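/- **Conventions.** Let $b(z,w)=-\bar z_1w_1-\bar z_2w_2+\bar z_3w_3$ on $\mathbb C^3$, and $H^5_2(-1)=\{z\in\mathbb C^3: b(z,z)=-1\}$. Let $\pi:H^5_2(-1)\to CH^2_1(-4)$, $z\mapsto z\cdot\mathbb C^*$, be the Hopf fibration. $CH^2_1(-4)$ carries its complex structure $J$ and the pseudo-Riemannian metric $\langle\,,\rangle$ of complex index one for which $\pi$ is a Riemannian submersion, $H^5_2(-1)$ carrying the metric induced by $\operatorname{Re} b$. A surface $L:M\to CH^2_1(-4)$ is *minimal* if its mean curvature vector vanishes, and *flat* if the curvature tensor of the induced metric vanishes. It is *slant* if there is a constant $\alpha\in\mathbb R$ such that at each point the tangent plane has a frame with $\langle e_1,e_1\rangle=\langle e_2,e_2\rangle=0$, $\langle e_1,e_2\rangle=-1$ (so the induced metric is Lorentzian), $Pe_1=(\sinh\alpha)e_1$ and $Pe_2=-(\sinh\alpha)e_2$, where $PX$ is the tangential component of $JX$. It is *Lagrangian* if $J$ maps tangent vectors to normal vectors. **Theorem 7.1.** Let $M$ be a connected smooth surface and let $L:M\to CH^2_1(-4)$ be a smooth map that makes $M$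 a minimal flat slant surface in the Lorentzian complex hyperbolic plane $CH^2_1(-4)$. Then $L$ is Lagrangian. Moreover, $L$ is congruent to $\pi\circ\tilde L$, where $$\tilde L(x,y)=\frac1{\sqrt3}\Big(\sqrt2\,e^{-\frac{i}{2a}(x+a^2y)}\cosh\big(\tfrac{\sqrt3}{2a}(x-a^2y)\big),\ e^{i(ay+\frac xa)},\ \sqrt2\,e^{-\frac{i}{2a}(x+a^2y)}\sinh\big(\tfrac{\sqrt3}{2a}(x-a^2y)\big)\Big)\in H^5_2(-1)$$ and $a$ is a nonzero real number. That is, there are a real number $a\ne0$ and a $b$-unitary linear map $A$ of $\mathbb C^3$, which induces a holomorphic isometry $\phi_A$ of $CH^2_1(-4)$, such that every point of $M$ has an open neighbourhood with smooth local coordinates $(x,y)$ in which $\phi_A\circ L=\pi\circ\tilde L(x,y)$. -/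

import Mathlib

open scoped ContDiff Manifold ComplexConjugate

noncomputable section

/-! ### The space `H⁵₂(-1)` and the Lorentzian complex hyperbolic plane `CH²₁(-4)` -/

/-- The Hermitian form `b_{2,3}(z,w) = -z̄₁w₁ - z̄₂w₂ + z̄₃w₃` on `ℂ³`. -/
def hermForm (z w : Fin 3 → ℂ) : ℂ :=
  -(conj (z 0) * w 0) - conj (z 1) * w 1 + conj (z 2) * w 2

/-- `H⁵₂(-1) = {z ∈ ℂ³ : b_{2,3}(z,z) = -1}`. -/
def H52 : Set (Fin 3 → ℂ) := {z | hermForm z z = -1}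

theorem hermForm_smul_smul (c d : ℂ) (z w : Fin 3 → ℂ) :
    hermForm (c • z) (d • w) = conj c * d * hermForm z w := by
  simp only [hermForm, Pi.smul_apply, smul_eq_mul, map_mul]; ring

theorem hermForm_self_im (z : Fin 3 → ℂ) : (hermForm z z).im = 0 := by
  simp [hermForm]; ring

theorem hermForm_self_eq (z : Fin 3 → ℂ) : hermForm z z = ((hermForm z z).re : ℂ) :=
  Complex.ext (by simp) (by simp [hermForm_self_im])

/-- Two points of `H⁵₂(-1)` are identified when they span the same complex line. -/
instance CH21.setoid : Setoid H52 where
  r z w := ∃ c : ℂ, c ≠ 0 ∧ (w : Fin 3 → ℂ) = c • (z : Fin 3 → ℂ)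
  iseqv :=
    { refl := fun z => ⟨1, one_ne_zero, by simp⟩
      symm := by
        rintro z w ⟨c, hc, h⟩
        exact ⟨c⁻¹, inv_ne_zero hc, by rw [h, smul_smul, inv_mul_cancel₀ hc, one_smul]⟩
      trans := by
        rintro x y z ⟨c, hc, h⟩ ⟨d, hd, h'⟩
        exact ⟨d * c, mul_ne_zero hd hc, by rw [h', h, smul_smul]⟩ }

/-- The Lorentzian complex hyperbolic plane `CH²₁(-4)` as a set of points, with the quotient
topology of `H⁵₂(-1)`. -/
def CH21 : Type := Quotient CH21.setoid

instance CH21.topologicalSpace : TopologicalSpace CH21 :=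
  inferInstanceAs (TopologicalSpace (Quotient CH21.setoid))

/-- The Hopf fibration `π : H⁵₂(-1) → CH²₁(-4)`, `z ↦ z·ℂ*`. -/
def hopf (z : H52) : CH21 := Quotient.mk CH21.setoid z

/-! #### The affine (inhomogeneous) coordinates, which make `CH²₁(-4)` a manifold -/

/-- Inhomogeneous coordinates `(z_j / z_i)_{j ≠ i}`. -/
def affineCoord (i : Fin 3) (z : Fin 3 → ℂ) : Fin 2 → ℂ := fun j => z (i.succAbove j) / z i

/-- The vector of `ℂ³` whose `i`-th entry is `1` and whose other entries are `w`. -/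
def affineVec (i : Fin 3) (w : Fin 2 → ℂ) : Fin 3 → ℂ := i.insertNth (α := fun _ => ℂ) 1 w

/-- The derivative of `affineVec i`: insert `0` in the `i`-th place. -/
def affineTan (i : Fin 3) (u : Fin 2 → ℂ) : Fin 3 → ℂ := i.insertNth (α := fun _ => ℂ) 0 u

theorem affineCoord_smul (i : Fin 3) {c : ℂ} (hc : c ≠ 0) (z : Fin 3 → ℂ) :
    affineCoord i (c • z) = affineCoord i z := by
  funext j
  simp [affineCoord, mul_div_mul_left _ _ hc]

theorem affineVec_affineCoord (i : Fin 3) {z : Fin 3 → ℂ} (hz : z i ≠ 0) :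
    affineVec i (affineCoord i z) = (z i)⁻¹ • z := by
  funext k
  refine Fin.succAboveCases i ?_ (fun j => ?_) k
  · simp [affineVec, hz]
  · simp [affineVec, affineCoord, div_eq_inv_mul]

theorem affineCoord_affineVec (i : Fin 3) (w : Fin 2 → ℂ) :
    affineCoord i (affineVec i w) = w := by
  funext j
  simp [affineCoord, affineVec]

theorem contDiff_affineVec (i : Fin 3) : ContDiff ℝ ∞ (affineVec i) := by
  rw [contDiff_pi]
  intro k
  refine Fin.succAboveCases i ?_ (fun j => ?_) k
  · simpa [affineVec] using contDiff_const
  · simpa [affineVec] using contDiff_apply ℝ ℂ j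

theorem contDiffOn_affineCoord (i : Fin 3) : ContDiffOn ℝ ∞ (affineCoord i) {z | z i ≠ 0} := by
  rw [contDiffOn_pi]
  intro j
  have h1 : ContDiffOn ℝ ∞ (fun z : Fin 3 → ℂ => z (i.succAbove j)) {z | z i ≠ 0} :=
    (contDiff_apply ℝ ℂ (i.succAbove j)).contDiffOn
  have h2 : ContDiffOn ℝ ∞ (fun z : Fin 3 → ℂ => z i) {z | z i ≠ 0} :=
    (contDiff_apply ℝ ℂ i).contDiffOn
  have h3 : ContDiffOn ℝ ∞ (fun z : Fin 3 → ℂ => z (i.succAbove j) * (z i)⁻¹) {z | z i ≠ 0} :=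
    h1.mul (h2.inv fun z hz => hz)
  exact h3

theorem continuous_hermForm_self : Continuous fun z : Fin 3 → ℂ => (hermForm z z).re := by
  unfold hermForm; fun_prop

/-- The positive multiple of a negative vector that lies on `H⁵₂(-1)`. -/
def normalizeVec (z : Fin 3 → ℂ) : Fin 3 → ℂ := (((√(-(hermForm z z).re))⁻¹ : ℝ) : ℂ) • z

theorem normalizeVec_mem {z : Fin 3 → ℂ} (hz : (hermForm z z).re < 0) : normalizeVec z ∈ H52 := by
  have h : 0 < -(hermForm z z).re := by linarith
  have h2 : √(-(hermForm z z).re) * √(-(hermForm z z).re) = -(hermForm z z).re :=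
    Real.mul_self_sqrt h.le
  show hermForm _ _ = -1
  rw [normalizeVec, hermForm_smul_smul, Complex.conj_ofReal, hermForm_self_eq z,
    Complex.ofReal_re]
  rw [← Complex.ofReal_mul, ← Complex.ofReal_mul, ← mul_inv, h2, inv_neg, neg_mul,
    inv_mul_cancel₀ hz.ne]
  simp

/-- A base point of `CH²₁(-4)`; it only serves as a default value. -/
def CH21.base : CH21 := hopf ⟨![1, 0, 0], by simp [H52, hermForm]⟩

theorem CH21.exists_rep (q : CH21) : ∃ z : H52, hopf z = q := Quotient.exists_rep q

theorem isQuotientMap_hopf : Topology.IsQuotientMap hopf := isQuotientMap_quotient_mk'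

/-- `z_i ≠ 0` on the complex line `q`. -/
def CH21.NonzeroAt (i : Fin 3) (q : CH21) : Prop :=
  Quotient.lift (fun z : H52 => (z : Fin 3 → ℂ) i ≠ 0)
    (by rintro z w ⟨c, hc, h⟩; simp [h, hc]) q

/-- The affine coordinates of the complex line `q`. -/
def CH21.coord (i : Fin 3) (q : CH21) : Fin 2 → ℂ :=
  Quotient.lift (fun z : H52 => affineCoord i (z : Fin 3 → ℂ))
    (by rintro z w ⟨c, hc, h⟩; simp only [h, affineCoord_smul i hc]) q

open Classical in
/-- The point of `CH²₁(-4)` with given affine coordinates. -/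
def CH21.ofCoord (i : Fin 3) (w : Fin 2 → ℂ) : CH21 :=
  if h : (hermForm (affineVec i w) (affineVec i w)).re < 0 then
    hopf ⟨normalizeVec (affineVec i w), normalizeVec_mem h⟩ else CH21.base

theorem CH21.nonzeroAt_hopf (i : Fin 3) (z : H52) :
    CH21.NonzeroAt i (hopf z) ↔ (z : Fin 3 → ℂ) i ≠ 0 := Iff.rfl

theorem CH21.coord_hopf (i : Fin 3) (z : H52) :
    CH21.coord i (hopf z) = affineCoord i (z : Fin 3 → ℂ) := rfl

theorem CH21.ofCoord_eq {i : Fin 3} {w : Fin 2 → ℂ}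
    (h : (hermForm (affineVec i w) (affineVec i w)).re < 0) :
    CH21.ofCoord i w = hopf ⟨normalizeVec (affineVec i w), normalizeVec_mem h⟩ := dif_pos h

theorem normalizeVec_factor_ne {z : Fin 3 → ℂ} (hz : (hermForm z z).re < 0) :
    (((√(-(hermForm z z).re))⁻¹ : ℝ) : ℂ) ≠ 0 := by
  have h : 0 < -(hermForm z z).re := by linarith
  exact Complex.ofReal_ne_zero.2 (inv_ne_zero (Real.sqrt_pos.2 h).ne')

theorem hermForm_affineVec_coord_neg {i : Fin 3} {z : H52} (hz : (z : Fin 3 → ℂ) i ≠ 0) :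
    (hermForm (affineVec i (affineCoord i z)) (affineVec i (affineCoord i z))).re < 0 := by
  have hz1 : hermForm (z : Fin 3 → ℂ) z = -1 := z.2
  rw [affineVec_affineCoord i hz, hermForm_smul_smul, hz1, Complex.conj_mul']
  have : 0 < ‖((z : Fin 3 → ℂ) i)⁻¹‖ := norm_pos_iff.2 (inv_ne_zero hz)
  rw [mul_neg_one, Complex.neg_re, ← Complex.ofReal_pow, Complex.ofReal_re]
  linarith [pow_pos this 2]

theorem CH21.isOpen_nonzeroAt (i : Fin 3) : IsOpen {q | CH21.NonzeroAt i q} := by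
  refine isQuotientMap_hopf.isOpen_preimage.1 ?_
  exact isOpen_ne_fun ((continuous_apply i).comp continuous_subtype_val) continuous_const

/-- The `i`-th affine chart of `CH²₁(-4)`, `z·ℂ* ↦ (z_j / z_i)_{j ≠ i}`, on `{z_i ≠ 0}`. -/
def CH21.chart (i : Fin 3) : OpenPartialHomeomorph CH21 (Fin 2 → ℂ) where
  toFun := CH21.coord i
  invFun := CH21.ofCoord i
  source := {q | CH21.NonzeroAt i q}
  target := {w | (hermForm (affineVec i w) (affineVec i w)).re < 0}
  map_source' := by
    intro q hq
    obtain ⟨z, rfl⟩ := q.exists_rep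
    exact hermForm_affineVec_coord_neg hq
  map_target' := by
    intro w hw
    have hw' : (hermForm (affineVec i w) (affineVec i w)).re < 0 := hw
    rw [CH21.ofCoord_eq hw']
    show normalizeVec (affineVec i w) i ≠ 0
    have h1 : affineVec i w i = 1 := by simp [affineVec]
    simpa only [normalizeVec, Pi.smul_apply, smul_eq_mul, h1, mul_one] using
      normalizeVec_factor_ne hw'
  left_inv' := by
    intro q hq
    obtain ⟨z, rfl⟩ := q.exists_rep
    have hz : (z : Fin 3 → ℂ) i ≠ 0 := hq
    have hlt := hermForm_affineVec_coord_neg hz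
    rw [CH21.coord_hopf, CH21.ofCoord_eq hlt]
    refine Quotient.sound (Setoid.symm ?_)
    refine ⟨_, mul_ne_zero (normalizeVec_factor_ne hlt) (inv_ne_zero hz), ?_⟩
    rw [mul_smul, ← affineVec_affineCoord i hz]
    rfl
  right_inv' := by
    intro w hw
    have hw' : (hermForm (affineVec i w) (affineVec i w)).re < 0 := hw
    rw [CH21.ofCoord_eq hw', CH21.coord_hopf]
    show affineCoord i (normalizeVec (affineVec i w)) = w
    rw [normalizeVec, affineCoord_smul i (normalizeVec_factor_ne hw'), affineCoord_affineVec]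
  open_source := CH21.isOpen_nonzeroAt i
  open_target := isOpen_lt
    (continuous_hermForm_self.comp (contDiff_affineVec i).continuous) continuous_const
  continuousOn_toFun := by
    refine (isQuotientMap_hopf.continuousOn_isOpen_iff (CH21.isOpen_nonzeroAt i)).2 ?_
    exact (contDiffOn_affineCoord i).continuousOn.comp continuous_subtype_val.continuousOn
      (fun z hz => hz)
  continuousOn_invFun := by
    rw [continuousOn_iff_continuous_domRestrict]
    have h1 : Continuous fun w : {w : Fin 2 → ℂ |
        (hermForm (affineVec i w) (affineVec i w)).re < 0} => affineVec i (w : Fin 2 → ℂ) :=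
      (contDiff_affineVec i).continuous.comp continuous_subtype_val
    have hN : Continuous fun w : {w : Fin 2 → ℂ |
        (hermForm (affineVec i w) (affineVec i w)).re < 0} =>
          normalizeVec (affineVec i (w : Fin 2 → ℂ)) := by
      unfold normalizeVec
      refine Continuous.smul (Complex.continuous_ofReal.comp (Continuous.inv₀ ?_ ?_)) h1
      · exact (continuous_hermForm_self.comp h1).neg.sqrt
      · intro w
        have hw : (hermForm (affineVec i w.1) (affineVec i w.1)).re < 0 := w.2
        exact (Real.sqrt_pos.2 (by linarith)).ne'
    have h2 : Continuous fun w : {w : Fin 2 → ℂ |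
        (hermForm (affineVec i w) (affineVec i w)).re < 0} =>
          hopf ⟨normalizeVec (affineVec i (w : Fin 2 → ℂ)), normalizeVec_mem w.2⟩ :=
      isQuotientMap_hopf.continuous.comp (hN.subtype_mk _)
    refine h2.congr (fun w => ?_)
    exact (CH21.ofCoord_eq w.2).symm

theorem CH21.exists_mem_source (q : CH21) : ∃ i, q ∈ (CH21.chart i).source := by
  obtain ⟨z, rfl⟩ := q.exists_rep
  by_contra! hcon
  have h : ∀ i, (z : Fin 3 → ℂ) i = 0 := fun i => by_contra fun hne => hcon i hne
  have hz1 : hermForm (z : Fin 3 → ℂ) z = -1 := z.2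
  simp [hermForm, h] at hz1

instance CH21.chartedSpace : ChartedSpace (Fin 2 → ℂ) CH21 where
  atlas := Set.range CH21.chart
  chartAt q := CH21.chart (CH21.exists_mem_source q).choose
  mem_chart_source q := (CH21.exists_mem_source q).choose_spec
  chart_mem_atlas _ := Set.mem_range_self _

/-- `CH²₁(-4)` is a smooth manifold of real dimension four. -/
instance CH21.isManifold : IsManifold 𝓘(ℝ, Fin 2 → ℂ) ∞ CH21 := by
  refine isManifold_of_contDiffOn _ _ _ ?_
  rintro _ _ ⟨i, rfl⟩ ⟨j, rfl⟩
  simp only [modelWithCornersSelf_coe, modelWithCornersSelf_coe_symm, Function.comp_id,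
    Function.id_comp, Set.range_id, Set.inter_univ, Set.preimage_id]
  have key : ∀ w ∈ ((CH21.chart i).symm.trans (CH21.chart j)).source,
      affineVec i w j ≠ 0 ∧
      ((CH21.chart i).symm.trans (CH21.chart j)) w = affineCoord j (affineVec i w) := by
    intro w hw
    rw [OpenPartialHomeomorph.trans_source] at hw
    have hw1 : (hermForm (affineVec i w) (affineVec i w)).re < 0 := hw.1
    have hw2 : (CH21.chart i).symm w ∈ (CH21.chart j).source := hw.2
    have he : (CH21.chart i).symm w
        = hopf ⟨normalizeVec (affineVec i w), normalizeVec_mem hw1⟩ := dif_pos hw1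
    have h3 : (((√(-(hermForm (affineVec i w) (affineVec i w)).re))⁻¹ : ℝ) : ℂ) ≠ 0 := by
      have h : 0 < -(hermForm (affineVec i w) (affineVec i w)).re := by linarith
      exact_mod_cast inv_ne_zero (Real.sqrt_pos.2 h).ne'
    rw [he] at hw2
    have hw3 : normalizeVec (affineVec i w) j ≠ 0 := hw2
    refine ⟨fun h0 => hw3 (by simp [normalizeVec, h0]), ?_⟩
    rw [OpenPartialHomeomorph.coe_trans, Function.comp_apply, he]
    show affineCoord j (normalizeVec (affineVec i w)) = _
    rw [normalizeVec, affineCoord_smul j h3]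
  refine ContDiffOn.congr (f := fun w => affineCoord j (affineVec i w)) ?_
    (fun w hw => (key w hw).2)
  exact (contDiffOn_affineCoord j).comp (contDiff_affineVec i).contDiffOn
    (fun w hw => (key w hw).1)

/-- The component of `ξ ∈ ℂ³` that is `b_{2,3}`-orthogonal to `z`, that is, the horizontal part
of `ξ` with respect to the Hopf fibration. -/
def horizontal (z ξ : Fin 3 → ℂ) : Fin 3 → ℂ := ξ - (hermForm z ξ / hermForm z z) • z

/-- The metric of `CH²₁(-4)` in the `i`-th affine chart, at the point `w` and on the tangent
vectors `u, v`. With `Z = affineVec i w` and `z = Z / √(-b(Z,Z)) ∈ H⁵₂(-1)`, the horizontal lift of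
`u` to `z` is `horizontal Z (affineTan i u) / √(-b(Z,Z))`, and the metric is the real part of
`b_{2,3}` on horizontal lifts. -/
def chMetric (i : Fin 3) (w u v : Fin 2 → ℂ) : ℝ :=
  (hermForm (horizontal (affineVec i w) (affineTan i u))
    (horizontal (affineVec i w) (affineTan i v))).re /
    (-(hermForm (affineVec i w) (affineVec i w)).re)

/-- `π` is a Riemannian submersion for `chMetric`: on vectors `ξ, η` that are horizontal at
`z ∈ H⁵₂(-1)` its differential, in affine coordinates, takes the real part of `b_{2,3}` to
`chMetric`. -/
theorem chMetric_submersion (i : Fin 3) (z : H52) (hz : (z : Fin 3 → ℂ) i ≠ 0)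
    (ξ η : Fin 3 → ℂ) (hξ : hermForm z ξ = 0) (hη : hermForm z η = 0) :
    chMetric i (affineCoord i z) (fderiv ℝ (affineCoord i) z ξ) (fderiv ℝ (affineCoord i) z η) =
      (hermForm ξ η).re := by
  have hz1 : hermForm (z : Fin 3 → ℂ) z = -1 := z.2
  generalize (z : Fin 3 → ℂ) = z at *
  have hd : ∀ ζ : Fin 3 → ℂ, affineTan i (fderiv ℝ (affineCoord i) z ζ) =
      (z i)⁻¹ • ζ - (ζ i / z i) • affineVec i (affineCoord i z) := by
    intro ζ
    have hp : ∀ k : Fin 3, HasFDerivAt (fun y : Fin 3 → ℂ => y k)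
        (ContinuousLinearMap.proj (R := ℝ) (φ := fun _ : Fin 3 => ℂ) k) z :=
      fun k => (ContinuousLinearMap.proj (R := ℝ) (φ := fun _ : Fin 3 => ℂ) k).hasFDerivAt
    have hf : HasFDerivAt (affineCoord i) (ContinuousLinearMap.pi fun j : Fin 2 =>
        z (i.succAbove j) • (-(z i ^ 2)⁻¹ •
            ContinuousLinearMap.proj (R := ℝ) (φ := fun _ : Fin 3 => ℂ) i) +
          (z i)⁻¹ • ContinuousLinearMap.proj (R := ℝ) (φ := fun _ : Fin 3 => ℂ)
            (i.succAbove j)) z := by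
      rw [hasFDerivAt_pi]
      intro j
      have hinv : HasFDerivAt (fun y : Fin 3 → ℂ => (y i)⁻¹)
          (-(z i ^ 2)⁻¹ • ContinuousLinearMap.proj (R := ℝ) (φ := fun _ : Fin 3 => ℂ) i) z :=
        ((hasDerivAt_inv hz).comp_hasFDerivAt_of_eq z (hp i) rfl)
      simp only [affineCoord, div_eq_mul_inv]
      exact (hp (i.succAbove j)).mul hinv
    rw [hf.fderiv]
    funext k
    refine Fin.succAboveCases i ?_ (fun j => ?_) k
    · simp [affineTan, affineVec, div_eq_inv_mul]
    · simp [affineTan, affineVec, affineCoord]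
      field_simp
      ring
  have hh : ∀ ζ : Fin 3 → ℂ, hermForm z ζ = 0 →
      horizontal (affineVec i (affineCoord i z))
        (affineTan i (fderiv ℝ (affineCoord i) z ζ)) = (z i)⁻¹ • ζ := by
    intro ζ hζ
    rw [hd, affineVec_affineCoord i hz]
    have e1 : hermForm ((z i)⁻¹ • z) ((z i)⁻¹ • ζ - (ζ i / z i) • (z i)⁻¹ • z) =
        -(ζ i / z i) * hermForm ((z i)⁻¹ • z) ((z i)⁻¹ • z) := by
      have : hermForm ((z i)⁻¹ • z) ((z i)⁻¹ • ζ - (ζ i / z i) • (z i)⁻¹ • z) =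
          hermForm ((z i)⁻¹ • z) ((z i)⁻¹ • ζ)
            - (ζ i / z i) * hermForm ((z i)⁻¹ • z) ((z i)⁻¹ • z) := by
        simp only [hermForm, Pi.sub_apply, Pi.smul_apply, smul_eq_mul]; ring
      rw [this, hermForm_smul_smul (z i)⁻¹ (z i)⁻¹ z ζ, hζ]; ring
    have e2 : hermForm ((z i)⁻¹ • z) ((z i)⁻¹ • z) ≠ 0 := by
      rw [hermForm_smul_smul, hz1]; simp [hz]
    rw [horizontal, e1, mul_div_assoc, div_self e2]
    simp
  rw [chMetric, hh ξ hξ, hh η hη, affineVec_affineCoord i hz, hermForm_smul_smul,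
    hermForm_smul_smul, hz1, Complex.conj_mul', ← Complex.ofReal_pow, Complex.re_ofReal_mul,
    mul_neg_one, Complex.neg_re, Complex.ofReal_re, neg_neg]
  have : ‖(z i)⁻¹‖ ^ 2 ≠ 0 := pow_ne_zero 2 (norm_ne_zero_iff.2 (inv_ne_zero hz))
  exact mul_div_cancel_left₀ _ this

/-! ### Pseudo-Riemannian geometry in local coordinates -/

/-- The Christoffel symbols (Levi-Civita connection) of a metric `g` on an open part of a vector
space: `christoffel g x u v` is `∇_u v` at `x` for the constant vector fields `u` and `v`, that is,
the vector given by the Koszul formula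
`2 g(∇_u v, w) = u g(v,w) + v g(u,w) - w g(u,v)` for all `w`
(unique where `g` is nondegenerate). -/
def christoffel {E : Type*} [NormedAddCommGroup E] [NormedSpace ℝ E] (g : E → E → E → ℝ)
    (x u v : E) : E :=
  Classical.epsilon fun Γ : E => ∀ w : E, 2 * g x Γ w =
    fderiv ℝ (fun y => g y v w) x u + fderiv ℝ (fun y => g y u w) x v
      - fderiv ℝ (fun y => g y u v) x w

/-- The curvature tensor `R(u,v)w = ∇_u ∇_v w - ∇_v ∇_u w` for constant vector fields. -/
def curvature {E : Type*} [NormedAddCommGroup E] [NormedSpace ℝ E] (g : E → E → E → ℝ)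
    (x u v w : E) : E :=
  (fderiv ℝ (fun y => christoffel g y v w) x u + christoffel g x u (christoffel g x v w))
    - (fderiv ℝ (fun y => christoffel g y u w) x v + christoffel g x v (christoffel g x u w))

/-- The metric induced by a map `f` from the metric `g` of the target. -/
def inducedMetric {E F : Type*} [NormedAddCommGroup E] [NormedSpace ℝ E]
    [NormedAddCommGroup F] [NormedSpace ℝ F] (g : F → F → F → ℝ) (f : E → F) (x u v : E) : ℝ :=
  g (f x) (fderiv ℝ f x u) (fderiv ℝ f x v)

/-- The second fundamental form, by the formula of Gauss `h(u,v) = ∇̃_u v - ∇_u v`, where `∇̃` is the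
Levi-Civita connection of the ambient metric `g`, and `∇` that of the induced metric. -/
def secondFundForm {E F : Type*} [NormedAddCommGroup E] [NormedSpace ℝ E]
    [NormedAddCommGroup F] [NormedSpace ℝ F] (g : F → F → F → ℝ) (f : E → F) (x u v : E) : F :=
  (fderiv ℝ (fun y => fderiv ℝ f y v) x u + christoffel g (f x) (fderiv ℝ f x u) (fderiv ℝ f x v))
    - fderiv ℝ f x (christoffel (inducedMetric g f) x u v)

/-- The `k`-th coordinate vector of `ℝ²`. -/
abbrev coordVec (k : Fin 2) : EuclideanSpace ℝ (Fin 2) := EuclideanSpace.single k 1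

/-- The mean curvature vector `H = ½ trace h = ½ Σ g^{kl} h(∂_k, ∂_l)` of a surface. -/
def meanCurvature {F : Type*} [NormedAddCommGroup F] [NormedSpace ℝ F] (g : F → F → F → ℝ)
    (f : EuclideanSpace ℝ (Fin 2) → F) (x : EuclideanSpace ℝ (Fin 2)) : F :=
  (1 / 2 : ℝ) • ∑ k, ∑ l,
    (Matrix.of fun m n => inducedMetric g f x (coordVec m) (coordVec n))⁻¹ k l •
      secondFundForm g f x (coordVec k) (coordVec l)

/-! ### Surfaces in `CH²₁(-4)` -/

section Surfaces

variable {M : Type*} [TopologicalSpace M] [ChartedSpace (EuclideanSpace ℝ (Fin 2)) M]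

/-- The expression of `L : M → CH²₁(-4)` in a chart `e` of `M` and the `i`-th affine chart. -/
def coordMap (L : M → CH21) (e : OpenPartialHomeomorph M (EuclideanSpace ℝ (Fin 2))) (i : Fin 3) :
    EuclideanSpace ℝ (Fin 2) → (Fin 2 → ℂ) := fun x => CH21.chart i (L (e.symm x))

/-- The set on which the coordinate expression is meaningful. -/
def coordDomain (L : M → CH21) (e : OpenPartialHomeomorph M (EuclideanSpace ℝ (Fin 2)))
    (i : Fin 3) : Set (EuclideanSpace ℝ (Fin 2)) :=
  {x | x ∈ e.target ∧ L (e.symm x) ∈ (CH21.chart i).source}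

/-- `P f i x` holds for all coordinate expressions `f` of `L`, in any smooth chart of `M` and any
affine chart `i` of `CH²₁(-4)`, at all points `x` where they are defined. -/
def InAllCoordinates (L : M → CH21)
    (P : (EuclideanSpace ℝ (Fin 2) → (Fin 2 → ℂ)) → Fin 3 → EuclideanSpace ℝ (Fin 2) → Prop) :
    Prop :=
  ∀ e ∈ IsManifold.maximalAtlas (𝓡 2) ∞ M, ∀ i : Fin 3, ∀ x ∈ coordDomain L e i,
    P (coordMap L e i) i x

/-- `ξ`, a tangent vector of `CH²₁(-4)` at `f x`, is normal to the surface. -/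
def IsNormalTo (f : EuclideanSpace ℝ (Fin 2) → (Fin 2 → ℂ)) (i : Fin 3)
    (x : EuclideanSpace ℝ (Fin 2)) (ξ : Fin 2 → ℂ) : Prop :=
  ∀ u, chMetric i (f x) ξ (fderiv ℝ f x u) = 0

/-- Minimal surface: the mean curvature vector vanishes. -/
def IsMinimalSurface (L : M → CH21) : Prop :=
  InAllCoordinates L fun f i x => meanCurvature (chMetric i) f x = 0

/-- Flat surface: the curvature tensor of the induced metric vanishes. -/
def IsFlatSurface (L : M → CH21) : Prop :=
  InAllCoordinates L fun f i x => ∀ u v w, curvature (inducedMetric (chMetric i) f) x u v w = 0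

/-- `α`-slant surface: at each point there is a pseudo-orthonormal frame `e₁, e₂` of the tangent
plane, `⟨e₁,e₁⟩ = ⟨e₂,e₂⟩ = 0`, `⟨e₁,e₂⟩ = -1` (so the surface is immersed and Lorentzian), such that
the tangential component `P` of the complex structure `J` (multiplication by `i` in affine
coordinates) satisfies `P e₁ = (sinh α) e₁` and `P e₂ = -(sinh α) e₂`. -/
def IsSlantWithAngle (L : M → CH21) (α : ℝ) : Prop :=
  InAllCoordinates L fun f i x => ∃ e₁ e₂ : EuclideanSpace ℝ (Fin 2),
    inducedMetric (chMetric i) f x e₁ e₁ = 0 ∧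
    inducedMetric (chMetric i) f x e₂ e₂ = 0 ∧
    inducedMetric (chMetric i) f x e₁ e₂ = -1 ∧
    IsNormalTo f i x (Complex.I • fderiv ℝ f x e₁ - fderiv ℝ f x (Real.sinh α • e₁)) ∧
    IsNormalTo f i x (Complex.I • fderiv ℝ f x e₂ - fderiv ℝ f x (-Real.sinh α • e₂))

/-- Slant surface: the Wirtinger angle is constant. -/
def IsSlantSurface (L : M → CH21) : Prop := ∃ α : ℝ, IsSlantWithAngle L α

/-- Lagrangian surface: `J` maps tangent vectors to normal vectors. -/
def IsLagrangianSurface (L : M → CH21) : Prop :=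
  InAllCoordinates L fun f i x => ∀ u, IsNormalTo f i x (Complex.I • fderiv ℝ f x u)

end Surfaces

/-! ### Congruences and the explicit surface -/

/-- The unitary group of `b_{2,3}`. -/
def HermUnitary : Type :=
  {A : (Fin 3 → ℂ) ≃ₗ[ℂ] (Fin 3 → ℂ) // ∀ z w, hermForm (A z) (A w) = hermForm z w}

/-- The holomorphic isometry `z·ℂ* ↦ (A z)·ℂ*` of `CH²₁(-4)` that a unitary map `A` induces. -/
def HermUnitary.congruence (A : HermUnitary) : CH21 → CH21 :=
  Quotient.map (fun z : H52 => (⟨A.1 z, (A.2 z z).trans z.2⟩ : H52))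
    (by
      rintro z w ⟨c, hc, h⟩
      exact ⟨c, hc, by simp [h]⟩)

/-- The `ℂ³`-valued map `L̃` with parameter `a`. -/
def tildeLVec (a x y : ℝ) : Fin 3 → ℂ :=
  ((1 / √3 : ℝ) : ℂ) •
    ![((√2 : ℝ) : ℂ) * Complex.exp (-(Complex.I / (2 * a)) * (x + a ^ 2 * y)) *
        (Real.cosh (√3 / (2 * a) * (x - a ^ 2 * y)) : ℂ),
      Complex.exp (Complex.I * (a * y + x / a)),
      ((√2 : ℝ) : ℂ) * Complex.exp (-(Complex.I / (2 * a)) * (x + a ^ 2 * y)) *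
        (Real.sinh (√3 / (2 * a) * (x - a ^ 2 * y)) : ℂ)]

theorem tildeLVec_mem (a x y : ℝ) : tildeLVec a x y ∈ H52 := by
  have e1 : -(Complex.I / (2 * a)) * (x + a ^ 2 * y)
      = ((-(1 / (2 * a)) * (x + a ^ 2 * y) : ℝ) : ℂ) * Complex.I := by push_cast; ring
  have e2 : Complex.I * (a * y + x / a) = ((a * y + x / a : ℝ) : ℂ) * Complex.I := by
    push_cast; ring
  have hexp : ∀ t : ℝ, conj (Complex.exp (t * Complex.I)) * Complex.exp (t * Complex.I) = 1 := by
    intro t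
    rw [Complex.conj_mul', Complex.norm_exp_ofReal_mul_I]; simp
  have h2 : ((√2 : ℝ) : ℂ) * ((√2 : ℝ) : ℂ) = 2 := by
    rw [← Complex.ofReal_mul, Real.mul_self_sqrt (by norm_num)]; norm_num
  have h3 : ((1 / √3 : ℝ) : ℂ) * ((1 / √3 : ℝ) : ℂ) = 1 / 3 := by
    rw [← Complex.ofReal_mul, div_mul_div_comm, Real.mul_self_sqrt (by norm_num)]; norm_num
  have hcs : (Real.cosh (√3 / (2 * a) * (x - a ^ 2 * y)) : ℂ) ^ 2
      - (Real.sinh (√3 / (2 * a) * (x - a ^ 2 * y)) : ℂ) ^ 2 = 1 := by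
    exact_mod_cast Real.cosh_sq_sub_sinh_sq _
  show hermForm _ _ = -1
  rw [tildeLVec, hermForm_smul_smul, Complex.conj_ofReal, h3, e1, e2]
  have p1 := hexp (-(1 / (2 * a)) * (x + a ^ 2 * y))
  have p2 := hexp (a * y + x / a)
  generalize Complex.exp (((-(1 / (2 * a)) * (x + a ^ 2 * y) : ℝ) : ℂ) * Complex.I) = E at *
  generalize Complex.exp (((a * y + x / a : ℝ) : ℂ) * Complex.I) = F at *
  generalize Real.cosh (√3 / (2 * a) * (x - a ^ 2 * y)) = C at *
  generalize Real.sinh (√3 / (2 * a) * (x - a ^ 2 * y)) = S at *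
  simp only [hermForm, Matrix.cons_val_zero, Matrix.cons_val_one, Matrix.cons_val, map_mul,
    Complex.conj_ofReal]
  linear_combination (-(1 / 3 : ℂ)) * p2 - (1 / 3) * (C ^ 2 - S ^ 2) * (conj E * E) * h2
    - (2 / 3) * (C ^ 2 - S ^ 2) * p1 - (2 / 3) * hcs

/-- The explicit map `L̃` into `H⁵₂(-1)`. -/
def tildeL (a x y : ℝ) : H52 := ⟨tildeLVec a x y, tildeLVec_mem a x y⟩

end

noncomputable section

/-!
Locally, lift the surface to the cone of negative vectors in `ℂ³` and differentiate covariantly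
along the lift. Around each point there is a smooth null frame `n₁`, `n₂` with `⟨n₁, n₂⟩ = -1`, and
minimality says that `∇_{n₁} n₂` has no normal component. The imaginary part of the Ricci identity
for this frame reads `3 sinh α = 0`, so the surface is Lagrangian. The cubic form then has only the
two components belonging to `n₁` and to `n₂`; the Gauss equation and flatness make the product of
these coefficients `-1`, and a rescaling of the frame makes both equal to `i`. The Codazzi equation
now says that the frame is parallel, so its dual coframe is closed and gives null coordinates `x`,
`y`. In them the lift solves a linear system with constant coefficients, whose solution is unique
up to a unitary map; the explicit surface with `a = 1` is one.

These local unitary maps can be taken equal because two unitary images of the explicit surface with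
`a = 1` that meet in an open set differ by an affine change of coordinates: the null frames agree
up to order, so the coordinates agree up to a translation and an exchange.
-/

theorem hermForm_add_left (x y z : Fin 3 → ℂ) :
    hermForm (x + y) z = hermForm x z + hermForm y z := by
  simp only [hermForm, Pi.add_apply, map_add]; ring

theorem hermForm_add_right (x y z : Fin 3 → ℂ) :
    hermForm x (y + z) = hermForm x y + hermForm x z := by
  simp only [hermForm, Pi.add_apply]; ring

theorem hermForm_smul_left (c : ℂ) (x y : Fin 3 → ℂ) :
    hermForm (c • x) y = conj c * hermForm x y := by
  simp only [hermForm, Pi.smul_apply, smul_eq_mul, map_mul]; ring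

theorem hermForm_smul_right (c : ℂ) (x y : Fin 3 → ℂ) :
    hermForm x (c • y) = c * hermForm x y := by
  simp only [hermForm, Pi.smul_apply, smul_eq_mul]; ring

theorem conj_hermForm (x y : Fin 3 → ℂ) : conj (hermForm x y) = hermForm y x := by
  simp only [hermForm, map_add, map_sub, map_neg, map_mul, Complex.conj_conj]; ring

theorem hermForm_self_ne_zero {z : Fin 3 → ℂ} (h : (hermForm z z).re < 0) : hermForm z z ≠ 0 :=
  fun h0 => by simp [h0] at h

/-- The Hermitian form as a continuous real bilinear map, to which the product rule applies. -/
def hermCLM : (Fin 3 → ℂ) →L[ℝ] (Fin 3 → ℂ) →L[ℝ] ℂ :=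
  LinearMap.toContinuousLinearMap <|
    (LinearMap.toContinuousLinearMap (𝕜 := ℝ) (E := Fin 3 → ℂ) (F' := ℂ)).toLinearMap ∘ₗ
      LinearMap.mk₂ ℝ hermForm hermForm_add_left
        (fun r x y => by
          simpa [Complex.real_smul] using hermForm_smul_left (r : ℂ) x y)
        hermForm_add_right
        (fun r x y => by
          simpa [Complex.real_smul] using hermForm_smul_right (r : ℂ) x y)

@[simp] theorem hermCLM_apply (x y : Fin 3 → ℂ) : hermCLM x y = hermForm x y := rfl

/-- The Hermitian form `b(x, y) / -b(Z, Z)` at a negative vector `Z`. It takes the value `-1` on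
`Z`, so that representatives of points of `CH²₁(-4)` need not lie on `H⁵₂(-1)`. On the orthogonal
complement of `Z` its real part is the metric of `CH²₁(-4)`. -/
def normForm (Z x y : Fin 3 → ℂ) : ℂ := (((-(hermForm Z Z).re)⁻¹ : ℝ) : ℂ) * hermForm x y

section normForm
variable (Z x y z : Fin 3 → ℂ) (c : ℂ)

theorem normForm_add_left : normForm Z (x + y) z = normForm Z x z + normForm Z y z := by
  simp only [normForm, hermForm_add_left]; ring

theorem normForm_add_right : normForm Z x (y + z) = normForm Z x y + normForm Z x z := by
  simp only [normForm, hermForm_add_right]; ring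

theorem normForm_smul_left : normForm Z (c • x) y = conj c * normForm Z x y := by
  simp only [normForm, hermForm_smul_left]; ring

theorem normForm_smul_right : normForm Z x (c • y) = c * normForm Z x y := by
  simp only [normForm, hermForm_smul_right]; ring

theorem normForm_neg_left : normForm Z (-x) y = -normForm Z x y := by
  simpa using normForm_smul_left Z x y (-1)

theorem normForm_sub_left : normForm Z (x - y) z = normForm Z x z - normForm Z y z := by
  rw [sub_eq_add_neg, normForm_add_left, normForm_neg_left, sub_eq_add_neg]

theorem conj_normForm : conj (normForm Z x y) = normForm Z y x := by
  simp only [normForm, map_mul, Complex.conj_ofReal, conj_hermForm]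

theorem normForm_zero_left : normForm Z 0 y = 0 := by
  simpa using normForm_smul_left Z 0 y 0

theorem normForm_zero_right : normForm Z x 0 = 0 := by
  simpa using normForm_smul_right Z x 0 0

theorem normForm_self_im : (normForm Z x x).im = 0 := by
  simp [normForm, hermForm_self_im]

theorem normForm_re_comm : (normForm Z x y).re = (normForm Z y x).re := by
  rw [← conj_normForm, Complex.conj_re]

theorem normForm_im_comm : (normForm Z x y).im = -(normForm Z y x).im := by
  rw [← conj_normForm, Complex.conj_im]

variable {Z}

theorem normForm_self (hZ : (hermForm Z Z).re < 0) : normForm Z Z Z = -1 := by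
  rw [normForm, hermForm_self_eq Z, ← Complex.ofReal_mul, Complex.ofReal_re, inv_neg, neg_mul,
    inv_mul_cancel₀ hZ.ne, Complex.ofReal_neg, Complex.ofReal_one]

theorem normForm_eq_zero_iff (hZ : (hermForm Z Z).re < 0) :
    normForm Z x y = 0 ↔ hermForm x y = 0 := by
  have : (((-(hermForm Z Z).re)⁻¹ : ℝ) : ℂ) ≠ 0 :=
    Complex.ofReal_ne_zero.2 (inv_ne_zero (neg_ne_zero.2 hZ.ne))
  simp only [normForm, mul_eq_zero, this, false_or]

end normForm

theorem normForm_smul_smul_smul {κ : ℂ} (hκ : κ ≠ 0) (Z x y : Fin 3 → ℂ) :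
    normForm (κ • Z) (κ • x) (κ • y) = normForm Z x y := by
  have hnorm : ((‖κ‖ : ℝ) : ℂ) ≠ 0 := by simpa using hκ
  rw [normForm, hermForm_smul_smul, hermForm_smul_smul, Complex.conj_mul', ← Complex.ofReal_pow,
    Complex.re_ofReal_mul, ← mul_neg, mul_inv, normForm]
  push_cast
  field_simp

theorem normForm_of_hermForm_self {Z : Fin 3 → ℂ} (hZ : hermForm Z Z = -1) (x y : Fin 3 → ℂ) :
    normForm Z x y = hermForm x y := by
  simp [normForm, hZ]

/-- Vectors `Z, e₁, e₂` of `ℂ³` that have the Gram matrix `(-1) ⊕ (0, -c; -c̄, 0)` for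
`normForm Z`, where `c ≠ 0`. Then `e₁, e₂` is a null basis of the complement of `Z`, the model of
the tangent space of `CH²₁(-4)`. -/
structure IsNullBasis (Z e₁ e₂ : Fin 3 → ℂ) (c : ℂ) : Prop where
  neg : (hermForm Z Z).re < 0
  ne_zero : c ≠ 0
  orth₁ : normForm Z Z e₁ = 0
  orth₂ : normForm Z Z e₂ = 0
  null₁ : normForm Z e₁ e₁ = 0
  null₂ : normForm Z e₂ e₂ = 0
  pair : normForm Z e₁ e₂ = -c

namespace IsNullBasis

variable {Z e₁ e₂ : Fin 3 → ℂ} {c : ℂ} (h : IsNullBasis Z e₁ e₂ c)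
include h

theorem conj_ne_zero : conj c ≠ 0 := (map_ne_zero _).2 h.ne_zero

theorem pair_symm : normForm Z e₂ e₁ = -conj c := by rw [← conj_normForm, h.pair, map_neg]

theorem swap : IsNullBasis Z e₂ e₁ (conj c) :=
  ⟨h.neg, h.conj_ne_zero, h.orth₂, h.orth₁, h.null₂, h.null₁, h.pair_symm⟩

theorem smul {κ : ℂ} (hκ : κ ≠ 0) : IsNullBasis (κ • Z) (κ • e₁) (κ • e₂) c := by
  refine ⟨?_, h.ne_zero, ?_, ?_, ?_, ?_, ?_⟩
  · rw [hermForm_smul_smul, Complex.conj_mul', ← Complex.ofReal_pow, Complex.re_ofReal_mul]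
    exact mul_neg_of_pos_of_neg (pow_pos (norm_pos_iff.2 hκ) 2) h.neg
  all_goals rw [normForm_smul_smul_smul hκ]
  exacts [h.orth₁, h.orth₂, h.null₁, h.null₂, h.pair]

theorem unitary_map (A : HermUnitary) : IsNullBasis (A.1 Z) (A.1 e₁) (A.1 e₂) c := by
  have hA (x y : Fin 3 → ℂ) : normForm (A.1 Z) (A.1 x) (A.1 y) = normForm Z x y := by
    rw [normForm, A.2, A.2, normForm]
  exact ⟨by rw [A.2]; exact h.neg, h.ne_zero, by rw [hA, h.orth₁], by rw [hA, h.orth₂],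
    by rw [hA, h.null₁], by rw [hA, h.null₂], by rw [hA, h.pair]⟩

theorem normForm_base_comb (a b d : ℂ) : normForm Z Z (a • Z + b • e₁ + d • e₂) = -a := by
  simp [normForm_add_right, normForm_smul_right, normForm_self h.neg, h.orth₁, h.orth₂]

theorem normForm_left_comb (a b d : ℂ) : normForm Z e₁ (a • Z + b • e₁ + d • e₂) = -(d * c) := by
  have h0 : normForm Z e₁ Z = 0 := by rw [← conj_normForm, h.orth₁, map_zero]
  simp [normForm_add_right, normForm_smul_right, h0, h.null₁, h.pair]

theorem normForm_right_comb (a b d : ℂ) :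
    normForm Z e₂ (a • Z + b • e₁ + d • e₂) = -(b * conj c) := by
  rw [add_right_comm]
  exact h.swap.normForm_left_comb a d b

theorem comb_eq_zero {a b d : ℂ} (h0 : a • Z + b • e₁ + d • e₂ = 0) : a = 0 ∧ b = 0 ∧ d = 0 := by
  have ha := h.normForm_base_comb a b d
  have hd := h.normForm_left_comb a b d
  have hb := h.normForm_right_comb a b d
  rw [h0, normForm_zero_right] at ha hd hb
  exact ⟨by simpa using ha.symm, by simpa [h.ne_zero] using hb.symm,
    by simpa [h.ne_zero] using hd.symm⟩

theorem linearIndependent : LinearIndependent ℂ ![Z, e₁, e₂] := by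
  rw [Fintype.linearIndependent_iff]
  intro g hg
  obtain ⟨h0, h1, h2⟩ := h.comb_eq_zero (by simpa [Fin.sum_univ_three] using hg)
  intro i
  fin_cases i <;> assumption

/-- The basis of `ℂ³` formed by the three vectors. -/
def basis : Module.Basis (Fin 3) ℂ (Fin 3 → ℂ) :=
  basisOfLinearIndependentOfCardEqFinrank h.linearIndependent (by simp)

theorem basis_apply (k : Fin 3) : h.basis k = ![Z, e₁, e₂] k := by
  simp [basis]

theorem exists_eq_comb (x : Fin 3 → ℂ) : ∃ a b d : ℂ, x = a • Z + b • e₁ + d • e₂ := by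
  refine ⟨h.basis.repr x 0, h.basis.repr x 1, h.basis.repr x 2, ?_⟩
  conv_lhs => rw [← h.basis.sum_repr x]
  simp [Fin.sum_univ_three, h.basis_apply]

theorem eq_comb (x : Fin 3 → ℂ) : x = (-normForm Z Z x) • Z + (-(normForm Z e₂ x / conj c)) • e₁ +
    (-(normForm Z e₁ x / c)) • e₂ := by
  obtain ⟨a, b, d, rfl⟩ := h.exists_eq_comb x
  rw [h.normForm_base_comb, h.normForm_left_comb, h.normForm_right_comb, neg_neg, neg_div, neg_neg,
    neg_div, neg_neg, mul_div_cancel_right₀ _ h.conj_ne_zero, mul_div_cancel_right₀ _ h.ne_zero]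

end IsNullBasis

/-! ### Lifts and covariant derivatives -/

section CovDeriv

variable {E : Type*} [NormedAddCommGroup E] [NormedSpace ℝ E]

/-- A smooth local lift to `ℂ³` of a map into `CH²₁(-4)`: a smooth map of an open set into the cone
of negative vectors. -/
structure SmoothLift (Z : E → Fin 3 → ℂ) (U : Set E) : Prop where
  isOpen : IsOpen U
  contDiffOn : ContDiffOn ℝ ∞ Z U
  neg : ∀ x ∈ U, (hermForm (Z x) (Z x)).re < 0

/-- The connection form of the complex line bundle spanned by `Z`, normalized so that the covariant
derivative of `Z` itself is orthogonal to `Z`. -/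
def connForm (Z : E → Fin 3 → ℂ) (x : E) : E →L[ℝ] ℂ :=
  (-(hermForm (Z x) (Z x))⁻¹) • (hermCLM (Z x)).comp (fderiv ℝ Z x)

/-- Scalar multiplication, as a real bilinear map, with the vector as first argument. -/
def smulFlip : (Fin 3 → ℂ) →L[ℝ] ℂ →L[ℝ] (Fin 3 → ℂ) := (ContinuousLinearMap.lsmul ℝ ℂ).flip

@[simp] theorem smulFlip_apply (x : Fin 3 → ℂ) (c : ℂ) : smulFlip x c = c • x := rfl

/-- The covariant derivative of `ξ` along `Z`: the derivative of `ξ`, corrected by the connection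
form so that it is equivariant under a common rescaling of `Z` and `ξ`. -/
def covDeriv (Z ξ : E → Fin 3 → ℂ) (x : E) : E →L[ℝ] (Fin 3 → ℂ) :=
  fderiv ℝ ξ x + (smulFlip (ξ x)).comp (connForm Z x)

theorem connForm_apply (Z : E → Fin 3 → ℂ) (x u : E) :
    connForm Z x u = -(hermForm (Z x) (fderiv ℝ Z x u) / hermForm (Z x) (Z x)) := by
  simp [connForm, div_eq_inv_mul]

theorem covDeriv_apply (Z ξ : E → Fin 3 → ℂ) (x u : E) :
    covDeriv Z ξ x u = fderiv ℝ ξ x u + connForm Z x u • ξ x := by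
  simp [covDeriv]

theorem covDeriv_self_eq_horizontal (Z : E → Fin 3 → ℂ) (x u : E) :
    covDeriv Z Z x u = horizontal (Z x) (fderiv ℝ Z x u) := by
  rw [covDeriv_apply, connForm_apply, horizontal, neg_smul, sub_eq_add_neg]

variable {Z ξ η : E → Fin 3 → ℂ} {U : Set E} {x : E}

theorem normForm_covDeriv_self (h : (hermForm (Z x) (Z x)).re < 0) (u : E) :
    normForm (Z x) (Z x) (covDeriv Z Z x u) = 0 := by
  rw [normForm_eq_zero_iff _ _ h, covDeriv_apply, connForm_apply, hermForm_add_right,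
    hermForm_smul_right]
  field_simp [hermForm_self_ne_zero h]
  ring

theorem hasFDerivAt_hermForm {ξ' η' : E →L[ℝ] (Fin 3 → ℂ)} (hξ : HasFDerivAt ξ ξ' x)
    (hη : HasFDerivAt η η' x) :
    HasFDerivAt (fun y => hermForm (ξ y) (η y))
      (hermCLM.precompR E (ξ x) η' + hermCLM.precompL E ξ' (η x)) x :=
  hermCLM.hasFDerivAt_of_bilinear hξ hη

theorem contDiffOn_hermForm {n : WithTop ℕ∞} (hξ : ContDiffOn ℝ n ξ U) (hη : ContDiffOn ℝ n η U) :
    ContDiffOn ℝ n (fun y => hermForm (ξ y) (η y)) U :=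
  hermCLM.isBoundedBilinearMap.contDiff.comp_contDiffOn (hξ.prodMk hη)

theorem hasFDerivAt_normForm_scale (hZ : DifferentiableAt ℝ Z x)
    (h : (hermForm (Z x) (Z x)).re < 0) :
    HasFDerivAt (fun y => (((-(hermForm (Z y) (Z y)).re)⁻¹ : ℝ) : ℂ))
      ((((-(hermForm (Z x) (Z x)).re)⁻¹ : ℝ) : ℂ) •
        (connForm Z x + (Complex.conjCLE : ℂ →L[ℝ] ℂ).comp (connForm Z x))) x := by
  have hre := (Complex.reCLM.hasFDerivAt (x := hermForm (Z x) (Z x))).comp x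
    (hasFDerivAt_hermForm hZ.hasFDerivAt hZ.hasFDerivAt)
  have hinv := (hasDerivAt_inv (neg_ne_zero.2 h.ne)).comp_hasFDerivAt x hre.neg
  refine (Complex.ofRealCLM.hasFDerivAt.comp x hinv).congr_fderiv ?_
  ext u
  have hne : ((hermForm (Z x) (Z x)).re : ℂ) ≠ 0 := Complex.ofReal_ne_zero.2 h.ne
  have hsum : ((hermForm (Z x) (fderiv ℝ Z x u)).re : ℂ) + (hermForm (fderiv ℝ Z x u) (Z x)).re =
      hermForm (fderiv ℝ Z x u) (Z x) + hermForm (Z x) (fderiv ℝ Z x u) := by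
    rw [← conj_hermForm (Z x) (fderiv ℝ Z x u)]
    apply Complex.ext <;> simp
  simp only [ContinuousLinearMap.comp_apply, smul_apply, neg_apply, add_apply, Complex.reCLM_apply,
    Complex.ofRealCLM_apply, smul_eq_mul, ContinuousLinearMap.precompR_apply,
    ContinuousLinearMap.precompL_apply, ContinuousLinearMap.compL_apply, hermCLM_apply,
    Complex.add_re, Complex.ofReal_neg, Complex.ofReal_mul, Complex.ofReal_inv, Complex.ofReal_pow,
    Complex.ofReal_add, ContinuousLinearEquiv.coe_coe, Complex.conjCLE_apply, connForm_apply,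
    map_neg, map_div₀, conj_hermForm, hsum]
  rw [hermForm_self_eq (Z x), Complex.ofReal_re]
  field_simp
  ring

theorem differentiableAt_normForm (hZ : DifferentiableAt ℝ Z x) (hξ : DifferentiableAt ℝ ξ x)
    (hη : DifferentiableAt ℝ η x) (h : (hermForm (Z x) (Z x)).re < 0) :
    DifferentiableAt ℝ (fun y => normForm (Z y) (ξ y) (η y)) x :=
  (hasFDerivAt_normForm_scale hZ h).differentiableAt.mul
    (hasFDerivAt_hermForm hξ.hasFDerivAt hη.hasFDerivAt).differentiableAt

theorem fderiv_normForm (hZ : DifferentiableAt ℝ Z x) (hξ : DifferentiableAt ℝ ξ x)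
    (hη : DifferentiableAt ℝ η x) (h : (hermForm (Z x) (Z x)).re < 0) (u : E) :
    fderiv ℝ (fun y => normForm (Z y) (ξ y) (η y)) x u =
      normForm (Z x) (covDeriv Z ξ x u) (η x) + normForm (Z x) (ξ x) (covDeriv Z η x u) := by
  have hprod : fderiv ℝ (fun y => normForm (Z y) (ξ y) (η y)) x = _ :=
    ((hasFDerivAt_normForm_scale hZ h).mul
      (hasFDerivAt_hermForm hξ.hasFDerivAt hη.hasFDerivAt)).fderiv
  rw [hprod]
  simp only [add_apply, smul_apply, smul_eq_mul, ContinuousLinearMap.precompR_apply,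
    ContinuousLinearMap.precompL_apply, ContinuousLinearMap.compL_apply,
    ContinuousLinearMap.comp_apply, hermCLM_apply, ContinuousLinearEquiv.coe_coe,
    Complex.conjCLE_apply, normForm, covDeriv_apply, hermForm_add_left, hermForm_add_right,
    hermForm_smul_left, hermForm_smul_right]
  ring

theorem contDiffOn_fderiv {F : Type*} [NormedAddCommGroup F] [NormedSpace ℝ F] {f : E → F}
    (hU : IsOpen U) (hf : ContDiffOn ℝ ∞ f U) : ContDiffOn ℝ ∞ (fderiv ℝ f) U :=
  hf.fderiv_of_isOpen hU (by simp)

theorem covDeriv_congr {ξ' : E → Fin 3 → ℂ} (h : ξ =ᶠ[nhds x] ξ') :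
    covDeriv Z ξ x = covDeriv Z ξ' x := by
  rw [covDeriv, covDeriv, h.fderiv_eq, h.eq_of_nhds]

theorem covDeriv_add (hξ : DifferentiableAt ℝ ξ x) (hη : DifferentiableAt ℝ η x) (u : E) :
    covDeriv Z (fun y => ξ y + η y) x u = covDeriv Z ξ x u + covDeriv Z η x u := by
  simp only [covDeriv_apply]
  rw [fderiv_fun_add hξ hη, add_apply, smul_add]
  abel

theorem covDeriv_sub (hξ : DifferentiableAt ℝ ξ x) (hη : DifferentiableAt ℝ η x) (u : E) :
    covDeriv Z (fun y => ξ y - η y) x u = covDeriv Z ξ x u - covDeriv Z η x u := by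
  simp only [covDeriv_apply]
  rw [fderiv_fun_sub hξ hη, sub_apply, smul_sub]
  abel

theorem covDeriv_smul {f : E → ℂ} (hf : DifferentiableAt ℝ f x) (hξ : DifferentiableAt ℝ ξ x)
    (u : E) :
    covDeriv Z (fun y => f y • ξ y) x u = fderiv ℝ f x u • ξ x + f x • covDeriv Z ξ x u := by
  simp only [covDeriv_apply]
  rw [fderiv_fun_smul hf hξ]
  simp only [add_apply, smul_apply,
    ContinuousLinearMap.smulRight_apply, smul_add, smul_smul]
  rw [mul_comm (f x)]
  abel

theorem covDeriv_clm_apply {A : E → E →L[ℝ] (Fin 3 → ℂ)} {Y : E → E}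
    (hA : DifferentiableAt ℝ A x) (hY : DifferentiableAt ℝ Y x) (u : E) :
    covDeriv Z (fun y => A y (Y y)) x u =
      covDeriv Z (fun y => A y (Y x)) x u + A x (fderiv ℝ Y x u) := by
  simp only [covDeriv_apply]
  rw [(hA.hasFDerivAt.clm_apply hY.hasFDerivAt).fderiv,
    (hA.hasFDerivAt.clm_apply (hasFDerivAt_const (Y x) x)).fderiv]
  simp only [add_apply, ContinuousLinearMap.comp_apply, ContinuousLinearMap.flip_apply, zero_apply,
    map_zero, zero_add]
  abel

/-- The curvature form of the connection form, that is, its exterior derivative. -/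
def connCurv (Z : E → Fin 3 → ℂ) (x u v : E) : ℂ :=
  fderiv ℝ (connForm Z) x u v - fderiv ℝ (connForm Z) x v u

namespace SmoothLift

variable (h : SmoothLift Z U)
include h

theorem differentiableAt_of_contDiffOn {F : Type*} [NormedAddCommGroup F] [NormedSpace ℝ F]
    {f : E → F} (hf : ContDiffOn ℝ ∞ f U) (hx : x ∈ U) : DifferentiableAt ℝ f x :=
  (hf.contDiffAt (h.isOpen.mem_nhds hx)).differentiableAt (by simp)

theorem differentiableAt (hx : x ∈ U) : DifferentiableAt ℝ Z x :=
  h.differentiableAt_of_contDiffOn h.contDiffOn hx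

theorem contDiffOn_normForm (hξ : ContDiffOn ℝ ∞ ξ U) (hη : ContDiffOn ℝ ∞ η U) :
    ContDiffOn ℝ ∞ (fun y => normForm (Z y) (ξ y) (η y)) U := by
  refine ContDiffOn.mul ?_ (contDiffOn_hermForm hξ hη)
  refine Complex.ofRealCLM.contDiff.comp_contDiffOn (ContDiffOn.inv ?_ fun x hx =>
    neg_ne_zero.2 (h.neg x hx).ne)
  exact (Complex.reCLM.contDiff.comp_contDiffOn
    (contDiffOn_hermForm h.contDiffOn h.contDiffOn)).neg

theorem contDiffOn_connForm : ContDiffOn ℝ ∞ (connForm Z) U :=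
  (((contDiffOn_hermForm h.contDiffOn h.contDiffOn).inv
    fun x hx => hermForm_self_ne_zero (h.neg x hx)).neg).smul
    ((hermCLM.contDiff.comp_contDiffOn h.contDiffOn).clm_comp
      (contDiffOn_fderiv h.isOpen h.contDiffOn))

theorem contDiffOn_covDeriv (hξ : ContDiffOn ℝ ∞ ξ U) : ContDiffOn ℝ ∞ (covDeriv Z ξ) U :=
  (contDiffOn_fderiv h.isOpen hξ).add
    ((smulFlip.contDiff.comp_contDiffOn hξ).clm_comp h.contDiffOn_connForm)

theorem fderiv_covDeriv_apply (hξ : ContDiffOn ℝ ∞ ξ U) (hx : x ∈ U) (u v : E) :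
    fderiv ℝ (fun y => covDeriv Z ξ y v) x u = fderiv ℝ (fderiv ℝ ξ) x u v +
      (fderiv ℝ (connForm Z) x u v • ξ x + connForm Z x v • fderiv ℝ ξ x u) := by
  have hdξ := (h.differentiableAt_of_contDiffOn (contDiffOn_fderiv h.isOpen hξ)
    hx).hasFDerivAt.clm_apply (hasFDerivAt_const v x)
  have hconn := (h.differentiableAt_of_contDiffOn h.contDiffOn_connForm
    hx).hasFDerivAt.clm_apply (hasFDerivAt_const v x)
  have hsum := hdξ.add (hconn.smul (h.differentiableAt_of_contDiffOn hξ hx).hasFDerivAt)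
  have heq : (fun y => covDeriv Z ξ y v) =
      (fun y => fderiv ℝ ξ y v) + (fun y => connForm Z y v) • ξ := by
    funext y; simp [covDeriv_apply]
  rw [heq, hsum.fderiv]
  simp [add_comm]

/-- The Ricci identity for constant vector fields: the curvature of the covariant derivative is
multiplication by the curvature of the line bundle. -/
theorem covDeriv_covDeriv_sub (hξ : ContDiffOn ℝ ∞ ξ U) (hx : x ∈ U) (u v : E) :
    covDeriv Z (fun y => covDeriv Z ξ y v) x u - covDeriv Z (fun y => covDeriv Z ξ y u) x v =
      connCurv Z x u v • ξ x := by
  have hsymm := ((hξ.contDiffAt (h.isOpen.mem_nhds hx)).isSymmSndFDerivAt (by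
    simpa using WithTop.coe_le_coe.2 (le_top : (2 : ℕ∞) ≤ ⊤))).eq u v
  rw [covDeriv_apply _ (fun y => covDeriv Z ξ y v), covDeriv_apply _ (fun y => covDeriv Z ξ y u),
    h.fderiv_covDeriv_apply hξ hx, h.fderiv_covDeriv_apply hξ hx, hsymm, covDeriv_apply,
    covDeriv_apply, connCurv, sub_smul, smul_add, smul_add, smul_smul, smul_smul,
    mul_comm (connForm Z x u) (connForm Z x v)]
  abel

theorem covDeriv_covDeriv_sub_field (hξ : ContDiffOn ℝ ∞ ξ U) (hx : x ∈ U) {X Y : E → E}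
    (hX : DifferentiableAt ℝ X x) (hY : DifferentiableAt ℝ Y x) :
    covDeriv Z (fun y => covDeriv Z ξ y (Y y)) x (X x) -
        covDeriv Z (fun y => covDeriv Z ξ y (X y)) x (Y x) =
      covDeriv Z ξ x (fderiv ℝ Y x (X x) - fderiv ℝ X x (Y x)) +
        connCurv Z x (X x) (Y x) • ξ x := by
  have hc := h.differentiableAt_of_contDiffOn (h.contDiffOn_covDeriv hξ) hx
  rw [covDeriv_clm_apply hc hY, covDeriv_clm_apply hc hX, ← h.covDeriv_covDeriv_sub hξ hx, map_sub]
  abel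

end SmoothLift

end CovDeriv

/-! ### Minimal slant frames -/

section MinimalSlantFrame

variable {E : Type*} [NormedAddCommGroup E] [NormedSpace ℝ E]

/-- The horizontal lift along `Z` of the vector field `n`. -/
def frameLift (Z : E → Fin 3 → ℂ) (n : E → E) (x : E) : Fin 3 → ℂ := covDeriv Z Z x (n x)

/-- A smooth null frame `n₁, n₂` along the lift `Z` of a surface, with `⟨n₁, n₂⟩ = -1`. The constant
`s` is, up to sign, the hyperbolic sine of the slant angle. The surface is minimal, that is, the
component of `∇_{n₁} n₂` normal to it vanishes. -/
structure MinimalSlantFrame (Z : E → Fin 3 → ℂ) (U : Set E) (n₁ n₂ : E → E) (s : ℝ) : Prop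
    extends SmoothLift Z U where
  contDiffOn₁ : ContDiffOn ℝ ∞ n₁ U
  contDiffOn₂ : ContDiffOn ℝ ∞ n₂ U
  null₁ : ∀ x ∈ U, normForm (Z x) (frameLift Z n₁ x) (frameLift Z n₁ x) = 0
  null₂ : ∀ x ∈ U, normForm (Z x) (frameLift Z n₂ x) (frameLift Z n₂ x) = 0
  pair : ∀ x ∈ U, normForm (Z x) (frameLift Z n₁ x) (frameLift Z n₂ x) = -(1 + s * Complex.I)
  span : ∀ x ∈ U, ∀ u, ∃ a b : ℝ, u = a • n₁ x + b • n₂ x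
  minimal : ∀ x ∈ U, ∃ a b : ℝ, ∃ l : ℂ, covDeriv Z (frameLift Z n₂) x (n₁ x) =
    (l • Z x + (a : ℂ) • frameLift Z n₁ x) + (b : ℂ) • frameLift Z n₂ x

/-- The coefficient `ω` of `n₁` in `∇_{n₁} n₁` for a null frame `n₁, n₂`; that of `n₂` in
`∇_{n₁} n₂` is `-ω`. -/
def frameConn (Z : E → Fin 3 → ℂ) (n₁ n₂ : E → E) (x : E) : ℝ :=
  (normForm (Z x) (frameLift Z n₁ x) (covDeriv Z (frameLift Z n₂) x (n₁ x))).re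

/-- The coefficient of `n₂` in `∇_{n₁} n₁` for a null frame `n₁, n₂`. For a Lagrangian surface it is
a component of the cubic form `⟨h(X, Y), J W⟩`. -/
def frameCubic (Z : E → Fin 3 → ℂ) (n₁ n₂ : E → E) (x : E) : ℂ :=
  normForm (Z x) (frameLift Z n₁ x) (covDeriv Z (frameLift Z n₁) x (n₁ x)) /
    normForm (Z x) (frameLift Z n₁ x) (frameLift Z n₂ x)

theorem fderiv_ofReal {f : E → ℝ} {x : E} (hf : DifferentiableAt ℝ f x) (u : E) :
    fderiv ℝ (fun y => (f y : ℂ)) x u = (fderiv ℝ f x u : ℂ) := by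
  have h : fderiv ℝ (fun y => (f y : ℂ)) x = _ :=
    (Complex.ofRealCLM.hasFDerivAt.comp x hf.hasFDerivAt).fderiv
  rw [h]
  rfl

theorem one_add_mul_I_ne_zero (r : ℝ) : (1 + r * Complex.I : ℂ) ≠ 0 := fun h => by
  simpa using congrArg Complex.re h

theorem conj_one_add_mul_I (r : ℝ) :
    conj (1 + r * Complex.I : ℂ) = 1 + ((-r : ℝ) : ℂ) * Complex.I := by
  simp

namespace SmoothLift

variable {Z ξ η : E → Fin 3 → ℂ} {U : Set E} {n m : E → E} {x : E} (h : SmoothLift Z U)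
include h

theorem contDiffOn_frameLift (hn : ContDiffOn ℝ ∞ n U) : ContDiffOn ℝ ∞ (frameLift Z n) U :=
  (h.contDiffOn_covDeriv h.contDiffOn).clm_apply hn

theorem contDiffOn_covDeriv_frameLift (hn : ContDiffOn ℝ ∞ n U) (hm : ContDiffOn ℝ ∞ m U) :
    ContDiffOn ℝ ∞ (fun y => covDeriv Z (frameLift Z n) y (m y)) U :=
  (h.contDiffOn_covDeriv (h.contDiffOn_frameLift hn)).clm_apply hm

theorem normForm_covDeriv_add_of_const {c : ℂ} (hξ : ContDiffOn ℝ ∞ ξ U) (hη : ContDiffOn ℝ ∞ η U)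
    (hc : ∀ y ∈ U, normForm (Z y) (ξ y) (η y) = c) (hx : x ∈ U) (u : E) :
    normForm (Z x) (covDeriv Z ξ x u) (η x) + normForm (Z x) (ξ x) (covDeriv Z η x u) = 0 := by
  rw [← fderiv_normForm (h.differentiableAt hx) (h.differentiableAt_of_contDiffOn hξ hx)
    (h.differentiableAt_of_contDiffOn hη hx) (h.neg x hx),
    (Filter.eventuallyEq_of_mem (h.isOpen.mem_nhds hx) hc).fderiv_eq, fderiv_const_apply,
    zero_apply]

theorem re_normForm_covDeriv_of_null (hξ : ContDiffOn ℝ ∞ ξ U)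
    (h0 : ∀ y ∈ U, normForm (Z y) (ξ y) (ξ y) = 0) (hx : x ∈ U) (u : E) :
    (normForm (Z x) (ξ x) (covDeriv Z ξ x u)).re = 0 := by
  have hre := congrArg Complex.re (h.normForm_covDeriv_add_of_const hξ hξ h0 hx u)
  rw [Complex.add_re, normForm_re_comm (Z x) (covDeriv _ _ _ _), Complex.zero_re] at hre
  linarith

theorem normForm_covDeriv_frameLift (hn : ContDiffOn ℝ ∞ n U) (hx : x ∈ U) (u : E) :
    normForm (Z x) (Z x) (covDeriv Z (frameLift Z n) x u) =
      -normForm (Z x) (covDeriv Z Z x u) (frameLift Z n x) :=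
  eq_neg_of_add_eq_zero_right (h.normForm_covDeriv_add_of_const h.contDiffOn
    (h.contDiffOn_frameLift hn) (fun y hy => normForm_covDeriv_self (h.neg y hy) _) hx u)

theorem covDeriv_frameLift_sub (hn : ContDiffOn ℝ ∞ n U) (hm : ContDiffOn ℝ ∞ m U) (hx : x ∈ U) :
    covDeriv Z (frameLift Z m) x (n x) - covDeriv Z (frameLift Z n) x (m x) =
      covDeriv Z Z x (fderiv ℝ m x (n x) - fderiv ℝ n x (m x)) + connCurv Z x (n x) (m x) • Z x :=
  h.covDeriv_covDeriv_sub_field h.contDiffOn hx (h.differentiableAt_of_contDiffOn hn hx)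
    (h.differentiableAt_of_contDiffOn hm hx)

end SmoothLift

namespace MinimalSlantFrame

variable {Z : E → Fin 3 → ℂ} {U : Set E} {n₁ n₂ : E → E} {s : ℝ} {x : E}
  (h : MinimalSlantFrame Z U n₁ n₂ s)
include h

theorem isNullBasis (hx : x ∈ U) :
    IsNullBasis (Z x) (frameLift Z n₁ x) (frameLift Z n₂ x) (1 + s * Complex.I) where
  neg := h.neg x hx
  ne_zero := one_add_mul_I_ne_zero s
  orth₁ := normForm_covDeriv_self (h.neg x hx) _
  orth₂ := normForm_covDeriv_self (h.neg x hx) _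
  null₁ := h.null₁ x hx
  null₂ := h.null₂ x hx
  pair := h.pair x hx

theorem contDiffOn_frameConn : ContDiffOn ℝ ∞ (frameConn Z n₁ n₂) U :=
  Complex.reCLM.contDiff.comp_contDiffOn (h.contDiffOn_normForm
    (h.contDiffOn_frameLift h.contDiffOn₁)
    (h.contDiffOn_covDeriv_frameLift h.contDiffOn₂ h.contDiffOn₁))

theorem contDiffOn_frameCubic : ContDiffOn ℝ ∞ (frameCubic Z n₁ n₂) U :=
  (h.contDiffOn_normForm (h.contDiffOn_frameLift h.contDiffOn₁)
    (h.contDiffOn_covDeriv_frameLift h.contDiffOn₁ h.contDiffOn₁)).mul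
  ((h.contDiffOn_normForm (h.contDiffOn_frameLift h.contDiffOn₁)
    (h.contDiffOn_frameLift h.contDiffOn₂)).inv fun x hx => by
      rw [h.pair x hx]
      exact neg_ne_zero.2 (one_add_mul_I_ne_zero _))

theorem normForm_covDeriv_pair (hx : x ∈ U) (u : E) :
    normForm (Z x) (covDeriv Z (frameLift Z n₁) x u) (frameLift Z n₂ x) =
      -normForm (Z x) (frameLift Z n₁ x) (covDeriv Z (frameLift Z n₂) x u) :=
  eq_neg_of_add_eq_zero_left (h.normForm_covDeriv_add_of_const
    (h.contDiffOn_frameLift h.contDiffOn₁) (h.contDiffOn_frameLift h.contDiffOn₂) h.pair hx u)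

theorem covDeriv₁₂ (hx : x ∈ U) : covDeriv Z (frameLift Z n₂) x (n₁ x) =
    (-(1 + s * Complex.I)) • Z x + (-(frameConn Z n₁ n₂ x : ℂ)) • frameLift Z n₂ x := by
  have hb := h.isNullBasis hx
  obtain ⟨a, b, l, e⟩ := h.minimal x hx
  have h0 := hb.normForm_base_comb l a b
  have h1 := hb.normForm_left_comb l a b
  have h2 := hb.normForm_right_comb l a b
  rw [← e] at h0 h1 h2
  have hl : l = -(1 + s * Complex.I) := by
    have hp : normForm (Z x) (covDeriv Z Z x (n₁ x)) (frameLift Z n₂ x) = _ := h.pair x hx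
    rw [h.normForm_covDeriv_frameLift h.contDiffOn₂ hx, hp] at h0
    linear_combination h0
  have ha : a = 0 := by
    have hre := h.re_normForm_covDeriv_of_null (h.contDiffOn_frameLift h.contDiffOn₂) h.null₂ hx
      (n₁ x)
    rw [h2] at hre
    simpa using hre
  have hconn : b = -frameConn Z n₁ n₂ x := by
    rw [frameConn, h1]
    simp
  rw [e, ha, hconn, hl]
  simp

theorem swap : MinimalSlantFrame Z U n₂ n₁ (-s) where
  toSmoothLift := h.toSmoothLift
  contDiffOn₁ := h.contDiffOn₂
  contDiffOn₂ := h.contDiffOn₁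
  null₁ := h.null₂
  null₂ := h.null₁
  pair x hx := by rw [← conj_normForm, h.pair x hx, map_neg, conj_one_add_mul_I]
  span x hx u := by
    obtain ⟨a, b, e⟩ := h.span x hx u
    exact ⟨b, a, by rw [e, add_comm]⟩
  minimal x hx := by
    have hsub := h.covDeriv_frameLift_sub h.contDiffOn₁ h.contDiffOn₂ hx
    obtain ⟨a, b, e⟩ := h.span x hx (fderiv ℝ n₂ x (n₁ x) - fderiv ℝ n₁ x (n₂ x))
    rw [h.covDeriv₁₂ hx, e, map_add, map_smul, map_smul] at hsub
    refine ⟨-(frameConn Z n₁ n₂ x) - b, -a,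
      -(1 + s * Complex.I) - connCurv Z x (n₁ x) (n₂ x), ?_⟩
    rw [← sub_eq_iff_eq_add'.2 (sub_eq_iff_eq_add.1 hsub)]
    simp only [frameLift, ← Complex.coe_smul]
    push_cast
    module

theorem covDeriv₂₁ (hx : x ∈ U) : covDeriv Z (frameLift Z n₁) x (n₂ x) =
    (-conj (1 + s * Complex.I)) • Z x + (-(frameConn Z n₂ n₁ x : ℂ)) • frameLift Z n₁ x := by
  rw [h.swap.covDeriv₁₂ hx, conj_one_add_mul_I]

theorem covDeriv₁₁ (hx : x ∈ U) : covDeriv Z (frameLift Z n₁) x (n₁ x) =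
    (frameConn Z n₁ n₂ x : ℂ) • frameLift Z n₁ x + frameCubic Z n₁ n₂ x • frameLift Z n₂ x := by
  have hb := h.isNullBasis hx
  have hbase : normForm (Z x) (Z x) (covDeriv Z (frameLift Z n₁) x (n₁ x)) = 0 := by
    rw [h.normForm_covDeriv_frameLift h.contDiffOn₁ hx]
    exact neg_eq_zero.2 (h.null₁ x hx)
  have hpair : normForm (Z x) (covDeriv Z (frameLift Z n₁) x (n₁ x)) (frameLift Z n₂ x) =
      -(frameConn Z n₁ n₂ x * (1 + s * Complex.I)) := by
    have h12 := hb.normForm_left_comb (-(1 + s * Complex.I)) 0 (-(frameConn Z n₁ n₂ x : ℂ))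
    rw [zero_smul, add_zero, ← h.covDeriv₁₂ hx] at h12
    rw [h.normForm_covDeriv_pair hx, h12, neg_mul, neg_neg]
  conv_lhs => rw [hb.eq_comb (covDeriv Z (frameLift Z n₁) x (n₁ x))]
  rw [hbase, ← conj_normForm, hpair, map_neg, map_mul, Complex.conj_ofReal, frameCubic, hb.pair,
    neg_zero, zero_smul, zero_add, neg_div, neg_neg, mul_div_cancel_right₀ _ hb.conj_ne_zero,
    div_neg]

theorem covDeriv₂₂ (hx : x ∈ U) : covDeriv Z (frameLift Z n₂) x (n₂ x) =
    (frameConn Z n₂ n₁ x : ℂ) • frameLift Z n₂ x + frameCubic Z n₂ n₁ x • frameLift Z n₁ x :=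
  h.swap.covDeriv₁₁ hx

theorem bracket_eq_and_connCurv_eq (hx : x ∈ U) :
    fderiv ℝ n₂ x (n₁ x) - fderiv ℝ n₁ x (n₂ x) =
      frameConn Z n₂ n₁ x • n₁ x - frameConn Z n₁ n₂ x • n₂ x ∧
    connCurv Z x (n₁ x) (n₂ x) = -2 * s * Complex.I := by
  have hsub := h.covDeriv_frameLift_sub h.contDiffOn₁ h.contDiffOn₂ hx
  obtain ⟨a, b, e⟩ := h.span x hx (fderiv ℝ n₂ x (n₁ x) - fderiv ℝ n₁ x (n₂ x))
  rw [h.covDeriv₁₂ hx, h.covDeriv₂₁ hx, conj_one_add_mul_I, e, (covDeriv Z Z x).map_add,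
    (covDeriv Z Z x).map_smul, (covDeriv Z Z x).map_smul] at hsub
  have hcomb : (connCurv Z x (n₁ x) (n₂ x) - (-2 * s * Complex.I)) • Z x +
      (a - frameConn Z n₂ n₁ x : ℂ) • frameLift Z n₁ x +
      (b + frameConn Z n₁ n₂ x : ℂ) • frameLift Z n₂ x = 0 := by
    have hsub' := sub_eq_zero.2 hsub
    simp only [frameLift, ← Complex.coe_smul] at hsub' ⊢
    rw [← neg_eq_zero, ← hsub']
    push_cast
    module
  obtain ⟨h0, h1, h2⟩ := (h.isNullBasis hx).comb_eq_zero hcomb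
  refine ⟨?_, sub_eq_zero.1 h0⟩
  have ha : a = frameConn Z n₂ n₁ x := by exact_mod_cast sub_eq_zero.1 h1
  have hb : b = -frameConn Z n₁ n₂ x := by exact_mod_cast eq_neg_of_add_eq_zero_left h2
  rw [e, ha, hb]
  module

theorem re_frameCubic_mul (hx : x ∈ U) :
    (frameCubic Z n₁ n₂ x * (1 + s * Complex.I)).re = 0 := by
  have hb := h.isNullBasis hx
  rw [frameCubic, hb.pair, div_neg, neg_mul, div_mul_cancel₀ _ hb.ne_zero, Complex.neg_re,
    h.re_normForm_covDeriv_of_null (h.contDiffOn_frameLift h.contDiffOn₁) h.null₁ hx, neg_zero]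

theorem im_frameCubic_mul_frameCubic (hx : x ∈ U) :
    (frameCubic Z n₁ n₂ x * frameCubic Z n₂ n₁ x).im = 0 := by
  have h1 : (frameCubic Z n₁ n₂ x).re = (frameCubic Z n₁ n₂ x).im * s := by
    simpa [sub_eq_zero] using h.re_frameCubic_mul hx
  have h2 : (frameCubic Z n₂ n₁ x).re = -((frameCubic Z n₂ n₁ x).im * s) := by
    simpa [add_eq_zero_iff_eq_neg] using h.swap.re_frameCubic_mul hx
  rw [Complex.mul_im, h1, h2]
  ring

theorem covDeriv_covDeriv₁₂ (hx : x ∈ U) :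
    covDeriv Z (fun y => covDeriv Z (frameLift Z n₁) y (n₂ y)) x (n₁ x) =
      (-conj (1 + s * Complex.I) - fderiv ℝ (frameConn Z n₂ n₁) x (n₁ x) -
        frameConn Z n₂ n₁ x * frameConn Z n₁ n₂ x) • frameLift Z n₁ x -
      (frameConn Z n₂ n₁ x * frameCubic Z n₁ n₂ x) • frameLift Z n₂ x := by
  have d₁ := h.differentiableAt_of_contDiffOn (h.contDiffOn_frameLift h.contDiffOn₁) hx
  have dω := h.differentiableAt_of_contDiffOn h.swap.contDiffOn_frameConn hx
  have dω' : DifferentiableAt ℝ (fun y => -(frameConn Z n₂ n₁ y : ℂ)) x :=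
    (Complex.ofRealCLM.differentiableAt.comp x dω).neg
  have dc : DifferentiableAt ℝ (fun _ : E => -conj (1 + s * Complex.I)) x :=
    differentiableAt_const _
  rw [covDeriv_congr (Filter.eventually_of_mem (h.isOpen.mem_nhds hx) fun y hy => h.covDeriv₂₁ hy),
    covDeriv_add (dc.fun_smul (h.differentiableAt hx)) (dω'.fun_smul d₁),
    covDeriv_smul dc (h.differentiableAt hx), covDeriv_smul dω' d₁, h.covDeriv₁₁ hx,
    fderiv_const_apply, fderiv_fun_neg, zero_apply, neg_apply, fderiv_ofReal dω]
  change _ + _ • frameLift Z n₁ x + _ = _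
  module

theorem covDeriv_covDeriv₂₁ (hx : x ∈ U) :
    covDeriv Z (fun y => covDeriv Z (frameLift Z n₁) y (n₁ y)) x (n₂ x) =
      (-frameConn Z n₁ n₂ x * conj (1 + s * Complex.I)) • Z x +
      (fderiv ℝ (frameConn Z n₁ n₂) x (n₂ x) - frameConn Z n₁ n₂ x * frameConn Z n₂ n₁ x +
        frameCubic Z n₁ n₂ x * frameCubic Z n₂ n₁ x) • frameLift Z n₁ x +
      (fderiv ℝ (frameCubic Z n₁ n₂) x (n₂ x) + frameCubic Z n₁ n₂ x * frameConn Z n₂ n₁ x) •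
        frameLift Z n₂ x := by
  have d₁ := h.differentiableAt_of_contDiffOn (h.contDiffOn_frameLift h.contDiffOn₁) hx
  have d₂ := h.differentiableAt_of_contDiffOn (h.contDiffOn_frameLift h.contDiffOn₂) hx
  have dω := h.differentiableAt_of_contDiffOn h.contDiffOn_frameConn hx
  have dω' : DifferentiableAt ℝ (fun y => (frameConn Z n₁ n₂ y : ℂ)) x :=
    Complex.ofRealCLM.differentiableAt.comp x dω
  have dq := h.differentiableAt_of_contDiffOn h.contDiffOn_frameCubic hx
  rw [covDeriv_congr (Filter.eventually_of_mem (h.isOpen.mem_nhds hx) fun y hy => h.covDeriv₁₁ hy),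
    covDeriv_add (dω'.fun_smul d₁) (dq.fun_smul d₂), covDeriv_smul dω' d₁, covDeriv_smul dq d₂,
    h.covDeriv₂₁ hx, h.covDeriv₂₂ hx, fderiv_ofReal dω]
  module

/-- The components along `n₁` and `n₂` of the Ricci identity for `n₁`. -/
theorem gauss_codazzi (hx : x ∈ U) :
    -conj (1 + s * Complex.I) + 2 * s * Complex.I =
      fderiv ℝ (frameConn Z n₂ n₁) x (n₁ x) + fderiv ℝ (frameConn Z n₁ n₂) x (n₂ x) +
      2 * frameConn Z n₁ n₂ x * frameConn Z n₂ n₁ x +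
      frameCubic Z n₁ n₂ x * frameCubic Z n₂ n₁ x ∧
    fderiv ℝ (frameCubic Z n₁ n₂) x (n₂ x) =
      -3 * frameConn Z n₂ n₁ x * frameCubic Z n₁ n₂ x := by
  have hricci := h.covDeriv_covDeriv_sub_field (h.contDiffOn_frameLift h.contDiffOn₁) hx
    (h.differentiableAt_of_contDiffOn h.contDiffOn₁ hx)
    (h.differentiableAt_of_contDiffOn h.contDiffOn₂ hx)
  obtain ⟨hbracket, hcurv⟩ := h.bracket_eq_and_connCurv_eq hx
  rw [h.covDeriv_covDeriv₁₂ hx, h.covDeriv_covDeriv₂₁ hx, hbracket, hcurv, map_sub, map_smul,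
    map_smul, h.covDeriv₁₁ hx, h.covDeriv₂₁ hx] at hricci
  have hcomb : (0 : ℂ) • Z x +
      (-conj (1 + s * Complex.I) + 2 * s * Complex.I -
        (fderiv ℝ (frameConn Z n₂ n₁) x (n₁ x) + fderiv ℝ (frameConn Z n₁ n₂) x (n₂ x) +
          2 * frameConn Z n₁ n₂ x * frameConn Z n₂ n₁ x +
          frameCubic Z n₁ n₂ x * frameCubic Z n₂ n₁ x)) • frameLift Z n₁ x +
      (-fderiv ℝ (frameCubic Z n₁ n₂) x (n₂ x) -
        3 * frameConn Z n₂ n₁ x * frameCubic Z n₁ n₂ x) • frameLift Z n₂ x = 0 := by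
    have hricci' := sub_eq_zero.2 hricci
    simp only [← Complex.coe_smul] at hricci'
    rw [← hricci']
    module
  obtain ⟨-, hgauss, hcodazzi⟩ := (h.isNullBasis hx).comb_eq_zero hcomb
  exact ⟨sub_eq_zero.1 hgauss, by linear_combination -hcodazzi⟩

/-- The imaginary part of the Gauss equation is `3 s = 0`. -/
theorem slant_eq_zero (hx : x ∈ U) : s = 0 := by
  have him := congrArg Complex.im (h.gauss_codazzi hx).1
  rw [conj_one_add_mul_I, Complex.add_im, Complex.add_im, h.im_frameCubic_mul_frameCubic hx] at him
  have hs : s + 2 * s = 0 := by simpa using him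
  linarith

end MinimalSlantFrame
end MinimalSlantFrame

/-! ### Induced metric and the Gauss equation -/

section LeviCivita

variable {E : Type*} [NormedAddCommGroup E] [NormedSpace ℝ E] {g g' : E → E → E → ℝ} {x : E}

theorem christoffel_congr (hg : ∀ᶠ y in nhds x, g y = g' y) :
    christoffel g x = christoffel g' x := by
  have hfderiv (v w : E) : fderiv ℝ (fun y => g y v w) x = fderiv ℝ (fun y => g' y v w) x :=
    Filter.EventuallyEq.fderiv_eq (hg.mono fun y hy => congrFun (congrFun hy v) w)
  funext u v
  simp only [christoffel, hg.self_of_nhds, hfderiv]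

theorem curvature_congr (hg : ∀ᶠ y in nhds x, g y = g' y) : curvature g x = curvature g' x := by
  have hchristoffel : ∀ᶠ y in nhds x, christoffel g y = christoffel g' y :=
    hg.eventually_nhds.mono fun y => christoffel_congr
  have hfderiv (v w : E) :
      fderiv ℝ (fun y => christoffel g y v w) x = fderiv ℝ (fun y => christoffel g' y v w) x :=
    Filter.EventuallyEq.fderiv_eq (hchristoffel.mono fun y hy => congrFun (congrFun hy v) w)
  funext u v w
  simp only [curvature, hchristoffel.self_of_nhds, hfderiv]

/-- The metric on the domain of `Z` that is induced from the real part of the normalized form on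
horizontal lifts. -/
def liftMetric (Z : E → Fin 3 → ℂ) (x u v : E) : ℝ :=
  (normForm (Z x) (covDeriv Z Z x u) (covDeriv Z Z x v)).re

section liftMetric
variable (Z : E → Fin 3 → ℂ) (x u v w : E) (r : ℝ)

theorem liftMetric_comm : liftMetric Z x u v = liftMetric Z x v u := normForm_re_comm _ _ _

theorem liftMetric_add_left :
    liftMetric Z x (u + v) w = liftMetric Z x u w + liftMetric Z x v w := by
  simp [liftMetric, normForm_add_left]

theorem liftMetric_smul_left : liftMetric Z x (r • u) w = r * liftMetric Z x u w := by
  rw [liftMetric, map_smul, ← Complex.coe_smul, normForm_smul_left]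
  simp [liftMetric]

theorem liftMetric_sub_left :
    liftMetric Z x (u - v) w = liftMetric Z x u w - liftMetric Z x v w := by
  simp [liftMetric, normForm_sub_left]

theorem liftMetric_zero_left : liftMetric Z x 0 w = 0 := by
  simp [liftMetric, normForm_zero_left]

theorem liftMetric_add_right :
    liftMetric Z x u (v + w) = liftMetric Z x u v + liftMetric Z x u w := by
  rw [liftMetric_comm, liftMetric_add_left, liftMetric_comm, liftMetric_comm Z x w]

theorem liftMetric_smul_right : liftMetric Z x u (r • w) = r * liftMetric Z x u w := by
  rw [liftMetric_comm, liftMetric_smul_left, liftMetric_comm]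

end liftMetric

/-- The covariant derivative of the horizontal lift of the constant vector field `v` in the
direction `u`. -/
def covHess (Z : E → Fin 3 → ℂ) (x u v : E) : Fin 3 → ℂ :=
  covDeriv Z (fun y => covDeriv Z Z y v) x u

/-- The second fundamental form of the map into `CH²₁(-4)` with lift `Z`. Its values may also have a
component along `Z x`, as the covariant derivative does not project to the complement of `Z x`. -/
def liftSecondForm (Z : E → Fin 3 → ℂ) (x u v : E) : Fin 3 → ℂ :=
  covHess Z x u v - covDeriv Z Z x (christoffel (liftMetric Z) x u v)

theorem fderiv_re_normForm {Z ξ η : E → Fin 3 → ℂ} (hZ : DifferentiableAt ℝ Z x)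
    (hξ : DifferentiableAt ℝ ξ x) (hη : DifferentiableAt ℝ η x)
    (hneg : (hermForm (Z x) (Z x)).re < 0) (u : E) :
    fderiv ℝ (fun y => (normForm (Z y) (ξ y) (η y)).re) x u =
      (normForm (Z x) (covDeriv Z ξ x u) (η x)).re +
        (normForm (Z x) (ξ x) (covDeriv Z η x u)).re := by
  have hre : fderiv ℝ (fun y => (normForm (Z y) (ξ y) (η y)).re) x = _ :=
    (Complex.reCLM.hasFDerivAt.comp x
      (differentiableAt_normForm hZ hξ hη hneg).hasFDerivAt).fderiv
  rw [hre, ContinuousLinearMap.comp_apply, fderiv_normForm hZ hξ hη hneg, Complex.reCLM_apply,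
    Complex.add_re]

namespace SmoothLift

variable {Z : E → Fin 3 → ℂ} {U : Set E} (h : SmoothLift Z U)
include h

theorem contDiffOn_covDeriv_self_apply (v : E) : ContDiffOn ℝ ∞ (fun y => covDeriv Z Z y v) U :=
  (h.contDiffOn_covDeriv h.contDiffOn).clm_apply contDiffOn_const

theorem contDiffOn_covHess (u v : E) : ContDiffOn ℝ ∞ (fun y => covHess Z y u v) U :=
  (h.contDiffOn_covDeriv (h.contDiffOn_covDeriv_self_apply v)).clm_apply contDiffOn_const

theorem contDiffOn_liftMetric (u v : E) : ContDiffOn ℝ ∞ (fun y => liftMetric Z y u v) U :=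
  Complex.reCLM.contDiff.comp_contDiffOn (h.contDiffOn_normForm
    (h.contDiffOn_covDeriv_self_apply u) (h.contDiffOn_covDeriv_self_apply v))

theorem fderiv_liftMetric (hx : x ∈ U) (u v w : E) :
    fderiv ℝ (fun y => liftMetric Z y v w) x u =
      (normForm (Z x) (covHess Z x u v) (covDeriv Z Z x w)).re +
        (normForm (Z x) (covHess Z x u w) (covDeriv Z Z x v)).re := by
  rw [normForm_re_comm _ (covHess Z x u w)]
  exact fderiv_re_normForm (h.differentiableAt hx)
    (h.differentiableAt_of_contDiffOn (h.contDiffOn_covDeriv_self_apply v) hx)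
    (h.differentiableAt_of_contDiffOn (h.contDiffOn_covDeriv_self_apply w) hx) (h.neg x hx) u

theorem normForm_covHess_symm (hx : x ∈ U) (u v w : E) :
    normForm (Z x) (covHess Z x u v) (covDeriv Z Z x w) =
      normForm (Z x) (covHess Z x v u) (covDeriv Z Z x w) := by
  have hricci : covHess Z x u v - covHess Z x v u = connCurv Z x u v • Z x :=
    h.covDeriv_covDeriv_sub h.contDiffOn hx u v
  rw [sub_eq_iff_eq_add.1 hricci, normForm_add_left, normForm_smul_left,
    normForm_covDeriv_self (h.neg x hx), mul_zero, zero_add]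

theorem christoffel_eq (hx : x ∈ U) (hnd : ∀ u, (∀ w, liftMetric Z x u w = 0) → u = 0) {u v Γ : E}
    (hΓ : ∀ w, liftMetric Z x Γ w = (normForm (Z x) (covHess Z x u v) (covDeriv Z Z x w)).re) :
    christoffel (liftMetric Z) x u v = Γ := by
  have hkoszul (w : E) : fderiv ℝ (fun y => liftMetric Z y v w) x u +
      fderiv ℝ (fun y => liftMetric Z y u w) x v - fderiv ℝ (fun y => liftMetric Z y u v) x w =
        2 * liftMetric Z x Γ w := by
    rw [h.fderiv_liftMetric hx, h.fderiv_liftMetric hx, h.fderiv_liftMetric hx, hΓ,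
      h.normForm_covHess_symm hx u w, h.normForm_covHess_symm hx v w,
      h.normForm_covHess_symm hx v u]
    ring
  have hspec : ∀ w, 2 * liftMetric Z x (christoffel (liftMetric Z) x u v) w = _ :=
    Classical.epsilon_spec (p := fun Γ : E => ∀ w, 2 * liftMetric Z x Γ w = _)
      ⟨Γ, fun w => (hkoszul w).symm⟩
  refine sub_eq_zero.1 (hnd _ fun w => ?_)
  rw [liftMetric_sub_left, mul_left_cancel₀ two_ne_zero ((hspec w).trans (hkoszul w)), sub_self]

end SmoothLift

section Gauss

variable {Z : E → Fin 3 → ℂ} {U : Set E}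

theorem re_normForm_covHess_eq (hnormal : ∀ u v w,
      (normForm (Z x) (liftSecondForm Z x u v) (covDeriv Z Z x w)).re = 0) (u v w : E) :
    (normForm (Z x) (covHess Z x u v) (covDeriv Z Z x w)).re =
      liftMetric Z x (christoffel (liftMetric Z) x u v) w := by
  have hw := hnormal u v w
  rwa [liftSecondForm, normForm_sub_left, Complex.sub_re, sub_eq_zero] at hw

theorem re_normForm_covHess_of_normal {ξ : Fin 3 → ℂ}
    (hξ : ∀ w, (normForm (Z x) ξ (covDeriv Z Z x w)).re = 0) (u v : E) :
    (normForm (Z x) ξ (covHess Z x u v)).re = (normForm (Z x) ξ (liftSecondForm Z x u v)).re := by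
  rw [← sub_add_cancel (covHess Z x u v) (covDeriv Z Z x (christoffel (liftMetric Z) x u v)),
    normForm_add_right, Complex.add_re, hξ, add_zero, liftSecondForm]

variable (h : SmoothLift Z U) (hnormal : ∀ y ∈ U, ∀ u v w,
    (normForm (Z y) (liftSecondForm Z y u v) (covDeriv Z Z y w)).re = 0) (hx : x ∈ U)
include h hnormal hx

/-- This is the derivative of the orthogonality of the second fundamental form to `k`. -/
theorem re_normForm_covDeriv_covHess {v w : E}
    (hd : DifferentiableAt ℝ (fun y => christoffel (liftMetric Z) y v w) x) (u k : E) :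
    (normForm (Z x) (covDeriv Z (fun y => covHess Z y v w) x u) (covDeriv Z Z x k)).re =
      liftMetric Z x (fderiv ℝ (fun y => christoffel (liftMetric Z) y v w) x u +
        christoffel (liftMetric Z) x u (christoffel (liftMetric Z) x v w)) k -
      (normForm (Z x) (liftSecondForm Z x v w) (liftSecondForm Z x u k)).re := by
  have dC := h.differentiableAt_of_contDiffOn (h.contDiffOn_covDeriv h.contDiffOn) hx
  have dH := h.differentiableAt_of_contDiffOn (h.contDiffOn_covHess v w) hx
  have dk := h.differentiableAt_of_contDiffOn (h.contDiffOn_covDeriv_self_apply k) hx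
  have dΓ := dC.clm_apply hd
  have hderiv := fderiv_re_normForm (h.differentiableAt hx) (dH.sub dΓ) dk (h.neg x hx) u
  have hzero : (fun y => (normForm (Z y) (liftSecondForm Z y v w) (covDeriv Z Z y k)).re)
      =ᶠ[nhds x] fun _ => 0 :=
    Filter.eventually_of_mem (h.isOpen.mem_nhds hx) fun y hy => hnormal y hy v w k
  have hsecond : covDeriv Z (fun y => liftSecondForm Z y v w) x u =
      covDeriv Z (fun y => covHess Z y v w) x u -
        (covHess Z x u (christoffel (liftMetric Z) x v w) +
          covDeriv Z Z x (fderiv ℝ (fun y => christoffel (liftMetric Z) y v w) x u)) :=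
    (covDeriv_sub dH dΓ u).trans (congrArg _ (covDeriv_clm_apply dC hd u))
  change fderiv ℝ (fun y => (normForm (Z y) (liftSecondForm Z y v w) (covDeriv Z Z y k)).re) x u =
    (normForm (Z x) (covDeriv Z (fun y => liftSecondForm Z y v w) x u) (covDeriv Z Z x k)).re +
      (normForm (Z x) (liftSecondForm Z x v w) (covHess Z x u k)).re at hderiv
  rw [hzero.fderiv_eq, hsecond, re_normForm_covHess_of_normal (hnormal x hx v w), normForm_sub_left,
    normForm_add_left, Complex.sub_re, Complex.add_re, re_normForm_covHess_eq (hnormal x hx),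
    fderiv_const_apply, zero_apply] at hderiv
  rw [liftMetric_add_left]
  simp only [liftMetric] at hderiv ⊢
  linarith

theorem gauss_equation
    (hd : ∀ u v, DifferentiableAt ℝ (fun y => christoffel (liftMetric Z) y u v) x) (u v w k : E) :
    liftMetric Z x (curvature (liftMetric Z) x u v w) k =
      (normForm (Z x) (connCurv Z x u v • covDeriv Z Z x w) (covDeriv Z Z x k)).re +
      (normForm (Z x) (liftSecondForm Z x v w) (liftSecondForm Z x u k)).re -
      (normForm (Z x) (liftSecondForm Z x u w) (liftSecondForm Z x v k)).re := by
  have hricci : covDeriv Z (fun y => covHess Z y v w) x u -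
      covDeriv Z (fun y => covHess Z y u w) x v = connCurv Z x u v • covDeriv Z Z x w :=
    h.covDeriv_covDeriv_sub (h.contDiffOn_covDeriv_self_apply w) hx u v
  rw [← hricci, normForm_sub_left, Complex.sub_re,
    re_normForm_covDeriv_covHess h hnormal hx (hd v w),
    re_normForm_covDeriv_covHess h hnormal hx (hd u w), curvature, liftMetric_sub_left]
  ring

end Gauss

end LeviCivita

section Rescale

variable {E : Type*} [NormedAddCommGroup E] [NormedSpace ℝ E] {Z : E → Fin 3 → ℂ} {U : Set E}
  {x : E}

theorem frameLift_smul (Z : E → Fin 3 → ℂ) (t : E → ℝ) (n : E → E) :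
    frameLift Z (fun y => t y • n y) = fun y => (t y : ℂ) • frameLift Z n y := by
  funext y
  rw [frameLift, map_smul, Complex.coe_smul, frameLift]

theorem SmoothLift.covDeriv_frameLift_smul (h : SmoothLift Z U) {t : E → ℝ} {n : E → E}
    (hn : ContDiffOn ℝ ∞ n U) (ht : ContDiffOn ℝ ∞ t U) (hx : x ∈ U) (u : E) :
    covDeriv Z (frameLift Z (fun y => t y • n y)) x u =
      (fderiv ℝ t x u : ℂ) • frameLift Z n x + (t x : ℂ) • covDeriv Z (frameLift Z n) x u := by
  have dt := h.differentiableAt_of_contDiffOn ht hx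
  rw [frameLift_smul, ← fderiv_ofReal dt]
  exact covDeriv_smul (Complex.ofRealCLM.differentiableAt.comp x dt)
    (h.differentiableAt_of_contDiffOn (h.contDiffOn_frameLift hn) hx) u

theorem exists_contDiffOn_cube_mul_eq_one {f : E → ℝ} (hf : ContDiffOn ℝ ∞ f U)
    (h0 : ∀ x ∈ U, f x ≠ 0) :
    ∃ t : E → ℝ, ContDiffOn ℝ ∞ t U ∧ ∀ x ∈ U, t x ^ 3 * f x = 1 := by
  refine ⟨fun x => f x * (f x ^ 2) ^ (-(2 / 3) : ℝ),
    hf.mul ((hf.pow 2).rpow_const_of_ne fun x hx => pow_ne_zero 2 (h0 x hx)), fun x hx => ?_⟩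
  have hpow : ((f x ^ 2) ^ (-(2 / 3) : ℝ)) ^ 3 = ((f x ^ 2) ^ 2)⁻¹ := by
    rw [← Real.rpow_natCast, ← Real.rpow_mul (sq_nonneg _), ← Real.rpow_natCast (f x ^ 2) 2,
      ← Real.rpow_neg (sq_nonneg _)]
    norm_num
  have hfx := h0 x hx
  rw [mul_pow, hpow]
  field_simp

end Rescale

namespace MinimalSlantFrame

variable {E : Type*} [NormedAddCommGroup E] [NormedSpace ℝ E]
  {Z : E → Fin 3 → ℂ} {U : Set E} {n₁ n₂ : E → E} {x : E}

section Slant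

variable {s : ℝ} (h : MinimalSlantFrame Z U n₁ n₂ s)
include h

theorem liftMetric₁₁ (hx : x ∈ U) : liftMetric Z x (n₁ x) (n₁ x) = 0 :=
  congrArg Complex.re (h.null₁ x hx)

theorem liftMetric₁₂ (hx : x ∈ U) : liftMetric Z x (n₁ x) (n₂ x) = -1 :=
  (congrArg Complex.re (h.pair x hx)).trans (by simp)

theorem liftMetric₂₁ (hx : x ∈ U) : liftMetric Z x (n₂ x) (n₁ x) = -1 := h.swap.liftMetric₁₂ hx

theorem liftMetric₂₂ (hx : x ∈ U) : liftMetric Z x (n₂ x) (n₂ x) = 0 := h.swap.liftMetric₁₁ hx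

theorem eq_zero_of_liftMetric_eq_zero (hx : x ∈ U) {u : E} (hu : ∀ w, liftMetric Z x u w = 0) :
    u = 0 := by
  obtain ⟨a, b, rfl⟩ := h.span x hx u
  have h₁ := hu (n₁ x)
  have h₂ := hu (n₂ x)
  rw [liftMetric_add_left, liftMetric_smul_left, liftMetric_smul_left] at h₁ h₂
  rw [h.liftMetric₁₁ hx, h.liftMetric₂₁ hx] at h₁
  rw [h.liftMetric₁₂ hx, h.liftMetric₂₂ hx] at h₂
  have ha : a = 0 := by linarith
  have hb : b = 0 := by linarith
  simp [ha, hb]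

theorem liftMetric_tangent_component (hx : x ∈ U) (ξ : Fin 3 → ℂ) (w : E) :
    liftMetric Z x ((-(normForm (Z x) (frameLift Z n₂ x) ξ).re) • n₁ x +
      (-(normForm (Z x) (frameLift Z n₁ x) ξ).re) • n₂ x) w =
    (normForm (Z x) ξ (covDeriv Z Z x w)).re := by
  obtain ⟨a, b, rfl⟩ := h.span x hx w
  rw [normForm_re_comm _ ξ]
  simp only [liftMetric_add_left, liftMetric_smul_left, liftMetric_add_right,
    liftMetric_smul_right, h.liftMetric₁₁ hx, h.liftMetric₂₂ hx, h.liftMetric₁₂ hx,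
    h.liftMetric₂₁ hx, map_add, map_smul, ← Complex.coe_smul, normForm_add_left,
    normForm_smul_left, Complex.add_re, Complex.conj_ofReal, Complex.re_ofReal_mul, frameLift]
  ring

theorem christoffel_eq (hx : x ∈ U) (u v : E) : christoffel (liftMetric Z) x u v =
    (-(normForm (Z x) (frameLift Z n₂ x) (covHess Z x u v)).re) • n₁ x +
      (-(normForm (Z x) (frameLift Z n₁ x) (covHess Z x u v)).re) • n₂ x :=
  h.toSmoothLift.christoffel_eq hx (fun _ => h.eq_zero_of_liftMetric_eq_zero hx)
    (h.liftMetric_tangent_component hx _)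

theorem differentiableAt_christoffel (hx : x ∈ U) (u v : E) :
    DifferentiableAt ℝ (fun y => christoffel (liftMetric Z) y u v) x := by
  have hcoeff {n : E → E} (hn : ContDiffOn ℝ ∞ n U) : DifferentiableAt ℝ
      (fun y => -(normForm (Z y) (frameLift Z n y) (covHess Z y u v)).re) x :=
    (Complex.reCLM.differentiableAt.comp x (h.differentiableAt_of_contDiffOn
      (h.contDiffOn_normForm (h.contDiffOn_frameLift hn) (h.contDiffOn_covHess u v)) hx)).neg
  refine DifferentiableAt.congr_of_eventuallyEq ?_
    (Filter.eventually_of_mem (h.isOpen.mem_nhds hx) fun y hy => h.christoffel_eq hy u v)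
  exact ((hcoeff h.contDiffOn₂).smul (h.differentiableAt_of_contDiffOn h.contDiffOn₁ hx)).add
    ((hcoeff h.contDiffOn₁).smul (h.differentiableAt_of_contDiffOn h.contDiffOn₂ hx))

theorem re_normForm_liftSecondForm (hx : x ∈ U) (u v w : E) :
    (normForm (Z x) (liftSecondForm Z x u v) (covDeriv Z Z x w)).re = 0 := by
  rw [liftSecondForm, normForm_sub_left, Complex.sub_re, ← h.liftMetric_tangent_component hx,
    ← h.christoffel_eq hx, liftMetric, sub_self]

theorem re_normForm_eq_zero (hx : x ∈ U) {ν : Fin 3 → ℂ}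
    (h₁ : (normForm (Z x) ν (frameLift Z n₁ x)).re = 0)
    (h₂ : (normForm (Z x) ν (frameLift Z n₂ x)).re = 0) (w : E) :
    (normForm (Z x) ν (covDeriv Z Z x w)).re = 0 := by
  rw [normForm_re_comm] at h₁ h₂
  rw [← h.liftMetric_tangent_component hx, h₁, h₂]
  simp [liftMetric_zero_left]

theorem liftSecondForm_eq {n : E → E} (hn : ContDiffOn ℝ ∞ n U) (hx : x ∈ U) {u r : E}
    {ν : Fin 3 → ℂ} (he : covDeriv Z (frameLift Z n) x u = covDeriv Z Z x r + ν)
    (hν : ∀ w, (normForm (Z x) ν (covDeriv Z Z x w)).re = 0) :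
    liftSecondForm Z x u (n x) = ν := by
  have hdiff : liftSecondForm Z x u (n x) = ν + covDeriv Z Z x
      (r - fderiv ℝ n x u - christoffel (liftMetric Z) x u (n x)) := by
    have hlift : covDeriv Z (frameLift Z n) x u =
        covHess Z x u (n x) + covDeriv Z Z x (fderiv ℝ n x u) :=
      covDeriv_clm_apply (h.differentiableAt_of_contDiffOn (h.contDiffOn_covDeriv h.contDiffOn) hx)
        (h.differentiableAt_of_contDiffOn hn hx) u
    rw [liftSecondForm, eq_sub_of_add_eq (hlift.symm.trans he), map_sub, map_sub]
    abel
  have hzero : r - fderiv ℝ n x u - christoffel (liftMetric Z) x u (n x) = 0 := by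
    refine h.eq_zero_of_liftMetric_eq_zero hx fun w => ?_
    have hw := h.re_normForm_liftSecondForm hx u (n x) w
    rwa [hdiff, normForm_add_left, Complex.add_re, hν, zero_add] at hw
  rw [hdiff, hzero, map_zero, add_zero]

end Slant

section Lagrangian

variable (h : MinimalSlantFrame Z U n₁ n₂ 0)
include h

theorem swap_zero : MinimalSlantFrame Z U n₂ n₁ 0 := by
  simpa using h.swap

theorem isNullBasis_one (hx : x ∈ U) :
    IsNullBasis (Z x) (frameLift Z n₁ x) (frameLift Z n₂ x) 1 := by
  simpa using h.isNullBasis hx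

theorem re_frameCubic (hx : x ∈ U) : (frameCubic Z n₁ n₂ x).re = 0 := by
  simpa using h.re_frameCubic_mul hx

theorem liftSecondForm₁₁ (hx : x ∈ U) :
    liftSecondForm Z x (n₁ x) (n₁ x) = frameCubic Z n₁ n₂ x • frameLift Z n₂ x := by
  have hb := h.isNullBasis_one hx
  refine h.liftSecondForm_eq h.contDiffOn₁ hx (r := frameConn Z n₁ n₂ x • n₁ x) ?_
    (h.re_normForm_eq_zero hx ?_ ?_)
  · rw [h.covDeriv₁₁ hx, map_smul, Complex.coe_smul, frameLift]
  · simp [normForm_smul_left, hb.pair_symm, h.re_frameCubic hx]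
  · simp [normForm_smul_left, hb.null₂]

theorem liftSecondForm₂₁ (hx : x ∈ U) : liftSecondForm Z x (n₂ x) (n₁ x) = (-1 : ℂ) • Z x := by
  have hb := h.isNullBasis_one hx
  refine h.liftSecondForm_eq h.contDiffOn₁ hx (r := -frameConn Z n₂ n₁ x • n₁ x) ?_
    (h.re_normForm_eq_zero hx ?_ ?_)
  · rw [h.covDeriv₂₁ hx, map_smul, ← Complex.coe_smul, ← frameLift]
    simp [add_comm]
  · rw [normForm_smul_left, hb.orth₁, mul_zero, Complex.zero_re]
  · rw [normForm_smul_left, hb.orth₂, mul_zero, Complex.zero_re]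

theorem frameCubic_mul_frameCubic_of_flat (hx : x ∈ U)
    (hflat : ∀ u v w, curvature (liftMetric Z) x u v w = 0) :
    frameCubic Z n₁ n₂ x * frameCubic Z n₂ n₁ x = -1 := by
  have hgauss := gauss_equation h.toSmoothLift (fun y hy => h.re_normForm_liftSecondForm hy) hx
    (h.differentiableAt_christoffel hx) (n₁ x) (n₂ x) (n₁ x) (n₂ x)
  have hre₁ := h.re_frameCubic hx
  have hre₂ := h.swap_zero.re_frameCubic hx
  rw [hflat, liftMetric_zero_left, (h.bracket_eq_and_connCurv_eq hx).2, h.liftSecondForm₁₁ hx,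
    h.liftSecondForm₂₁ hx, h.swap_zero.liftSecondForm₁₁ hx, h.swap_zero.liftSecondForm₂₁ hx]
    at hgauss
  simp only [normForm_smul_left, normForm_smul_right, normForm_self (h.neg x hx),
    (h.isNullBasis_one hx).pair_symm] at hgauss
  apply Complex.ext
  · simp only [Complex.ofReal_zero, mul_zero, zero_mul, map_zero, map_neg, map_one, mul_neg,
      mul_one, neg_neg, zero_add, zero_sub, neg_inj, sub_neg_eq_add, Complex.zero_re,
      Complex.neg_re, Complex.one_re, Complex.mul_re, Complex.conj_re, Complex.conj_im, hre₁,
      hre₂] at hgauss ⊢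
    linarith
  · simpa using h.im_frameCubic_mul_frameCubic hx

end Lagrangian

section Rescale

variable {s : ℝ} (h : MinimalSlantFrame Z U n₁ n₂ s) {t : E → ℝ} (ht : ContDiffOn ℝ ∞ t U)
  (h0 : ∀ x ∈ U, t x ≠ 0)
include h ht h0

theorem rescale : MinimalSlantFrame Z U (fun y => t y • n₁ y) (fun y => (t y)⁻¹ • n₂ y) s where
  toSmoothLift := h.toSmoothLift
  contDiffOn₁ := ht.smul h.contDiffOn₁
  contDiffOn₂ := (ht.inv h0).smul h.contDiffOn₂
  null₁ x hx := by
    rw [frameLift_smul, normForm_smul_left, normForm_smul_right, h.null₁ x hx, mul_zero, mul_zero]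
  null₂ x hx := by
    rw [frameLift_smul Z (fun y => (t y)⁻¹), normForm_smul_left, normForm_smul_right,
      h.null₂ x hx, mul_zero, mul_zero]
  pair x hx := by
    rw [frameLift_smul, frameLift_smul Z (fun y => (t y)⁻¹), normForm_smul_left,
      normForm_smul_right, h.pair x hx, Complex.conj_ofReal, Complex.ofReal_inv,
      mul_inv_cancel_left₀ (Complex.ofReal_ne_zero.2 (h0 x hx))]
  span x hx u := by
    obtain ⟨a, b, e⟩ := h.span x hx u
    refine ⟨a * (t x)⁻¹, b * t x, ?_⟩
    rw [smul_smul, smul_smul, inv_mul_cancel_right₀ (h0 x hx), mul_inv_cancel_right₀ (h0 x hx), e]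
  minimal x hx := by
    refine ⟨0, t x * (t x * fderiv ℝ (fun y => (t y)⁻¹) x (n₁ x) - frameConn Z n₁ n₂ x),
      -(1 + s * Complex.I), ?_⟩
    have htx : (t x : ℂ) ≠ 0 := Complex.ofReal_ne_zero.2 (h0 x hx)
    rw [h.covDeriv_frameLift_smul (t := fun y => (t y)⁻¹) h.contDiffOn₂ (ht.inv h0) hx, map_smul,
      map_smul, h.covDeriv₁₂ hx, frameLift_smul Z (fun y => (t y)⁻¹)]
    simp only [← Complex.coe_smul, smul_eq_mul]
    push_cast
    match_scalars <;> field_simp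
    ring

theorem frameCubic_rescale (hx : x ∈ U) :
    frameCubic Z (fun y => t y • n₁ y) (fun y => (t y)⁻¹ • n₂ y) x =
      (t x : ℂ) ^ 3 * frameCubic Z n₁ n₂ x := by
  have htx : (t x : ℂ) ≠ 0 := Complex.ofReal_ne_zero.2 (h0 x hx)
  rw [frameCubic, frameCubic, h.covDeriv_frameLift_smul h.contDiffOn₁ ht hx, frameLift_smul,
    frameLift_smul Z (fun y => (t y)⁻¹)]
  simp only [map_smul, ← Complex.coe_smul, normForm_add_right, normForm_smul_left,
    normForm_smul_right, h.null₁ x hx, Complex.conj_ofReal, Complex.ofReal_inv]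
  rw [inv_mul_cancel_left₀ htx]
  ring

end Rescale

theorem exists_frameCubic_eq_I (h : MinimalSlantFrame Z U n₁ n₂ 0)
    (hflat : ∀ x ∈ U, ∀ u v w, curvature (liftMetric Z) x u v w = 0) :
    ∃ m₁ m₂ : E → E, MinimalSlantFrame Z U m₁ m₂ 0 ∧
      (∀ x ∈ U, frameCubic Z m₁ m₂ x = Complex.I) ∧ ∀ x ∈ U, frameCubic Z m₂ m₁ x = Complex.I := by
  have him (x) (hx : x ∈ U) : frameCubic Z n₁ n₂ x = (frameCubic Z n₁ n₂ x).im * Complex.I :=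
    Complex.ext (by simp [h.re_frameCubic hx]) (by simp)
  have him_ne (x) (hx : x ∈ U) : (frameCubic Z n₁ n₂ x).im ≠ 0 := fun h0 => by
    have hmul := h.frameCubic_mul_frameCubic_of_flat hx (hflat x hx)
    rw [him x hx, h0] at hmul
    simp at hmul
  obtain ⟨t, ht, htq⟩ := exists_contDiffOn_cube_mul_eq_one
    (f := fun x => (frameCubic Z n₁ n₂ x).im)
    (Complex.imCLM.contDiff.comp_contDiffOn h.contDiffOn_frameCubic) him_ne
  have ht0 (x) (hx : x ∈ U) : t x ≠ 0 := fun h0 => by simpa [h0] using htq x hx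
  have hr := h.rescale ht ht0
  have hI (x) (hx : x ∈ U) :
      frameCubic Z (fun y => t y • n₁ y) (fun y => (t y)⁻¹ • n₂ y) x = Complex.I := by
    rw [h.frameCubic_rescale ht ht0 hx, him x hx, ← mul_assoc, ← Complex.ofReal_pow,
      ← Complex.ofReal_mul, htq x hx, Complex.ofReal_one, one_mul]
  refine ⟨_, _, hr, hI, fun x hx => ?_⟩
  have hmul := hr.frameCubic_mul_frameCubic_of_flat hx (hflat x hx)
  rw [hI x hx] at hmul
  exact mul_left_cancel₀ Complex.I_ne_zero (hmul.trans Complex.I_mul_I.symm)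

end MinimalSlantFrame

/-! ### The structure equations of the explicit surface -/

section FrameSystem

variable {E W : Type*} [NormedAddCommGroup E] [NormedSpace ℝ E] [NormedAddCommGroup W]
  [NormedSpace ℂ W] [NormedSpace ℝ W] [IsScalarTower ℝ ℂ W] {K : Set E}

theorem eq_zero_of_hasFDerivAt_smulRight {w : E → W} {φ : E → ℂ} {φ' : E → E →L[ℝ] ℂ}
    (hK : IsOpen K) (hc : IsPreconnected K) (hφ : ∀ x ∈ K, HasFDerivAt φ (φ' x) x)
    (hw : ∀ x ∈ K, HasFDerivAt w ((φ' x).smulRight (w x)) x) {x₀ x : E} (hx₀ : x₀ ∈ K)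
    (hx : x ∈ K) (h0 : w x₀ = 0) : w x = 0 := by
  have hd (y) (hy : y ∈ K) :
      HasFDerivAt (fun y => Complex.exp (-φ y) • w y) (0 : E →L[ℝ] W) y := by
    refine ((hφ y hy).neg.cexp.smul (hw y hy)).congr_fderiv ?_
    ext u
    simp [smul_smul]
  have hconst := hK.is_const_of_fderiv_eq_zero hc
    (fun y hy => (hd y hy).differentiableAt.differentiableWithinAt)
    (fun y hy => (hd y hy).fderiv) hx hx₀
  simpa [h0, Complex.exp_ne_zero] using hconst

/-- The structure equations `dF = θ₁F₁ + θ₂F₂`, `dF₁ = iθ₁F₂ - θ₂F`, `dF₂ = iθ₂F₁ - θ₁F` of a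
horizontal lift `F` of a flat minimal Lagrangian surface, in the null coframe `θ₁`, `θ₂` in which
both cubic coefficients are `i`. -/
structure FrameSystem (K : Set E) (θ₁ θ₂ : E → E →L[ℝ] ℝ) (F F₁ F₂ : E → W) : Prop where
  hasFDerivAt : ∀ x ∈ K, HasFDerivAt F ((θ₁ x).smulRight (F₁ x) + (θ₂ x).smulRight (F₂ x)) x
  hasFDerivAt₁ : ∀ x ∈ K,
    HasFDerivAt F₁ ((θ₁ x).smulRight (Complex.I • F₂ x) - (θ₂ x).smulRight (F x)) x
  hasFDerivAt₂ : ∀ x ∈ K,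
    HasFDerivAt F₂ ((θ₂ x).smulRight (Complex.I • F₁ x) - (θ₁ x).smulRight (F x)) x

/-- The exponents `(μ, ν)` for which `exp (μX + νY)` solves the frame system with `θ₁ = dX` and
`θ₂ = dY`. -/
structure IsFrameExponent (μ ν : ℂ) : Prop where
  mul : μ * ν = -1
  sq_left : μ ^ 2 = Complex.I * ν
  sq_right : ν ^ 2 = Complex.I * μ

theorem IsFrameExponent.symm {μ ν : ℂ} (h : IsFrameExponent μ ν) : IsFrameExponent ν μ :=
  ⟨by rw [mul_comm, h.mul], h.sq_right, h.sq_left⟩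

theorem isFrameExponent_I : IsFrameExponent Complex.I Complex.I :=
  ⟨Complex.I_mul_I, sq _, sq _⟩

/-- The first coefficient of the exponent of `√2 e^{-i(x + y)/2} e^{√3(x - y)/2}`. -/
def tildeExp₁ : ℂ := -(Complex.I / 2) + (√3 / 2 : ℝ)

/-- The second coefficient of the exponent of `√2 e^{-i(x + y)/2} e^{√3(x - y)/2}`. -/
def tildeExp₂ : ℂ := -(Complex.I / 2) - (√3 / 2 : ℝ)

theorem isFrameExponent_tildeExp : IsFrameExponent tildeExp₁ tildeExp₂ := by
  have hsq : ((√3 / 2 : ℝ) : ℂ) ^ 2 = 3 / 4 := by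
    rw [← Complex.ofReal_pow, div_pow, Real.sq_sqrt (by norm_num)]
    norm_num
  have hI := Complex.I_sq
  rw [tildeExp₁, tildeExp₂]
  refine ⟨?_, ?_, ?_⟩
  · linear_combination (1 / 4) * hI - hsq
  · linear_combination (3 / 4) * hI + hsq
  · linear_combination (3 / 4) * hI + hsq

/-- The complex form `μθ₁ + νθ₂`. -/
def exponentForm (μ ν : ℂ) (θ₁ θ₂ : E →L[ℝ] ℝ) : E →L[ℝ] ℂ :=
  μ • Complex.ofRealCLM.comp θ₁ + ν • Complex.ofRealCLM.comp θ₂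

theorem exponentForm_apply (μ ν : ℂ) (θ₁ θ₂ : E →L[ℝ] ℝ) (u : E) :
    exponentForm μ ν θ₁ θ₂ u = μ * θ₁ u + ν * θ₂ u := rfl

theorem hasFDerivAt_exponent {X Y : E → ℝ} {θ₁ θ₂ : E →L[ℝ] ℝ} {x : E} (hX : HasFDerivAt X θ₁ x)
    (hY : HasFDerivAt Y θ₂ x) (μ ν : ℂ) :
    HasFDerivAt (fun y => μ * X y + ν * Y y) (exponentForm μ ν θ₁ θ₂) x :=
  ((Complex.ofRealCLM.hasFDerivAt.comp x hX).const_mul μ).add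
    ((Complex.ofRealCLM.hasFDerivAt.comp x hY).const_mul ν)

namespace FrameSystem

variable {θ₁ θ₂ : E → E →L[ℝ] ℝ} {F F₁ F₂ G G₁ G₂ : E → W}

theorem add (h : FrameSystem K θ₁ θ₂ F F₁ F₂) (h' : FrameSystem K θ₁ θ₂ G G₁ G₂) :
    FrameSystem K θ₁ θ₂ (F + G) (F₁ + G₁) (F₂ + G₂) where
  hasFDerivAt x hx := ((h.hasFDerivAt x hx).add (h'.hasFDerivAt x hx)).congr_fderiv <| by
    ext u
    simp only [add_apply, ContinuousLinearMap.smulRight_apply, Pi.add_apply]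
    module
  hasFDerivAt₁ x hx := ((h.hasFDerivAt₁ x hx).add (h'.hasFDerivAt₁ x hx)).congr_fderiv <| by
    ext u
    simp only [add_apply, sub_apply, ContinuousLinearMap.smulRight_apply, Pi.add_apply]
    module
  hasFDerivAt₂ x hx := ((h.hasFDerivAt₂ x hx).add (h'.hasFDerivAt₂ x hx)).congr_fderiv <| by
    ext u
    simp only [add_apply, sub_apply, ContinuousLinearMap.smulRight_apply, Pi.add_apply]
    module

theorem map (h : FrameSystem K θ₁ θ₂ F F₁ F₂) (A : W →L[ℂ] W) :
    FrameSystem K θ₁ θ₂ (fun y => A (F y)) (fun y => A (F₁ y)) (fun y => A (F₂ y)) where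
  hasFDerivAt x hx :=
    ((A.restrictScalars ℝ).hasFDerivAt.comp x (h.hasFDerivAt x hx)).congr_fderiv <| by
      ext u
      simp
  hasFDerivAt₁ x hx :=
    ((A.restrictScalars ℝ).hasFDerivAt.comp x (h.hasFDerivAt₁ x hx)).congr_fderiv <| by
      ext u
      simp
  hasFDerivAt₂ x hx :=
    ((A.restrictScalars ℝ).hasFDerivAt.comp x (h.hasFDerivAt₂ x hx)).congr_fderiv <| by
      ext u
      simp

omit [IsScalarTower ℝ ℂ W] in
theorem swap (h : FrameSystem K θ₁ θ₂ F F₁ F₂) : FrameSystem K θ₂ θ₁ F F₂ F₁ :=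
  ⟨fun x hx => by rw [add_comm]; exact h.hasFDerivAt x hx, h.hasFDerivAt₂, h.hasFDerivAt₁⟩

theorem exp {X Y : E → ℝ} (hX : ∀ x ∈ K, HasFDerivAt X (θ₁ x) x)
    (hY : ∀ x ∈ K, HasFDerivAt Y (θ₂ x) x) {μ ν : ℂ} (h : IsFrameExponent μ ν) (v : W) :
    FrameSystem K θ₁ θ₂ (fun y => Complex.exp (μ * X y + ν * Y y) • v)
      (fun y => Complex.exp (μ * X y + ν * Y y) • μ • v)
      (fun y => Complex.exp (μ * X y + ν * Y y) • ν • v) := by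
  have hd (x) (hx : x ∈ K) (w : W) :=
    (hasFDerivAt_exponent (hX x hx) (hY x hx) μ ν).cexp.smul_const w
  refine ⟨fun x hx => (hd x hx _).congr_fderiv ?_, fun x hx => (hd x hx _).congr_fderiv ?_,
    fun x hx => (hd x hx _).congr_fderiv ?_⟩ <;>
  ext u <;>
  simp only [ContinuousLinearMap.smulRight_apply, smul_apply, add_apply, sub_apply, smul_eq_mul,
    exponentForm_apply]
  · module
  · match_scalars
    simp only [Complex.coe_algebraMap]
    linear_combination (Complex.exp (μ * X x + ν * Y x)) * (θ₁ x u * h.sq_left + θ₂ x u * h.mul)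
  · match_scalars
    simp only [Complex.coe_algebraMap]
    linear_combination (Complex.exp (μ * X x + ν * Y x)) * (θ₂ x u * h.sq_right + θ₁ x u * h.mul)

theorem hasFDerivAt_component (h : FrameSystem K θ₁ θ₂ F F₁ F₂) {μ ν : ℂ}
    (hμ : IsFrameExponent μ ν) {x : E} (hx : x ∈ K) :
    HasFDerivAt (fun y => F y - ν • F₁ y - μ • F₂ y)
      ((exponentForm μ ν (θ₁ x) (θ₂ x)).smulRight (F x - ν • F₁ x - μ • F₂ x)) x := by
  refine (((h.hasFDerivAt x hx).sub ((h.hasFDerivAt₁ x hx).const_smul ν)).sub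
    ((h.hasFDerivAt₂ x hx).const_smul μ)).congr_fderiv ?_
  ext u
  simp only [ContinuousLinearMap.smulRight_apply, smul_apply, add_apply, sub_apply,
    exponentForm_apply]
  match_scalars <;> simp only [Complex.coe_algebraMap]
  · linear_combination θ₁ x u * hμ.mul + θ₂ x u * hμ.sq_right
  · linear_combination θ₂ x u * hμ.mul + θ₁ x u * hμ.sq_left
  · ring

section Uniqueness

variable (hK : IsOpen K) (hc : IsPreconnected K) {X Y : E → ℝ}
  (hX : ∀ x ∈ K, HasFDerivAt X (θ₁ x) x) (hY : ∀ x ∈ K, HasFDerivAt Y (θ₂ x) x) {x₀ x : E}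
  (hx₀ : x₀ ∈ K) (hx : x ∈ K)
include hK hc hX hY hx₀ hx

theorem eq_zero (h : FrameSystem K θ₁ θ₂ F F₁ F₂) (h0 : F x₀ = 0) (h1 : F₁ x₀ = 0)
    (h2 : F₂ x₀ = 0) : F x = 0 := by
  have hcomp {μ ν : ℂ} (hμ : IsFrameExponent μ ν) : F x - ν • F₁ x - μ • F₂ x = 0 :=
    eq_zero_of_hasFDerivAt_smulRight hK hc
      (fun y hy => hasFDerivAt_exponent (hX y hy) (hY y hy) μ ν)
      (fun y hy => h.hasFDerivAt_component hμ hy) hx₀ hx (by simp [h0, h1, h2])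
  have hsum : (3 : ℂ) • F x = (F x - Complex.I • F₁ x - Complex.I • F₂ x) +
      (F x - tildeExp₂ • F₁ x - tildeExp₁ • F₂ x) +
      (F x - tildeExp₁ • F₁ x - tildeExp₂ • F₂ x) := by
    rw [tildeExp₁, tildeExp₂]
    module
  rw [hcomp isFrameExponent_I, hcomp isFrameExponent_tildeExp, hcomp isFrameExponent_tildeExp.symm,
    add_zero, add_zero] at hsum
  exact (smul_eq_zero.1 hsum).resolve_left three_ne_zero

theorem unique (h : FrameSystem K θ₁ θ₂ F F₁ F₂) (h' : FrameSystem K θ₁ θ₂ G G₁ G₂)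
    (h0 : F x₀ = G x₀) (h1 : F₁ x₀ = G₁ x₀) (h2 : F₂ x₀ = G₂ x₀) : F x = G x := by
  have hsub := (h.add (h'.map (-1))).eq_zero hK hc hX hY hx₀ hx (by simp [h0]) (by simp [h1])
    (by simp [h2])
  simpa [← sub_eq_add_neg, sub_eq_zero] using hsub

end Uniqueness

end FrameSystem

end FrameSystem

section ExplicitSurface

/-- The vector with the three exponential components of `tildeLVec 1` multiplied by `α`, `β`, `γ`;
the derivatives of the explicit surface have this form. -/
def tildeVec (α β γ : ℂ) (x y : ℝ) : Fin 3 → ℂ :=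
  ((1 / √3 : ℝ) : ℂ) •
    ![((√2 : ℝ) : ℂ) * ((α * Complex.exp (tildeExp₁ * x + tildeExp₂ * y) +
        β * Complex.exp (tildeExp₂ * x + tildeExp₁ * y)) / 2),
      γ * Complex.exp (Complex.I * x + Complex.I * y),
      ((√2 : ℝ) : ℂ) * ((α * Complex.exp (tildeExp₁ * x + tildeExp₂ * y) -
        β * Complex.exp (tildeExp₂ * x + tildeExp₁ * y)) / 2)]

/-- The `x`-derivative of `tildeLVec 1`. -/
def tildeFrame₁ : ℝ → ℝ → Fin 3 → ℂ := tildeVec tildeExp₁ tildeExp₂ Complex.I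

/-- The `y`-derivative of `tildeLVec 1`. -/
def tildeFrame₂ : ℝ → ℝ → Fin 3 → ℂ := tildeVec tildeExp₂ tildeExp₁ Complex.I

theorem tildeLVec_one (x y : ℝ) : tildeLVec 1 x y = tildeVec 1 1 1 x y := by
  have hexp₁ : Complex.exp (tildeExp₁ * x + tildeExp₂ * y) =
      Complex.exp (-(Complex.I / (2 * (1 : ℝ))) * (x + (1 : ℝ) ^ 2 * y)) *
        Complex.exp ((√3 / (2 * 1) * (x - 1 ^ 2 * y) : ℝ)) := by
    rw [← Complex.exp_add, tildeExp₁, tildeExp₂]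
    push_cast
    ring_nf
  have hexp₂ : Complex.exp (tildeExp₂ * x + tildeExp₁ * y) =
      Complex.exp (-(Complex.I / (2 * (1 : ℝ))) * (x + (1 : ℝ) ^ 2 * y)) *
        Complex.exp (-(√3 / (2 * 1) * (x - 1 ^ 2 * y) : ℝ)) := by
    rw [← Complex.exp_add, tildeExp₁, tildeExp₂]
    push_cast
    ring_nf
  have hI : Complex.I * ((1 : ℝ) * y + x / (1 : ℝ)) = Complex.I * x + Complex.I * y := by
    push_cast
    ring
  rw [tildeLVec, tildeVec, hexp₁, hexp₂, hI, Complex.ofReal_cosh, Complex.ofReal_sinh,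
    Complex.cosh, Complex.sinh]
  congr 1
  funext k
  fin_cases k <;> simp <;> ring

theorem conj_tildeExp₁ : conj tildeExp₁ = -tildeExp₂ := by
  simp only [tildeExp₁, tildeExp₂, map_add, map_neg, map_div₀, Complex.conj_I,
    Complex.conj_ofReal, map_ofNat]
  ring

theorem conj_tildeExp₂ : conj tildeExp₂ = -tildeExp₁ := by
  rw [← neg_eq_iff_eq_neg, ← map_neg, ← conj_tildeExp₁, Complex.conj_conj]

theorem tildeExp_add : tildeExp₁ + tildeExp₂ = -Complex.I := by
  rw [tildeExp₁, tildeExp₂]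
  ring

theorem conj_exp_mul_exp {a b c d : ℂ} (hac : conj a = -c) (hbd : conj b = -d) (x y : ℝ) :
    conj (Complex.exp (a * x + b * y)) * Complex.exp (c * x + d * y) = 1 := by
  rw [← Complex.exp_conj, ← Complex.exp_add]
  simp only [map_add, map_mul, hac, hbd, Complex.conj_ofReal]
  rw [← Complex.exp_zero]
  ring_nf

theorem hermForm_tildeVec (α β γ α' β' γ' : ℂ) (x y : ℝ) :
    hermForm (tildeVec α β γ x y) (tildeVec α' β' γ' x y) =
      -(conj α * β' + conj β * α' + conj γ * γ') / 3 := by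
  have h2 : ((√2 : ℝ) : ℂ) * ((√2 : ℝ) : ℂ) = 2 := by
    rw [← Complex.ofReal_mul, Real.mul_self_sqrt (by norm_num), Complex.ofReal_ofNat]
  have h3 : ((1 / √3 : ℝ) : ℂ) * ((1 / √3 : ℝ) : ℂ) = 1 / 3 := by
    rw [← Complex.ofReal_mul, div_mul_div_comm, Real.mul_self_sqrt (by norm_num)]
    norm_num
  have h₁₂ := conj_exp_mul_exp conj_tildeExp₁ conj_tildeExp₂ x y
  have h₂₁ := conj_exp_mul_exp conj_tildeExp₂ conj_tildeExp₁ x y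
  have hI := conj_exp_mul_exp Complex.conj_I Complex.conj_I x y
  rw [tildeVec, tildeVec, hermForm_smul_smul, Complex.conj_ofReal, h3]
  generalize Complex.exp (tildeExp₁ * x + tildeExp₂ * y) = a at *
  generalize Complex.exp (tildeExp₂ * x + tildeExp₁ * y) = b at *
  generalize Complex.exp (Complex.I * x + Complex.I * y) = c at *
  simp only [hermForm, Matrix.cons_val_zero, Matrix.cons_val_one, Matrix.cons_val, map_mul,
    Complex.conj_ofReal, map_add, map_sub, map_div₀, map_ofNat]
  linear_combination (-(1 / 3 : ℂ)) * (conj α * β' * h₁₂ + conj β * α' * h₂₁ + conj γ * γ' * hI) -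
    (1 / 6) * (conj α * β' * (conj a * b) + conj β * α' * (conj b * a)) * h2

theorem isNullBasis_tilde (x y : ℝ) :
    IsNullBasis (tildeLVec 1 x y) (tildeFrame₁ x y) (tildeFrame₂ x y) 1 := by
  have hself : hermForm (tildeLVec 1 x y) (tildeLVec 1 x y) = -1 := tildeLVec_mem 1 x y
  have hadd := tildeExp_add
  have hexp := isFrameExponent_tildeExp
  refine ⟨by simp [hself], one_ne_zero, ?_, ?_, ?_, ?_, ?_⟩ <;>
  rw [normForm_of_hermForm_self hself] <;>
  simp only [tildeLVec_one, tildeFrame₁, tildeFrame₂, hermForm_tildeVec, conj_tildeExp₁,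
    conj_tildeExp₂, map_one, Complex.conj_I]
  · linear_combination (-1 / 3) * hadd
  · linear_combination (-1 / 3) * hadd
  · linear_combination (1 / 3) * (hexp.sq_left + hexp.sq_right + Complex.I * hadd)
  · linear_combination (1 / 3) * (hexp.sq_left + hexp.sq_right + Complex.I * hadd)
  · linear_combination (2 / 3) * hexp.mul + (1 / 3) * Complex.I_sq

variable {E : Type*} [NormedAddCommGroup E] [NormedSpace ℝ E] {K : Set E}
  {θ₁ θ₂ : E → E →L[ℝ] ℝ} {X Y : E → ℝ}

theorem frameSystem_tilde (hX : ∀ x ∈ K, HasFDerivAt X (θ₁ x) x)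
    (hY : ∀ x ∈ K, HasFDerivAt Y (θ₂ x) x) :
    FrameSystem K θ₁ θ₂ (fun x => tildeLVec 1 (X x) (Y x)) (fun x => tildeFrame₁ (X x) (Y x))
      (fun x => tildeFrame₂ (X x) (Y x)) := by
  have h₁ := FrameSystem.exp hX hY isFrameExponent_tildeExp
    (((1 / √3 : ℝ) : ℂ) • ![((√2 : ℝ) : ℂ) / 2, 0, ((√2 : ℝ) : ℂ) / 2])
  have h₂ := FrameSystem.exp hX hY isFrameExponent_tildeExp.symm
    (((1 / √3 : ℝ) : ℂ) • ![((√2 : ℝ) : ℂ) / 2, 0, -(((√2 : ℝ) : ℂ) / 2)])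
  have h₃ := FrameSystem.exp hX hY isFrameExponent_I
    (((1 / √3 : ℝ) : ℂ) • (![0, 1, 0] : Fin 3 → ℂ))
  convert (h₁.add h₂).add h₃ using 1 <;>
  · funext x k
    fin_cases k <;> simp [tildeLVec_one, tildeFrame₁, tildeFrame₂, tildeVec] <;> ring

theorem IsNullBasis.exists_unitary {Z e₁ e₂ Z' e₁' e₂' : Fin 3 → ℂ} {c : ℂ}
    (h : IsNullBasis Z e₁ e₂ c) (h' : IsNullBasis Z' e₁' e₂' c) (hZ : hermForm Z Z = -1)
    (hZ' : hermForm Z' Z' = -1) :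
    ∃ A : HermUnitary, A.1 Z = Z' ∧ A.1 e₁ = e₁' ∧ A.1 e₂ = e₂' := by
  set A := h.basis.equiv h'.basis (Equiv.refl _)
  have hA (k) : A (![Z, e₁, e₂] k) = ![Z', e₁', e₂'] k := by
    rw [← h.basis_apply, ← h'.basis_apply, Module.Basis.equiv_apply, Equiv.refl_apply]
  have h0 : A Z = Z' := hA 0
  have h1 : A e₁ = e₁' := hA 1
  have h2 : A e₂ = e₂' := hA 2
  refine ⟨⟨A, fun z w => ?_⟩, h0, h1, h2⟩
  obtain ⟨a, b, d, rfl⟩ := h.exists_eq_comb z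
  obtain ⟨a', b', d', rfl⟩ := h.exists_eq_comb w
  simp only [map_add, map_smul, h0, h1, h2, ← normForm_of_hermForm_self hZ]
  rw [normForm_of_hermForm_self hZ, ← normForm_of_hermForm_self hZ']
  simp only [normForm_add_left, normForm_smul_left, h.normForm_base_comb, h.normForm_left_comb,
    h.normForm_right_comb, h'.normForm_base_comb, h'.normForm_left_comb, h'.normForm_right_comb]

theorem FrameSystem.exists_unitary {F F₁ F₂ : E → Fin 3 → ℂ} (h : FrameSystem K θ₁ θ₂ F F₁ F₂)
    (hK : IsOpen K) (hc : IsPreconnected K) (hX : ∀ x ∈ K, HasFDerivAt X (θ₁ x) x)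
    (hY : ∀ x ∈ K, HasFDerivAt Y (θ₂ x) x) {x₀ : E} (hx₀ : x₀ ∈ K)
    (hF : hermForm (F x₀) (F x₀) = -1) (hb : IsNullBasis (F x₀) (F₁ x₀) (F₂ x₀) 1) :
    ∃ A : HermUnitary, ∀ x ∈ K, A.1 (F x) = tildeLVec 1 (X x) (Y x) := by
  obtain ⟨A, h0, h1, h2⟩ := hb.exists_unitary (isNullBasis_tilde (X x₀) (Y x₀)) hF
    (tildeLVec_mem 1 _ _)
  exact ⟨A, fun x hx => (h.map (LinearMap.toContinuousLinearMap A.1.toLinearMap)).unique hK hc hX hY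
    hx₀ hx (frameSystem_tilde hX hY) h0 h1 h2⟩

end ExplicitSurface

/-! ### Rigidity of the explicit surface -/

section Rigidity

variable {E : Type*} [NormedAddCommGroup E] [NormedSpace ℝ E] {K : Set E} {F G : E → Fin 3 → ℂ}

theorem exists_eq_smul_of_horizontal {F' G' : E → E →L[ℝ] (Fin 3 → ℂ)} (hK : IsOpen K)
    (hc : IsPreconnected K) (hF : ∀ x ∈ K, HasFDerivAt F (F' x) x)
    (hG : ∀ x ∈ K, HasFDerivAt G (G' x) x) (hF' : ∀ x ∈ K, ∀ u, hermForm (F x) (F' x u) = 0)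
    (hG' : ∀ x ∈ K, ∀ u, hermForm (G x) (G' x u) = 0) (hF₁ : ∀ x ∈ K, hermForm (F x) (F x) = -1)
    (hG₀ : ∀ x ∈ K, G x ≠ 0) (h : ∀ x ∈ K, ∃ c : ℂ, G x = c • F x) :
    ∃ c : ℂ, ∀ x ∈ K, G x = c • F x := by
  have hfactor (x) (hx : x ∈ K) : G x = (-hermForm (F x) (G x)) • F x := by
    obtain ⟨c, hcx⟩ := h x hx
    rw [hcx, hermForm_smul_right, hF₁ x hx, mul_neg_one, neg_neg]
  have hd (x) (hx : x ∈ K) := hasFDerivAt_hermForm (hF x hx) (hG x hx)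
  have hzero (x) (hx : x ∈ K) : fderiv ℝ (fun y => hermForm (F y) (G y)) x = 0 := by
    rw [(hd x hx).fderiv]
    ext u
    obtain ⟨c, hcx⟩ := h x hx
    have hc0 : c ≠ 0 := by
      rintro rfl
      exact hG₀ x hx (by rw [hcx, zero_smul])
    have h₁ : hermForm (F' x u) (F x) = 0 := by rw [← conj_hermForm, hF' x hx, map_zero]
    have h₂ : hermForm (F x) (G' x u) = 0 := by
      simpa [hcx, hermForm_smul_left, hc0] using hG' x hx u
    change hermForm (F x) (G' x u) + hermForm (F' x u) (G x) = 0
    rw [h₂, hcx, hermForm_smul_right, h₁, mul_zero, zero_add]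
  obtain ⟨c, hconst⟩ := hK.exists_is_const_of_fderiv_eq_zero hc
    (fun x hx => (hd x hx).differentiableAt.differentiableWithinAt) hzero
  exact ⟨-c, fun x hx => by rw [hfactor x hx, hconst x hx]⟩

theorem IsNullBasis.hermForm_comb_eq_zero {Z e₁ e₂ : Fin 3 → ℂ} {c : ℂ}
    (h : IsNullBasis Z e₁ e₂ c) (a b : ℂ) : hermForm Z (a • e₁ + b • e₂) = 0 := by
  rw [hermForm_add_right, hermForm_smul_right, hermForm_smul_right,
    (normForm_eq_zero_iff _ _ h.neg).1 h.orth₁, (normForm_eq_zero_iff _ _ h.neg).1 h.orth₂,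
    mul_zero, mul_zero, add_zero]

theorem IsNullBasis.coeff_eq {Z e₁ e₂ : Fin 3 → ℂ} {c : ℂ} (h : IsNullBasis Z e₁ e₂ c)
    {a b a' b' r t : ℝ}
    (heq : Complex.I • ((r : ℂ) • e₁ + (t : ℂ) • e₂) = ((-2 * a * b : ℝ) : ℂ) • Z +
      (a' + (b ^ 2 : ℝ) * Complex.I) • e₁ + (b' + (a ^ 2 : ℝ) * Complex.I) • e₂) :
    a * b = 0 ∧ r = b ^ 2 ∧ t = a ^ 2 := by
  have hcomb : ((-2 * a * b : ℝ) : ℂ) • Z + (a' + (b ^ 2 : ℝ) * Complex.I - r * Complex.I) • e₁ +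
      (b' + (a ^ 2 : ℝ) * Complex.I - t * Complex.I) • e₂ = 0 := by
    rw [← sub_eq_zero.2 heq.symm]
    module
  obtain ⟨hZ, h₁, h₂⟩ := h.comb_eq_zero hcomb
  have h₁' := congrArg Complex.im h₁
  have h₂' := congrArg Complex.im h₂
  simp only [Complex.sub_im, Complex.add_im, Complex.ofReal_im, Complex.im_ofReal_mul,
    Complex.I_im, mul_one, zero_add, Complex.zero_im] at h₁' h₂'
  refine ⟨?_, by linarith, by linarith⟩
  linarith [Complex.ofReal_eq_zero.1 hZ]

theorem eq_one_or_eq_zero_of_mul_eq_zero {a b : ℝ} (hab : a * b = 0) (h : a ^ 3 + b ^ 3 = 1) :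
    a = 1 ∧ b = 0 ∨ a = 0 ∧ b = 1 := by
  have cube (z : ℝ) (hz : z ^ 3 = 1) : z = 1 := by
    nlinarith [sq_nonneg (z + 1), sq_nonneg z]
  rcases mul_eq_zero.1 hab with rfl | rfl
  · exact .inr ⟨rfl, cube b (by linarith)⟩
  · exact .inl ⟨cube a (by linarith), rfl⟩

theorem hasFDerivAt_coord (k : Fin 2) (s : EuclideanSpace ℝ (Fin 2)) :
    HasFDerivAt (fun s : EuclideanSpace ℝ (Fin 2) => s k)
      (EuclideanSpace.proj k : EuclideanSpace ℝ (Fin 2) →L[ℝ] ℝ) s :=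
  (EuclideanSpace.proj k : EuclideanSpace ℝ (Fin 2) →L[ℝ] ℝ).hasFDerivAt

namespace FrameSystem

theorem congr {θ₁ θ₂ : E → E →L[ℝ] ℝ} {F₁ F₂ : E → Fin 3 → ℂ} (h : FrameSystem K θ₁ θ₂ F F₁ F₂)
    (hK : IsOpen K) (hFG : Set.EqOn G F K) : FrameSystem K θ₁ θ₂ G F₁ F₂ where
  hasFDerivAt x hx :=
    (h.hasFDerivAt x hx).congr_of_eventuallyEq (hFG.eventuallyEq_of_mem (hK.mem_nhds hx))
  hasFDerivAt₁ x hx := hFG hx ▸ h.hasFDerivAt₁ x hx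
  hasFDerivAt₂ x hx := hFG hx ▸ h.hasFDerivAt₂ x hx

section Comparison

variable {θ₁ θ₂ η₁ η₂ : E → E →L[ℝ] ℝ} {F₁ F₂ G₁ G₂ : E → Fin 3 → ℂ}
  (h : FrameSystem K θ₁ θ₂ F F₁ F₂) (h' : FrameSystem K η₁ η₂ F G₁ G₂) {x : E} (hx : x ∈ K)
include h h' hx

theorem frame_comb_eq (u : E) : (η₁ x u : ℂ) • G₁ x + (η₂ x u : ℂ) • G₂ x =
    (θ₁ x u : ℂ) • F₁ x + (θ₂ x u : ℂ) • F₂ x := by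
  simpa using DFunLike.congr_fun ((h'.hasFDerivAt x hx).unique (h.hasFDerivAt x hx)) u

/-- Differentiating `G₁ = θ₁(u)F₁ + θ₂(u)F₂` along `u` gives `iG₂` on the left. -/
theorem I_smul_frame_eq (hK : IsOpen K) (hθ₁ : DifferentiableAt ℝ θ₁ x)
    (hθ₂ : DifferentiableAt ℝ θ₂ x) {u : E} (hu₁ : ∀ y ∈ K, η₁ y u = 1)
    (hu₂ : ∀ y ∈ K, η₂ y u = 0) : ∃ a' b' : ℝ,
    Complex.I • G₂ x = ((-2 * θ₁ x u * θ₂ x u : ℝ) : ℂ) • F x +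
      (a' + (θ₂ x u ^ 2 : ℝ) * Complex.I) • F₁ x + (b' + (θ₁ x u ^ 2 : ℝ) * Complex.I) • F₂ x := by
  have hG : G₁ =ᶠ[nhds x] fun y => θ₁ y u • F₁ y + θ₂ y u • F₂ y := by
    filter_upwards [hK.mem_nhds hx] with y hy
    simpa [hu₁ y hy, hu₂ y hy] using h.frame_comb_eq h' hy u
  have ha := hθ₁.hasFDerivAt.clm_apply (hasFDerivAt_const u x)
  have hb := hθ₂.hasFDerivAt.clm_apply (hasFDerivAt_const u x)
  have hcomb := (ha.smul (h.hasFDerivAt₁ x hx)).add (hb.smul (h.hasFDerivAt₂ x hx))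
  have heq := DFunLike.congr_fun
    ((h'.hasFDerivAt₁ x hx).unique (hcomb.congr_of_eventuallyEq hG)) u
  refine ⟨fderiv ℝ θ₁ x u u, fderiv ℝ θ₂ x u u, ?_⟩
  simp only [sub_apply, ContinuousLinearMap.smulRight_apply, hu₁ x hx, hu₂ x hx, one_smul,
    zero_smul, sub_zero, add_apply, smul_apply, ContinuousLinearMap.comp_apply,
    ContinuousLinearMap.flip_apply, zero_apply, map_zero, zero_add] at heq
  rw [heq]
  match_scalars <;> simp only [Complex.coe_algebraMap] <;> ring

end Comparison

variable {K : Set (EuclideanSpace ℝ (Fin 2))}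
  {θ₁ θ₂ : EuclideanSpace ℝ (Fin 2) → EuclideanSpace ℝ (Fin 2) →L[ℝ] ℝ}
  {F F₁ F₂ G₁ G₂ : EuclideanSpace ℝ (Fin 2) → Fin 3 → ℂ} {s : EuclideanSpace ℝ (Fin 2)}

theorem frame_eq_or_eq_swap (hK : IsOpen K) (h : FrameSystem K θ₁ θ₂ F F₁ F₂)
    (h' : FrameSystem K (fun _ => EuclideanSpace.proj 0) (fun _ => EuclideanSpace.proj 1) F G₁ G₂)
    (hs : s ∈ K) (hθ₁ : DifferentiableAt ℝ θ₁ s) (hθ₂ : DifferentiableAt ℝ θ₂ s)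
    (hF : IsNullBasis (F s) (F₁ s) (F₂ s) 1) (hG : IsNullBasis (F s) (G₁ s) (G₂ s) 1) :
    G₁ s = F₁ s ∧ G₂ s = F₂ s ∨ G₁ s = F₂ s ∧ G₂ s = F₁ s := by
  set e₀ : EuclideanSpace ℝ (Fin 2) := EuclideanSpace.single 0 1
  set e₁ : EuclideanSpace ℝ (Fin 2) := EuclideanSpace.single 1 1
  have hG₁ : G₁ s = (θ₁ s e₀ : ℂ) • F₁ s + (θ₂ s e₀ : ℂ) • F₂ s := by
    simpa [e₀] using h.frame_comb_eq h' hs e₀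
  have hG₂ : G₂ s = (θ₁ s e₁ : ℂ) • F₁ s + (θ₂ s e₁ : ℂ) • F₂ s := by
    simpa [e₁] using h.frame_comb_eq h' hs e₁
  obtain ⟨a', b', hI⟩ := h.I_smul_frame_eq h' hs hK hθ₁ hθ₂ (u := e₀)
    (fun _ _ => by simp [e₀]) (fun _ _ => by simp [e₀])
  rw [hG₂] at hI
  obtain ⟨hab, hr, ht⟩ := hF.coeff_eq hI
  have hpair := hG.pair
  rw [hG₁, hG₂, hr, ht] at hpair
  have hcube : θ₁ s e₀ ^ 3 + θ₂ s e₀ ^ 3 = 1 := by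
    simp only [normForm_add_left, normForm_add_right, normForm_smul_left, normForm_smul_right,
      hF.null₁, hF.null₂, hF.pair, hF.pair_symm, Complex.conj_ofReal, map_one] at hpair
    have hcubeℂ : ((θ₁ s e₀ ^ 3 + θ₂ s e₀ ^ 3 : ℝ) : ℂ) = 1 := by
      push_cast at hpair ⊢
      linear_combination -hpair
    exact_mod_cast hcubeℂ
  rcases eq_one_or_eq_zero_of_mul_eq_zero hab hcube with ⟨ha, hb⟩ | ⟨ha, hb⟩
  · exact .inl ⟨by simp [hG₁, ha, hb], by simp [hG₂, hr, ht, ha, hb]⟩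
  · exact .inr ⟨by simp [hG₁, ha, hb], by simp [hG₂, hr, ht, ha, hb]⟩

end FrameSystem

variable {K : Set (EuclideanSpace ℝ (Fin 2))} {p q : EuclideanSpace ℝ (Fin 2) → ℝ}
  {B : HermUnitary}

theorem ne_zero_of_tildeLVec_eq_smul {a x y : ℝ} {c : ℂ} {v : Fin 3 → ℂ}
    (h : tildeLVec a x y = c • v) : c ≠ 0 := by
  rintro rfl
  have hself : hermForm (tildeLVec a x y) (tildeLVec a x y) = -1 := tildeLVec_mem a x y
  simp [h, hermForm] at hself

theorem exists_tildeLVec_eq_smul (hK : IsOpen K) (hc : IsPreconnected K)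
    (hp : DifferentiableOn ℝ p K) (hq : DifferentiableOn ℝ q K)
    (hB : ∀ s ∈ K, ∃ c : ℂ, tildeLVec 1 (p s) (q s) = c • B.1 (tildeLVec 1 (s 0) (s 1))) :
    ∃ c : ℂ, ∀ s ∈ K, tildeLVec 1 (p s) (q s) = c • B.1 (tildeLVec 1 (s 0) (s 1)) := by
  have hsys := frameSystem_tilde (fun s hs => (hp.differentiableAt (hK.mem_nhds hs)).hasFDerivAt)
    (fun s hs => (hq.differentiableAt (hK.mem_nhds hs)).hasFDerivAt)
  have hcoord := frameSystem_tilde (K := K) (fun s _ => hasFDerivAt_coord 0 s)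
    (fun s _ => hasFDerivAt_coord 1 s)
  have hself (x y : ℝ) : hermForm (tildeLVec 1 x y) (tildeLVec 1 x y) = -1 := tildeLVec_mem 1 x y
  have hBcoord := hcoord.map (LinearMap.toContinuousLinearMap B.1.toLinearMap)
  refine exists_eq_smul_of_horizontal hK hc hBcoord.hasFDerivAt hsys.hasFDerivAt
    (fun s _ u => ?_) (fun s _ u => ?_) (fun s _ => ?_) (fun s _ h0 => ?_) hB
  · exact ((isNullBasis_tilde (s 0) (s 1)).unitary_map B).hermForm_comb_eq_zero (u 0) (u 1)
  · exact (isNullBasis_tilde (p s) (q s)).hermForm_comb_eq_zero (fderiv ℝ p s u) (fderiv ℝ q s u)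
  · exact (B.2 _ _).trans (hself _ _)
  · simpa [h0, hermForm] using hself (p s) (q s)

/-- Two unitary lifts of the explicit surface that agree on an open set have the same null frames
up to order, so that the change of coordinates is a translation, possibly after an exchange of the
two coordinates. -/
theorem exists_affineEquiv_tildeLVec (hK : IsOpen K)
    (hc : IsPreconnected K) (hne : K.Nonempty) (hp : ContDiffOn ℝ ∞ p K) (hq : ContDiffOn ℝ ∞ q K)
    (hB : ∀ s ∈ K, ∃ c : ℂ, tildeLVec 1 (p s) (q s) = c • B.1 (tildeLVec 1 (s 0) (s 1))) :
    ∃ (τ : EuclideanSpace ℝ (Fin 2) ≃ᴬ[ℝ] EuclideanSpace ℝ (Fin 2)) (c : ℂ), ∀ s,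
      tildeLVec 1 (τ s 0) (τ s 1) = c • B.1 (tildeLVec 1 (s 0) (s 1)) := by
  obtain ⟨s₀, hs₀⟩ := hne
  obtain ⟨c, hcB⟩ := exists_tildeLVec_eq_smul hK hc (hp.differentiableOn (by simp))
    (hq.differentiableOn (by simp)) hB
  have hd {f : EuclideanSpace ℝ (Fin 2) → ℝ} (hf : ContDiffOn ℝ ∞ f K) (s) (hs : s ∈ K) :
      HasFDerivAt f (fderiv ℝ f s) s :=
    ((hf.differentiableOn (by simp)).differentiableAt (hK.mem_nhds hs)).hasFDerivAt
  have hd' {f : EuclideanSpace ℝ (Fin 2) → ℝ} (hf : ContDiffOn ℝ ∞ f K) :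
      DifferentiableAt ℝ (fderiv ℝ f) s₀ :=
    ((contDiffOn_fderiv hK hf).contDiffAt (hK.mem_nhds hs₀)).differentiableAt (by simp)
  have hBcoord (K' : Set (EuclideanSpace ℝ (Fin 2))) :=
    (frameSystem_tilde (K := K') (fun s _ => hasFDerivAt_coord 0 s)
      (fun s _ => hasFDerivAt_coord 1 s)).map (c • LinearMap.toContinuousLinearMap B.1.toLinearMap)
  have hbasis : IsNullBasis _ _ _ 1 :=
    ((isNullBasis_tilde (s₀ 0) (s₀ 1)).unitary_map B).smul
      (ne_zero_of_tildeLVec_eq_smul (hcB s₀ hs₀))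
  rw [← hcB s₀ hs₀] at hbasis
  have hframe := (frameSystem_tilde (hd hp) (hd hq)).frame_eq_or_eq_swap hK
    ((hBcoord K).congr hK hcB) hs₀ (hd' hp) (hd' hq) (isNullBasis_tilde _ _) hbasis
  rcases hframe with ⟨h₁, h₂⟩ | ⟨h₁, h₂⟩
  · refine ⟨.constVAdd ℝ _ !₂[p s₀ - s₀ 0, q s₀ - s₀ 1], c, fun s => ?_⟩
    have hsys := frameSystem_tilde (K := Set.univ)
      (fun s _ => (hasFDerivAt_coord 0 s).const_add (p s₀ - s₀ 0))
      (fun s _ => (hasFDerivAt_coord 1 s).const_add (q s₀ - s₀ 1))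
    exact hsys.unique isOpen_univ isPreconnected_univ (fun s _ => hasFDerivAt_coord 0 s)
      (fun s _ => hasFDerivAt_coord 1 s) (Set.mem_univ s₀) (Set.mem_univ s) (hBcoord _)
      (by simpa using hcB s₀ hs₀) (by simpa using h₁.symm) (by simpa using h₂.symm)
  · refine ⟨(LinearIsometryEquiv.piLpCongrLeft 2 ℝ ℝ
      (Equiv.swap (0 : Fin 2) 1)).toContinuousLinearEquiv.toContinuousAffineEquiv.trans
        (.constVAdd ℝ _ !₂[p s₀ - s₀ 1, q s₀ - s₀ 0]), c, fun s => ?_⟩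
    have hsys := (frameSystem_tilde (K := Set.univ)
      (fun s _ => (hasFDerivAt_coord 1 s).const_add (p s₀ - s₀ 1))
      (fun s _ => (hasFDerivAt_coord 0 s).const_add (q s₀ - s₀ 0))).swap
    exact hsys.unique isOpen_univ isPreconnected_univ (fun s _ => hasFDerivAt_coord 0 s)
      (fun s _ => hasFDerivAt_coord 1 s) (Set.mem_univ s₀) (Set.mem_univ s) (hBcoord _)
      (by simpa using hcB s₀ hs₀) (by simpa using h₁.symm) (by simpa using h₂.symm)

end Rigidity

/-! ### Integration of flat frames -/

section FlatFrame

variable {E : Type*} [NormedAddCommGroup E] [NormedSpace ℝ E] {Z : E → Fin 3 → ℂ} {U : Set E}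
  {n₁ n₂ : E → E} {x : E}

/-- A null frame of a minimal Lagrangian surface for which both components `⟨h(nᵢ, nᵢ), J nᵢ⟩` of
the cubic form are normalized. Such frames exist exactly on flat surfaces. -/
structure FlatFrame (Z : E → Fin 3 → ℂ) (U : Set E) (n₁ n₂ : E → E) : Prop
    extends MinimalSlantFrame Z U n₁ n₂ 0 where
  frameCubic₁ : ∀ x ∈ U, frameCubic Z n₁ n₂ x = Complex.I
  frameCubic₂ : ∀ x ∈ U, frameCubic Z n₂ n₁ x = Complex.I

/-- The real one-form with value `1` on `m` and `0` on `n`, for a null frame `m, n`. -/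
def frameCoform (Z : E → Fin 3 → ℂ) (n : E → E) (x : E) : E →L[ℝ] ℝ :=
  (hermForm (Z x) (Z x)).re⁻¹ •
    Complex.reCLM.comp ((hermCLM (frameLift Z n x)).comp (covDeriv Z Z x))

theorem frameCoform_apply (Z : E → Fin 3 → ℂ) (n : E → E) (x u : E) :
    frameCoform Z n x u = -(normForm (Z x) (frameLift Z n x) (covDeriv Z Z x u)).re := by
  simp only [frameCoform, normForm, smul_apply, ContinuousLinearMap.comp_apply, hermCLM_apply,
    Complex.reCLM_apply, smul_eq_mul, Complex.re_ofReal_mul, inv_neg, neg_mul, neg_neg]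

theorem SmoothLift.contDiffOn_frameCoform (h : SmoothLift Z U) {n : E → E}
    (hn : ContDiffOn ℝ ∞ n U) : ContDiffOn ℝ ∞ (frameCoform Z n) U := by
  have hinv : ContDiffOn ℝ ∞ (fun x => (hermForm (Z x) (Z x)).re⁻¹) U :=
    (Complex.reCLM.contDiff.comp_contDiffOn (contDiffOn_hermForm h.contDiffOn h.contDiffOn)).inv
      fun x hx => (h.neg x hx).ne
  exact hinv.smul (contDiffOn_const.clm_comp ((hermCLM.contDiff.comp_contDiffOn
    (h.contDiffOn_frameLift hn)).clm_comp (h.contDiffOn_covDeriv h.contDiffOn)))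

theorem SmoothLift.fderiv_frameCoform_apply (h : SmoothLift Z U) {n : E → E}
    (hn : ContDiffOn ℝ ∞ n U) (hx : x ∈ U) (u v : E) :
    fderiv ℝ (frameCoform Z n) x u v =
      -((normForm (Z x) (covDeriv Z (frameLift Z n) x u) (covDeriv Z Z x v)).re +
        (normForm (Z x) (covHess Z x u v) (frameLift Z n x)).re) := by
  have dθ := h.differentiableAt_of_contDiffOn (h.contDiffOn_frameCoform hn) hx
  have dn := h.differentiableAt_of_contDiffOn (h.contDiffOn_frameLift hn) hx
  have dv := h.differentiableAt_of_contDiffOn (h.contDiffOn_covDeriv_self_apply v) hx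
  calc fderiv ℝ (frameCoform Z n) x u v = fderiv ℝ (fun y => frameCoform Z n y v) x u := by
        rw [fderiv_clm_apply dθ (differentiableAt_const v)]
        simp
    _ = _ := by
        simp only [frameCoform_apply]
        rw [fderiv_fun_neg, neg_apply, fderiv_re_normForm (h.differentiableAt hx) dn dv
          (h.neg x hx), normForm_re_comm _ (frameLift Z n x)]
        rfl

theorem MinimalSlantFrame.frameCoform_eq (h : MinimalSlantFrame Z U n₁ n₂ 0) (hx : x ∈ U) (u : E) :
    u = frameCoform Z n₂ x u • n₁ x + frameCoform Z n₁ x u • n₂ x := by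
  obtain ⟨a, b, e⟩ := h.span x hx u
  have hb := h.isNullBasis_one hx
  have hu : covDeriv Z Z x u = (0 : ℂ) • Z x + (a : ℂ) • frameLift Z n₁ x +
      (b : ℂ) • frameLift Z n₂ x := by
    rw [e, map_add, map_smul, map_smul, zero_smul, zero_add, Complex.coe_smul, Complex.coe_smul,
      frameLift, frameLift]
  rw [frameCoform_apply, frameCoform_apply, hu, hb.normForm_left_comb, hb.normForm_right_comb]
  simpa using e

namespace FlatFrame

section Frame

variable (h : FlatFrame Z U n₁ n₂)
include h

theorem swap : FlatFrame Z U n₂ n₁ where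
  toMinimalSlantFrame := h.toMinimalSlantFrame.swap_zero
  frameCubic₁ := h.frameCubic₂
  frameCubic₂ := h.frameCubic₁

theorem frameConn_eq_zero (hx : x ∈ U) : frameConn Z n₂ n₁ x = 0 := by
  have hcodazzi := (h.gauss_codazzi hx).2
  have hconst : frameCubic Z n₁ n₂ =ᶠ[nhds x] fun _ => Complex.I :=
    Filter.eventually_of_mem (h.isOpen.mem_nhds hx) h.frameCubic₁
  rw [hconst.fderiv_eq, h.frameCubic₁ x hx, fderiv_fun_const] at hcodazzi
  simpa using hcodazzi

theorem covDeriv_eq (hx : x ∈ U) (u : E) : covDeriv Z (frameLift Z n₁) x u =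
    (frameCoform Z n₂ x u * Complex.I) • frameLift Z n₂ x - (frameCoform Z n₁ x u : ℂ) • Z x := by
  have h₁ : covDeriv Z (frameLift Z n₁) x (n₁ x) = Complex.I • frameLift Z n₂ x := by
    simp [h.covDeriv₁₁ hx, h.swap.frameConn_eq_zero hx, h.frameCubic₁ x hx]
  have h₂ : covDeriv Z (frameLift Z n₁) x (n₂ x) = -Z x := by
    simp [h.covDeriv₂₁ hx, h.frameConn_eq_zero hx]
  conv_lhs => rw [h.frameCoform_eq hx u, map_add, map_smul, map_smul, h₁, h₂]
  simp only [← Complex.coe_smul]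
  module

theorem re_normForm_covDeriv_frameLift (hx : x ∈ U) (u v : E) :
    (normForm (Z x) (covDeriv Z (frameLift Z n₁) x u) (covDeriv Z Z x v)).re = 0 := by
  have hb := h.isNullBasis_one hx
  have hv : covDeriv Z Z x v = (0 : ℂ) • Z x + (frameCoform Z n₂ x v : ℂ) • frameLift Z n₁ x +
      (frameCoform Z n₁ x v : ℂ) • frameLift Z n₂ x := by
    conv_lhs => rw [h.frameCoform_eq hx v, map_add, map_smul, map_smul]
    rw [zero_smul, zero_add, Complex.coe_smul, Complex.coe_smul, frameLift, frameLift]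
  rw [h.covDeriv_eq hx, normForm_sub_left, normForm_smul_left, normForm_smul_left,
    normForm_covDeriv_self (h.neg x hx), hv, hb.normForm_right_comb]
  simp

theorem fderiv_frameCoform_symm (hx : x ∈ U) (u v : E) :
    fderiv ℝ (frameCoform Z n₁) x u v = fderiv ℝ (frameCoform Z n₁) x v u := by
  rw [h.fderiv_frameCoform_apply h.contDiffOn₁ hx, h.fderiv_frameCoform_apply h.contDiffOn₁ hx,
    h.re_normForm_covDeriv_frameLift hx, h.re_normForm_covDeriv_frameLift hx, frameLift,
    h.normForm_covHess_symm hx]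

theorem fderiv_connForm_symm (hx : x ∈ U) (u v : E) :
    fderiv ℝ (connForm Z) x u v = fderiv ℝ (connForm Z) x v u := by
  have hcurv : connCurv Z x (n₁ x) (n₂ x) = 0 := by
    simp [(h.bracket_eq_and_connCurv_eq hx).2]
  rw [h.frameCoform_eq hx u, h.frameCoform_eq hx v]
  simp only [map_add, map_smul, add_apply, smul_apply, sub_eq_zero.1 hcurv]
  module

end Frame

end FlatFrame

theorem exists_potential {F : Type*} [NormedAddCommGroup F] [NormedSpace ℝ F] [CompleteSpace F]
    {K : Set E} {θ : E → E →L[ℝ] F} (hK : IsOpen K) (hc : Convex ℝ K)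
    (hθ : ContDiffOn ℝ ∞ θ K)
    (hsymm : ∀ x ∈ K, ∀ u v, fderiv ℝ θ x u v = fderiv ℝ θ x v u) :
    ∃ f : E → F, ContDiffOn ℝ ∞ f K ∧ ∀ x ∈ K, HasFDerivAt f (θ x) x := by
  obtain ⟨f, hf⟩ := hc.exists_forall_hasFDerivAt_of_fderiv_symmetric hK
    (hθ.differentiableOn (by simp)) hsymm
  exact ⟨f, (contDiffOn_infty_iff_fderiv_of_isOpen hK).2
    ⟨fun x hx => (hf x hx).differentiableAt.differentiableWithinAt,
      hθ.congr fun x hx => (hf x hx).fderiv⟩, hf⟩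

theorem exists_parallel_factor {K : Set E} (hK : IsOpen K) (hc : Convex ℝ K)
    (hconn : ContDiffOn ℝ ∞ (connForm Z) K)
    (hsymm : ∀ x ∈ K, ∀ u v, fderiv ℝ (connForm Z) x u v = fderiv ℝ (connForm Z) x v u) (x₀ : E)
    {κ : ℂ} (hκ : κ ≠ 0) :
    ∃ ρ : E → ℂ, ρ x₀ = κ ∧ (∀ x, ρ x ≠ 0) ∧
      ∀ x ∈ K, HasFDerivAt ρ (ρ x • connForm Z x) x := by
  obtain ⟨φ, -, hφ⟩ := exists_potential hK hc hconn hsymm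
  refine ⟨fun x => κ * Complex.exp (φ x - φ x₀), by simp,
    fun x => mul_ne_zero hκ (Complex.exp_ne_zero _), fun x hx => ?_⟩
  exact (((hφ x hx).sub_const (φ x₀)).cexp.const_mul κ).congr_fderiv (smul_smul _ _ _)

theorem hasFDerivAt_parallel_smul {ρ : E → ℂ} {ξ : E → Fin 3 → ℂ}
    (hρ : HasFDerivAt ρ (ρ x • connForm Z x) x) (hξ : DifferentiableAt ℝ ξ x) :
    HasFDerivAt (fun y => ρ y • ξ y) (ρ x • covDeriv Z ξ x) x := by
  refine (hρ.smul hξ.hasFDerivAt).congr_fderiv (ContinuousLinearMap.ext fun u => ?_)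
  simp [covDeriv_apply, smul_smul]

namespace FlatFrame

theorem frameSystem (h : FlatFrame Z U n₁ n₂) {K : Set E} (hKU : K ⊆ U) {ρ : E → ℂ}
    (hρ : ∀ y ∈ K, HasFDerivAt ρ (ρ y • connForm Z y) y) :
    FrameSystem K (frameCoform Z n₂) (frameCoform Z n₁) (fun y => ρ y • Z y)
      (fun y => ρ y • frameLift Z n₁ y) (fun y => ρ y • frameLift Z n₂ y) where
  hasFDerivAt y hy := by
    refine (hasFDerivAt_parallel_smul (hρ y hy) (h.differentiableAt (hKU hy))).congr_fderiv
      (ContinuousLinearMap.ext fun u => ?_)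
    rw [smul_apply]
    conv_lhs => rw [h.frameCoform_eq (hKU hy) u, map_add, map_smul, map_smul]
    simp only [frameLift, add_apply, ContinuousLinearMap.smulRight_apply, ← Complex.coe_smul]
    module
  hasFDerivAt₁ y hy := by
    refine (hasFDerivAt_parallel_smul (hρ y hy) (h.differentiableAt_of_contDiffOn
      (h.contDiffOn_frameLift h.contDiffOn₁) (hKU hy))).congr_fderiv
      (ContinuousLinearMap.ext fun u => ?_)
    rw [smul_apply, h.covDeriv_eq (hKU hy)]
    simp only [sub_apply, ContinuousLinearMap.smulRight_apply, ← Complex.coe_smul]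
    module
  hasFDerivAt₂ y hy := by
    refine (hasFDerivAt_parallel_smul (hρ y hy) (h.differentiableAt_of_contDiffOn
      (h.contDiffOn_frameLift h.contDiffOn₂) (hKU hy))).congr_fderiv
      (ContinuousLinearMap.ext fun u => ?_)
    rw [smul_apply, h.swap.covDeriv_eq (hKU hy)]
    simp only [sub_apply, ContinuousLinearMap.smulRight_apply, ← Complex.coe_smul]
    module

theorem exists_unitary (h : FlatFrame Z U n₁ n₂) (hx : x ∈ U) :
    ∃ r > 0, Metric.ball x r ⊆ U ∧
      ∃ (X Y : E → ℝ) (ρ : E → ℂ) (A : HermUnitary),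
        ContDiffOn ℝ ∞ X (Metric.ball x r) ∧ ContDiffOn ℝ ∞ Y (Metric.ball x r) ∧
        (∀ y ∈ Metric.ball x r, ∀ u, u = fderiv ℝ X y u • n₁ y + fderiv ℝ Y y u • n₂ y) ∧
        ∀ y ∈ Metric.ball x r, ρ y ≠ 0 ∧ A.1 (ρ y • Z y) = tildeLVec 1 (X y) (Y y) := by
  obtain ⟨r, hr, hrU⟩ := Metric.isOpen_iff.1 h.isOpen x hx
  have hK := Metric.isOpen_ball (x := x) (ε := r)
  have hc := convex_ball x r
  have hxK := Metric.mem_ball_self hr (x := x)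
  obtain ⟨X, hXs, hX⟩ := exists_potential hK hc
    ((h.contDiffOn_frameCoform h.contDiffOn₂).mono hrU)
    fun y hy => h.swap.fderiv_frameCoform_symm (hrU hy)
  obtain ⟨Y, hYs, hY⟩ := exists_potential hK hc
    ((h.contDiffOn_frameCoform h.contDiffOn₁).mono hrU)
    fun y hy => h.fderiv_frameCoform_symm (hrU hy)
  have hκ := normalizeVec_factor_ne (h.neg x hx)
  obtain ⟨ρ, hρx, hρ0, hρ⟩ := exists_parallel_factor hK hc (h.contDiffOn_connForm.mono hrU)
    (fun y hy => h.fderiv_connForm_symm (hrU hy)) x hκ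
  obtain ⟨A, hA⟩ := (h.frameSystem hrU hρ).exists_unitary hK hc.isPreconnected hX hY hxK
    (by simpa only [hρx] using! normalizeVec_mem (h.neg x hx))
    ((h.isNullBasis_one hx).smul (hρ0 x))
  refine ⟨r, hr, hrU, X, Y, ρ, A, hXs, hYs, fun y hy u => ?_, fun y hy => ⟨hρ0 y, hA y hy⟩⟩
  rw [(hX y hy).fderiv, (hY y hy).fderiv]
  exact h.frameCoform_eq (hrU hy) u

end FlatFrame

theorem MinimalSlantFrame.exists_flatFrame (h : MinimalSlantFrame Z U n₁ n₂ 0)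
    (hflat : ∀ x ∈ U, ∀ u v w, curvature (liftMetric Z) x u v w = 0) :
    ∃ m₁ m₂ : E → E, FlatFrame Z U m₁ m₂ := by
  obtain ⟨m₁, m₂, hm, h₁, h₂⟩ := h.exists_frameCubic_eq_I hflat
  exact ⟨m₁, m₂, hm, h₁, h₂⟩

end FlatFrame

/-! ### Affine charts -/

section affine

variable {i : Fin 3}

theorem affineTan_add (i : Fin 3) (u v : Fin 2 → ℂ) :
    affineTan i (u + v) = affineTan i u + affineTan i v := by
  funext k
  refine Fin.succAboveCases i ?_ (fun j => ?_) k <;> simp [affineTan]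

theorem affineTan_smul (i : Fin 3) (c : ℂ) (u : Fin 2 → ℂ) :
    affineTan i (c • u) = c • affineTan i u := by
  funext k
  refine Fin.succAboveCases i ?_ (fun j => ?_) k <;> simp [affineTan]

/-- `affineTan i` as a continuous real linear map. -/
def affineTanCLM (i : Fin 3) : (Fin 2 → ℂ) →L[ℝ] (Fin 3 → ℂ) :=
  (LinearMap.toContinuousLinearMap
    { toFun := affineTan i
      map_add' := affineTan_add i
      map_smul' := affineTan_smul i : (Fin 2 → ℂ) →ₗ[ℂ] (Fin 3 → ℂ) }).restrictScalars ℝ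

@[simp] theorem affineTanCLM_apply (u : Fin 2 → ℂ) : affineTanCLM i u = affineTan i u := rfl

theorem affineVec_eq_single_add (i : Fin 3) (w : Fin 2 → ℂ) :
    affineVec i w = Pi.single i 1 + affineTan i w := by
  funext k
  refine Fin.succAboveCases i ?_ (fun j => ?_) k <;> simp [affineTan, affineVec]

theorem eq_zero_of_affineTan_add_smul_affineVec {u w : Fin 2 → ℂ} {c : ℂ}
    (h : affineTan i u + c • affineVec i w = 0) : u = 0 := by
  have hc : c = 0 := by simpa [affineTan, affineVec] using congrFun h i
  funext j
  simpa [affineTan, hc] using congrFun h (i.succAbove j)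

theorem exists_eq_smul_affineVec_add_affineTan (i : Fin 3) (w : Fin 2 → ℂ) (z : Fin 3 → ℂ) :
    ∃ u, z = z i • affineVec i w + affineTan i u := by
  refine ⟨fun j => z (i.succAbove j) - z i * w j, ?_⟩
  funext k
  refine Fin.succAboveCases i ?_ (fun j => ?_) k <;> simp [affineTan, affineVec]

theorem eq_zero_of_forall_hermForm_eq_zero {z : Fin 3 → ℂ} (h : ∀ w, hermForm z w = 0) :
    z = 0 := by
  have hconj (k : Fin 3) : conj (z k) = 0 := by
    have hk := h (Pi.single k 1)
    fin_cases k <;> simpa [hermForm] using hk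
  funext k
  simpa using hconj k

theorem fderiv_affineVec (w u : Fin 2 → ℂ) : fderiv ℝ (affineVec i) w u = affineTan i u := by
  have h : affineVec i = fun y => Pi.single i 1 + affineTanCLM i y :=
    funext (affineVec_eq_single_add i)
  rw [h, fderiv_const_add, ContinuousLinearMap.fderiv, affineTanCLM_apply]

theorem covDeriv_affineVec (w u : Fin 2 → ℂ) : covDeriv (affineVec i) (affineVec i) w u =
    affineTan i u + connForm (affineVec i) w u • affineVec i w := by
  rw [covDeriv_apply, fderiv_affineVec]

theorem connForm_affineVec_smul (w u : Fin 2 → ℂ) (c : ℂ) :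
    connForm (affineVec i) w (c • u) = c * connForm (affineVec i) w u := by
  simp only [connForm_apply, fderiv_affineVec, affineTan_smul, hermForm_smul_right]
  ring

theorem covDeriv_affineVec_smul (w u : Fin 2 → ℂ) (c : ℂ) :
    covDeriv (affineVec i) (affineVec i) w (c • u) =
      c • covDeriv (affineVec i) (affineVec i) w u := by
  rw [covDeriv_affineVec, covDeriv_affineVec, connForm_affineVec_smul, affineTan_smul]
  module

theorem liftMetric_affineVec (w : Fin 2 → ℂ) : liftMetric (affineVec i) w = chMetric i w := by
  funext u v
  rw [liftMetric, covDeriv_self_eq_horizontal, covDeriv_self_eq_horizontal, fderiv_affineVec,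
    fderiv_affineVec, chMetric, normForm, Complex.re_ofReal_mul, div_eq_inv_mul]

theorem chMetric_nondegenerate {w : Fin 2 → ℂ}
    (hw : (hermForm (affineVec i w) (affineVec i w)).re < 0) {u : Fin 2 → ℂ}
    (hu : ∀ v, chMetric i w u v = 0) : u = 0 := by
  have horth : ∀ v, normForm (affineVec i w) (covDeriv (affineVec i) (affineVec i) w u)
      (covDeriv (affineVec i) (affineVec i) w v) = 0 := by
    intro v
    have him := hu (Complex.I • v)
    rw [← liftMetric_affineVec, liftMetric, covDeriv_affineVec_smul, normForm_smul_right] at him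
    rw [← liftMetric_affineVec] at hu
    exact Complex.ext (hu v) (by simpa using him)
  have hself : normForm (affineVec i w) (covDeriv (affineVec i) (affineVec i) w u)
      (affineVec i w) = 0 := by
    rw [← conj_normForm, normForm_covDeriv_self hw, map_zero]
  have hzero : covDeriv (affineVec i) (affineVec i) w u = 0 := by
    refine eq_zero_of_forall_hermForm_eq_zero fun z => ?_
    rw [← normForm_eq_zero_iff _ _ hw]
    obtain ⟨v, hv⟩ := exists_eq_smul_affineVec_add_affineTan i w z
    have htan := horth v
    rw [covDeriv_affineVec _ v, normForm_add_right, normForm_smul_right, hself, mul_zero,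
      add_zero] at htan
    rw [hv, normForm_add_right, normForm_smul_right, hself, htan, mul_zero, add_zero]
  exact eq_zero_of_affineTan_add_smul_affineVec (covDeriv_affineVec w u ▸ hzero)

variable {E : Type*} [NormedAddCommGroup E] [NormedSpace ℝ E]

/-- The lift to `ℂ³` of a map `f` into the `i`-th affine chart of `CH²₁(-4)`. -/
def affineLift (i : Fin 3) (f : E → Fin 2 → ℂ) (x : E) : Fin 3 → ℂ := affineVec i (f x)

variable {f : E → Fin 2 → ℂ} {U : Set E} {x : E}

section DifferentiableAt
variable (hf : DifferentiableAt ℝ f x)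
include hf

theorem fderiv_affineTan_comp (u : E) :
    fderiv ℝ (fun y => affineTan i (f y)) x u = affineTan i (fderiv ℝ f x u) := by
  have h : fderiv ℝ (fun y => affineTan i (f y)) x = _ :=
    ((affineTanCLM i).hasFDerivAt.comp x hf.hasFDerivAt).fderiv
  rw [h]
  rfl

theorem fderiv_affineLift (u : E) :
    fderiv ℝ (affineLift i f) x u = affineTan i (fderiv ℝ f x u) := by
  have h : affineLift i f = fun y => Pi.single i 1 + affineTan i (f y) :=
    funext fun y => affineVec_eq_single_add i (f y)
  rw [h, fderiv_const_add, fderiv_affineTan_comp hf]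

theorem connForm_affineLift (u : E) :
    connForm (affineLift i f) x u = connForm (affineVec i) (f x) (fderiv ℝ f x u) := by
  rw [connForm_apply, connForm_apply, fderiv_affineVec, fderiv_affineLift hf, affineLift]

theorem covDeriv_affineLift (u : E) : covDeriv (affineLift i f) (affineLift i f) x u =
    covDeriv (affineVec i) (affineVec i) (f x) (fderiv ℝ f x u) := by
  rw [covDeriv_apply, covDeriv_affineVec, fderiv_affineLift hf, connForm_affineLift hf, affineLift]

theorem inducedMetric_eq_liftMetric :
    inducedMetric (chMetric i) f x = liftMetric (affineLift i f) x := by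
  funext u v
  rw [inducedMetric, ← liftMetric_affineVec, liftMetric, liftMetric, covDeriv_affineLift hf,
    covDeriv_affineLift hf, affineLift]

theorem chMetric_I_smul (u v : E) :
    chMetric i (f x) (Complex.I • fderiv ℝ f x u) (fderiv ℝ f x v) =
      (normForm (affineLift i f x) (covDeriv (affineLift i f) (affineLift i f) x u)
        (covDeriv (affineLift i f) (affineLift i f) x v)).im := by
  rw [← liftMetric_affineVec, liftMetric, covDeriv_affineVec_smul, normForm_smul_left,
    covDeriv_affineLift hf, covDeriv_affineLift hf]
  simp [affineLift]

end DifferentiableAt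

theorem smoothLift_affineLift (hU : IsOpen U) (hf : ContDiffOn ℝ ∞ f U)
    (hneg : ∀ y ∈ U, (hermForm (affineVec i (f y)) (affineVec i (f y))).re < 0) :
    SmoothLift (affineLift i f) U :=
  ⟨hU, (contDiff_affineVec i).comp_contDiffOn hf, hneg⟩

namespace SmoothLift

theorem contDiffOn_of_affineLift (h : SmoothLift (affineLift i f) U) : ContDiffOn ℝ ∞ f U := by
  refine contDiffOn_pi.2 fun j =>
    (contDiffOn_pi.1 h.contDiffOn (i.succAbove j)).congr fun y _ => ?_
  simp [affineLift, affineVec]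

theorem differentiableAt_of_affineLift (h : SmoothLift (affineLift i f) U) (hx : x ∈ U) :
    DifferentiableAt ℝ f x :=
  h.differentiableAt_of_contDiffOn h.contDiffOn_of_affineLift hx

theorem exists_covHess_affineLift (h : SmoothLift (affineLift i f) U) (hx : x ∈ U) (u v : E) :
    ∃ l : ℂ, covHess (affineLift i f) x u v = l • affineLift i f x +
      covDeriv (affineVec i) (affineVec i) (f x) (fderiv ℝ (fun y => fderiv ℝ f y v) x u +
        (connForm (affineVec i) (f x) (fderiv ℝ f x u) • fderiv ℝ f x v +
          connForm (affineVec i) (f x) (fderiv ℝ f x v) • fderiv ℝ f x u)) := by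
  have hf := h.differentiableAt_of_affineLift hx
  have hdf : DifferentiableAt ℝ (fun y => fderiv ℝ f y v) x :=
    (h.differentiableAt_of_contDiffOn
      (contDiffOn_fderiv h.isOpen h.contDiffOn_of_affineLift) hx).clm_apply
      (differentiableAt_const _)
  have htan : DifferentiableAt ℝ (fun y => affineTan i (fderiv ℝ f y v)) x :=
    (affineTanCLM i).differentiableAt.comp x hdf
  have hconn : DifferentiableAt ℝ (fun y => connForm (affineLift i f) y v) x :=
    (h.differentiableAt_of_contDiffOn h.contDiffOn_connForm hx).clm_apply
      (differentiableAt_const _)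
  have hcov : (fun y => covDeriv (affineLift i f) (affineLift i f) y v) =ᶠ[nhds x]
      fun y => affineTan i (fderiv ℝ f y v) + connForm (affineLift i f) y v • affineLift i f y :=
    Filter.eventually_of_mem (h.isOpen.mem_nhds hx) fun y hy => by
      simp only [covDeriv_apply, fderiv_affineLift (h.differentiableAt_of_affineLift hy)]
  rw [covHess, covDeriv_congr hcov, covDeriv_add htan (hconn.fun_smul (h.differentiableAt hx)),
    covDeriv_smul hconn (h.differentiableAt hx), covDeriv_apply _ (fun y => affineTan i _),
    fderiv_affineTan_comp hdf, covDeriv_affineLift hf, covDeriv_affineVec, covDeriv_affineVec,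
    connForm_affineLift hf, connForm_affineLift hf, affineTan_add, affineTan_add, affineTan_smul,
    affineTan_smul, affineLift]
  generalize connForm (affineVec i) (f x) (_ + _) = c
  exact ⟨fderiv ℝ (fun y => connForm (affineLift i f) y v) x u + connForm (affineVec i) (f x)
    (fderiv ℝ f x v) * connForm (affineVec i) (f x) (fderiv ℝ f x u) - c, by module⟩

end SmoothLift

theorem christoffel_chMetric {w : Fin 2 → ℂ}
    (hw : (hermForm (affineVec i w) (affineVec i w)).re < 0) (u v : Fin 2 → ℂ) :
    christoffel (chMetric i) w u v =
      connForm (affineVec i) w u • v + connForm (affineVec i) w v • u := by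
  have h : SmoothLift (affineLift i fun y => y) _ :=
    smoothLift_affineLift (CH21.chart i).open_target contDiffOn_id fun _ hy => hy
  obtain ⟨l, hl⟩ := h.exists_covHess_affineLift hw u v
  simp only [fderiv_fun_id, ContinuousLinearMap.id_apply, fderiv_fun_const, Pi.zero_apply,
    zero_apply, zero_add] at hl
  rw [← christoffel_congr (.of_forall liftMetric_affineVec)]
  refine h.christoffel_eq hw (fun u hu => chMetric_nondegenerate hw fun t => ?_) fun t => ?_
  · rw [← liftMetric_affineVec]
    exact hu t
  · rw [hl, normForm_add_left, normForm_smul_left, normForm_covDeriv_self (h.neg w hw), mul_zero,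
      zero_add]
    rfl

end affine

section NullPair

variable {E : Type*} [NormedAddCommGroup E] [NormedSpace ℝ E] {Z : E → Fin 3 → ℂ} {U : Set E}
  {x e₁ e₂ : E}

theorem eq_liftMetric_smul_add_of_null (hE : Module.finrank ℝ E = 2)
    (h₁ : liftMetric Z x e₁ e₁ = 0) (h₂ : liftMetric Z x e₂ e₂ = 0)
    (h₁₂ : liftMetric Z x e₁ e₂ = -1) (u : E) :
    u = (-liftMetric Z x e₂ u) • e₁ + (-liftMetric Z x e₁ u) • e₂ := by
  have h₂₁ : liftMetric Z x e₂ e₁ = -1 := by rw [liftMetric_comm, h₁₂]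
  have hcoeff₂ (a b : ℝ) : liftMetric Z x e₁ (a • e₁ + b • e₂) = -b := by
    rw [liftMetric_add_right, liftMetric_smul_right, liftMetric_smul_right, h₁, h₁₂]; ring
  have hcoeff₁ (a b : ℝ) : liftMetric Z x e₂ (a • e₁ + b • e₂) = -a := by
    rw [liftMetric_add_right, liftMetric_smul_right, liftMetric_smul_right, h₂, h₂₁]; ring
  have hli : LinearIndependent ℝ ![e₁, e₂] := by
    rw [LinearIndependent.pair_iff]
    intro a b hab
    have ha := hcoeff₁ a b
    have hb := hcoeff₂ a b
    rw [hab, liftMetric_comm, liftMetric_zero_left] at ha hb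
    exact ⟨by linarith, by linarith⟩
  have hu : u ∈ Submodule.span ℝ (Set.range ![e₁, e₂]) :=
    hli.span_eq_top_of_card_eq_finrank (by simp [hE]) ▸ Submodule.mem_top
  rw [Matrix.range_cons_cons_empty, Submodule.mem_span_pair] at hu
  obtain ⟨a, b, rfl⟩ := hu
  rw [hcoeff₁, hcoeff₂, neg_neg, neg_neg]

theorem normForm_im_covDeriv_comb (a b c d : ℝ) :
    (normForm (Z x) (covDeriv Z Z x (a • e₁ + b • e₂)) (covDeriv Z Z x (c • e₁ + d • e₂))).im =
      (a * d - b * c) * (normForm (Z x) (covDeriv Z Z x e₁) (covDeriv Z Z x e₂)).im := by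
  have hcomm := normForm_im_comm (Z x) (covDeriv Z Z x e₂) (covDeriv Z Z x e₁)
  simp only [map_add, map_smul, ← Complex.coe_smul, normForm_add_left, normForm_add_right,
    normForm_smul_left, normForm_smul_right, Complex.conj_ofReal, Complex.add_im,
    Complex.im_ofReal_mul, normForm_self_im, hcomm]
  ring

theorem normForm_im_sq_eq_of_null (hE : Module.finrank ℝ E = 2) {m₁ m₂ : E}
    (h₁ : liftMetric Z x e₁ e₁ = 0) (h₂ : liftMetric Z x e₂ e₂ = 0)
    (h₁₂ : liftMetric Z x e₁ e₂ = -1) (k₁ : liftMetric Z x m₁ m₁ = 0)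
    (k₂ : liftMetric Z x m₂ m₂ = 0) (k₁₂ : liftMetric Z x m₁ m₂ = -1) :
    (normForm (Z x) (covDeriv Z Z x m₁) (covDeriv Z Z x m₂)).im ^ 2 =
      (normForm (Z x) (covDeriv Z Z x e₁) (covDeriv Z Z x e₂)).im ^ 2 := by
  have hm₁ := eq_liftMetric_smul_add_of_null hE h₁ h₂ h₁₂ m₁
  have hm₂ := eq_liftMetric_smul_add_of_null hE h₁ h₂ h₁₂ m₂
  generalize -liftMetric Z x e₂ m₁ = a at hm₁
  generalize -liftMetric Z x e₁ m₁ = b at hm₁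
  generalize -liftMetric Z x e₂ m₂ = c at hm₂
  generalize -liftMetric Z x e₁ m₂ = d at hm₂
  subst hm₁ hm₂
  have h₂₁ : liftMetric Z x e₂ e₁ = -1 := by rw [liftMetric_comm, h₁₂]
  simp only [liftMetric_add_left, liftMetric_add_right, liftMetric_smul_left,
    liftMetric_smul_right, h₁, h₂, h₁₂, h₂₁] at k₁ k₂ k₁₂
  have hab : a * b = 0 := by linarith
  have hsum : a * d + b * c = 1 := by linarith
  have hdet : (a * d - b * c) ^ 2 = 1 := by
    linear_combination (a * d + b * c + 1) * hsum - 4 * c * d * hab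
  rw [normForm_im_covDeriv_comb, mul_pow, hdet, one_mul]

/-- Minus the Gram determinant of `e₁` and `e₂` in the metric with lift `Z`. -/
def negGram (Z : E → Fin 3 → ℂ) (e₁ e₂ x : E) : ℝ :=
  liftMetric Z x e₁ e₂ * liftMetric Z x e₁ e₂ - liftMetric Z x e₁ e₁ * liftMetric Z x e₂ e₂

/-- The null direction in the span of `e₁` and `e₂` that is `e₁` itself where `e₁` is null; it is
obtained by solving a quadratic equation. -/
def nullDirection (Z : E → Fin 3 → ℂ) (e₁ e₂ x : E) : E :=
  e₁ + (liftMetric Z x e₁ e₁ * (√(negGram Z e₁ e₂ x) - liftMetric Z x e₁ e₂)⁻¹) • e₂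

theorem negGram_comm : negGram Z e₂ e₁ x = negGram Z e₁ e₂ x := by
  rw [negGram, negGram, liftMetric_comm Z x e₂ e₁, mul_comm (liftMetric Z x e₂ e₂)]

section Gram
variable (hlt : liftMetric Z x e₁ e₂ < 0) (hpos : 0 < negGram Z e₁ e₂ x)
include hlt

theorem sqrt_negGram_sub_pos : 0 < √(negGram Z e₁ e₂ x) - liftMetric Z x e₁ e₂ :=
  sub_pos.2 (hlt.trans_le (Real.sqrt_nonneg _))

include hpos

theorem liftMetric_nullDirection_self :
    liftMetric Z x (nullDirection Z e₁ e₂ x) (nullDirection Z e₁ e₂ x) = 0 := by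
  have hne := (sqrt_negGram_sub_pos hlt).ne'
  have hsq := Real.mul_self_sqrt hpos.le
  simp only [nullDirection, liftMetric_add_left, liftMetric_add_right, liftMetric_smul_left,
    liftMetric_smul_right, liftMetric_comm Z x e₂ e₁]
  generalize √(negGram Z e₁ e₂ x) = r at *
  rw [negGram] at hsq
  field_simp
  linear_combination liftMetric Z x e₁ e₁ * hsq

theorem liftMetric_nullDirection_swap :
    liftMetric Z x (nullDirection Z e₁ e₂ x) (nullDirection Z e₂ e₁ x) =
      -(2 * negGram Z e₁ e₂ x) / (√(negGram Z e₁ e₂ x) - liftMetric Z x e₁ e₂) := by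
  have hne := (sqrt_negGram_sub_pos hlt).ne'
  have hsq := Real.mul_self_sqrt hpos.le
  simp only [nullDirection, negGram_comm (e₁ := e₁), liftMetric_add_left, liftMetric_add_right,
    liftMetric_smul_left, liftMetric_smul_right, liftMetric_comm Z x e₂ e₁]
  generalize √(negGram Z e₁ e₂ x) = r at *
  rw [negGram] at hsq ⊢
  field_simp
  linear_combination liftMetric Z x e₁ e₂ * hsq

end Gram

namespace SmoothLift

variable (h : SmoothLift Z U)
include h

theorem contDiffOn_negGram (e₁ e₂ : E) : ContDiffOn ℝ ∞ (negGram Z e₁ e₂) U :=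
  ((h.contDiffOn_liftMetric _ _).mul (h.contDiffOn_liftMetric _ _)).sub
    ((h.contDiffOn_liftMetric _ _).mul (h.contDiffOn_liftMetric _ _))

theorem contDiffOn_nullDirection (hlt : ∀ y ∈ U, liftMetric Z y e₁ e₂ < 0)
    (hpos : ∀ y ∈ U, 0 < negGram Z e₁ e₂ y) : ContDiffOn ℝ ∞ (nullDirection Z e₁ e₂) U := by
  have hsqrt := (h.contDiffOn_negGram e₁ e₂).sqrt fun y hy => (hpos y hy).ne'
  have hinv := (hsqrt.sub (h.contDiffOn_liftMetric e₁ e₂)).inv fun y hy =>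
    (sqrt_negGram_sub_pos (hlt y hy)).ne'
  exact contDiffOn_const.add (((h.contDiffOn_liftMetric _ _).mul hinv).smul contDiffOn_const)

theorem mono {V : Set E} (hV : IsOpen V) (hVU : V ⊆ U) : SmoothLift Z V :=
  ⟨hV, h.contDiffOn.mono hVU, fun y hy => h.neg y (hVU hy)⟩

theorem exists_null_fields_of_negGram_pos (hlt : ∀ y ∈ U, liftMetric Z y e₁ e₂ < 0)
    (hpos : ∀ y ∈ U, 0 < negGram Z e₁ e₂ y) :
    ∃ n₁ n₂ : E → E, ContDiffOn ℝ ∞ n₁ U ∧ ContDiffOn ℝ ∞ n₂ U ∧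
      ∀ y ∈ U, liftMetric Z y (n₁ y) (n₁ y) = 0 ∧ liftMetric Z y (n₂ y) (n₂ y) = 0 ∧
        liftMetric Z y (n₁ y) (n₂ y) = -1 := by
  have hlt' : ∀ y ∈ U, liftMetric Z y e₂ e₁ < 0 := fun y hy =>
    (liftMetric_comm Z y e₂ e₁).trans_lt (hlt y hy)
  have hpos' : ∀ y ∈ U, 0 < negGram Z e₂ e₁ y := fun y hy => (hpos y hy).trans_eq negGram_comm.symm
  have hsmooth := h.contDiffOn_nullDirection hlt hpos
  have hsmooth' := h.contDiffOn_nullDirection hlt' hpos'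
  set g := fun y => liftMetric Z y (nullDirection Z e₁ e₂ y) (nullDirection Z e₂ e₁ y) with hg
  have hgne : ∀ y ∈ U, g y ≠ 0 := fun y hy => by
    simp only [hg, liftMetric_nullDirection_swap (hlt y hy) (hpos y hy)]
    exact div_ne_zero (neg_ne_zero.2 (mul_ne_zero two_ne_zero (hpos y hy).ne'))
      (sqrt_negGram_sub_pos (hlt y hy)).ne'
  have hgsmooth : ContDiffOn ℝ ∞ g U :=
    Complex.reCLM.contDiff.comp_contDiffOn (h.contDiffOn_normForm
      (h.contDiffOn_frameLift hsmooth) (h.contDiffOn_frameLift hsmooth'))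
  refine ⟨nullDirection Z e₁ e₂, fun y => (-(g y)⁻¹) • nullDirection Z e₂ e₁ y, hsmooth,
    (hgsmooth.inv hgne).neg.smul hsmooth',
    fun y hy => ⟨liftMetric_nullDirection_self (hlt y hy) (hpos y hy), ?_, ?_⟩⟩
  · rw [liftMetric_smul_left, liftMetric_smul_right,
      liftMetric_nullDirection_self (hlt' y hy) (hpos' y hy), mul_zero, mul_zero]
  · rw [liftMetric_smul_right, neg_mul, inv_mul_cancel₀ (hgne y hy)]

theorem exists_null_fields (hx : x ∈ U) (h₁ : liftMetric Z x e₁ e₁ = 0)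
    (h₁₂ : liftMetric Z x e₁ e₂ = -1) :
    ∃ (V : Set E) (n₁ n₂ : E → E), IsOpen V ∧ V ⊆ U ∧ x ∈ V ∧ ContDiffOn ℝ ∞ n₁ V ∧
      ContDiffOn ℝ ∞ n₂ V ∧ ∀ y ∈ V, liftMetric Z y (n₁ y) (n₁ y) = 0 ∧
        liftMetric Z y (n₂ y) (n₂ y) = 0 ∧ liftMetric Z y (n₁ y) (n₂ y) = -1 := by
  have hmetric := (h.contDiffOn_liftMetric e₁ e₂).continuousOn
  have hgram := (h.contDiffOn_negGram e₁ e₂).continuousOn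
  have hV := (hmetric.prodMk hgram).isOpen_inter_preimage h.isOpen
    ((isOpen_Iio (a := (0 : ℝ))).prod (isOpen_Ioi (a := (0 : ℝ))))
  obtain ⟨n₁, n₂, hn⟩ := (h.mono hV Set.inter_subset_left).exists_null_fields_of_negGram_pos
    (fun y hy => hy.2.1) fun y hy => hy.2.2
  refine ⟨_, n₁, n₂, hV, Set.inter_subset_left, ⟨hx, ?_, ?_⟩, hn⟩
  · simp [h₁₂]
  · simp [negGram, h₁, h₁₂]

end SmoothLift

end NullPair

section Minimal

theorem eq_smul_coordVec_add (u : EuclideanSpace ℝ (Fin 2)) :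
    u = u 0 • coordVec 0 + u 1 • coordVec 1 := by
  ext k
  fin_cases k <;> simp

variable {i : Fin 3} {f : EuclideanSpace ℝ (Fin 2) → Fin 2 → ℂ}
  {Z : EuclideanSpace ℝ (Fin 2) → Fin 3 → ℂ} {U : Set (EuclideanSpace ℝ (Fin 2))}
  {x m₁ m₂ : EuclideanSpace ℝ (Fin 2)}

theorem inv_matrix_liftMetric (k₁ : liftMetric Z x m₁ m₁ = 0) (k₂ : liftMetric Z x m₂ m₂ = 0)
    (k₁₂ : liftMetric Z x m₁ m₂ = -1) :
    (Matrix.of fun m n => liftMetric Z x (coordVec m) (coordVec n))⁻¹ =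
      Matrix.of fun k l => -(m₁ k * m₂ l + m₂ k * m₁ l) := by
  refine Matrix.inv_eq_right_inv ?_
  ext m l
  have hcoord (n : EuclideanSpace ℝ (Fin 2)) : liftMetric Z x n (coordVec m) =
      n 0 * liftMetric Z x (coordVec m) (coordVec 0) +
        n 1 * liftMetric Z x (coordVec m) (coordVec 1) := by
    conv_lhs => rw [liftMetric_comm, eq_smul_coordVec_add n, liftMetric_add_right,
      liftMetric_smul_right, liftMetric_smul_right]
  have hexpand := congrArg (· l) (eq_liftMetric_smul_add_of_null (by simp) k₁ k₂ k₁₂ (coordVec m))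
  simp only [hcoord, PiLp.add_apply, PiLp.smul_apply, smul_eq_mul] at hexpand
  have hone : (1 : Matrix (Fin 2) (Fin 2) ℝ) m l = coordVec m l := by
    simp [Matrix.one_apply, eq_comm]
  rw [Matrix.mul_apply, Fin.sum_univ_two, hone, hexpand]
  simp only [Matrix.of_apply]
  ring

theorem sum_inv_matrix_liftMetric_smul {F : Type*} [AddCommGroup F] [Module ℝ F]
    (B : EuclideanSpace ℝ (Fin 2) →ₗ[ℝ] EuclideanSpace ℝ (Fin 2) →ₗ[ℝ] F)
    (hB : ∀ u v, B u v = B v u) (k₁ : liftMetric Z x m₁ m₁ = 0) (k₂ : liftMetric Z x m₂ m₂ = 0)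
    (k₁₂ : liftMetric Z x m₁ m₂ = -1) :
    ∑ k, ∑ l, (Matrix.of fun m n => liftMetric Z x (coordVec m) (coordVec n))⁻¹ k l •
      B (coordVec k) (coordVec l) = (-2 : ℝ) • B m₁ m₂ := by
  have hcoord : B m₁ m₂ = B (m₁ 0 • coordVec 0 + m₁ 1 • coordVec 1)
      (m₂ 0 • coordVec 0 + m₂ 1 • coordVec 1) := by
    rw [← eq_smul_coordVec_add, ← eq_smul_coordVec_add]
  rw [hcoord, inv_matrix_liftMetric k₁ k₂ k₁₂]
  simp only [map_add, map_smul, LinearMap.add_apply, LinearMap.smul_apply, Fin.sum_univ_two,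
    Matrix.of_apply, hB (coordVec 1) (coordVec 0)]
  module

namespace SmoothLift

variable (h : SmoothLift (affineLift i f) U) (hx : x ∈ U)
include h hx

/-- Modulo tangent vectors, the second fundamental form is the symmetric bilinear form `B` of
second covariant derivatives of `f` in the ambient space. -/
theorem exists_bilin_secondFundForm :
    ∃ B : EuclideanSpace ℝ (Fin 2) →ₗ[ℝ] EuclideanSpace ℝ (Fin 2) →ₗ[ℝ] (Fin 2 → ℂ),
      (∀ u v, B u v = B v u) ∧
      (∀ u v, secondFundForm (chMetric i) f x u v =
        B u v - fderiv ℝ f x (christoffel (inducedMetric (chMetric i) f) x u v)) ∧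
      ∀ u v, ∃ l : ℂ, covHess (affineLift i f) x u v =
        l • affineLift i f x + covDeriv (affineVec i) (affineVec i) (f x) (B u v) := by
  have hf := h.contDiffOn_of_affineLift
  have hsymm := ((hf.contDiffAt (h.isOpen.mem_nhds hx)).isSymmSndFDerivAt (by
    simpa using WithTop.coe_le_coe.2 (le_top : (2 : ℕ∞) ≤ ⊤))).eq
  have hdf := h.differentiableAt_of_contDiffOn (contDiffOn_fderiv h.isOpen hf) hx
  have hsnd (u v) : fderiv ℝ (fun y => fderiv ℝ f y v) x u = fderiv ℝ (fderiv ℝ f) x u v := by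
    rw [(hdf.hasFDerivAt.clm_apply (hasFDerivAt_const v x)).fderiv]
    simp
  set κ := connForm (affineVec i) (f x)
  let B : EuclideanSpace ℝ (Fin 2) →ₗ[ℝ] EuclideanSpace ℝ (Fin 2) →ₗ[ℝ] (Fin 2 → ℂ) :=
    LinearMap.mk₂ ℝ (fun u v => fderiv ℝ (fderiv ℝ f) x u v +
        (κ (fderiv ℝ f x u) • fderiv ℝ f x v + κ (fderiv ℝ f x v) • fderiv ℝ f x u))
      (fun u u' v => by simp only [map_add, add_apply]; module)
      (fun r u v => by
        simp only [map_smul, smul_apply, Complex.real_smul]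
        simp only [← Complex.coe_smul]
        module)
      (fun u v v' => by simp only [map_add]; module)
      (fun r u v => by
        simp only [map_smul, Complex.real_smul]
        simp only [← Complex.coe_smul]
        module)
  refine ⟨B, fun u v => ?_, fun u v => ?_, fun u v => ?_⟩
  · simp only [B, LinearMap.mk₂_apply, hsymm u v]
    module
  · rw [secondFundForm, hsnd, christoffel_chMetric (h.neg x hx), LinearMap.mk₂_apply]
  · have hhess := h.exists_covHess_affineLift hx u v
    rwa [hsnd] at hhess

/-- The trace of the second fundamental form is `-2` times its value on a null pair. -/
theorem exists_covHess_eq_of_meanCurvature_eq_zero (hmin : meanCurvature (chMetric i) f x = 0)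
    (k₁ : liftMetric (affineLift i f) x m₁ m₁ = 0) (k₂ : liftMetric (affineLift i f) x m₂ m₂ = 0)
    (k₁₂ : liftMetric (affineLift i f) x m₁ m₂ = -1) :
    ∃ (l : ℂ) (w : EuclideanSpace ℝ (Fin 2)), covHess (affineLift i f) x m₁ m₂ =
      l • affineLift i f x + covDeriv (affineLift i f) (affineLift i f) x w := by
  have hf := h.differentiableAt_of_affineLift hx
  obtain ⟨B, hsymm, hsecond, hhess⟩ := h.exists_bilin_secondFundForm hx
  obtain ⟨l, hl⟩ := hhess m₁ m₂
  set G := (Matrix.of fun m n => liftMetric (affineLift i f) x (coordVec m) (coordVec n))⁻¹ with hG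
  set Γ := christoffel (inducedMetric (chMetric i) f) x
  have htrace : ∑ k, ∑ l, G k l • secondFundForm (chMetric i) f x (coordVec k) (coordVec l) =
      (-2 : ℝ) • B m₁ m₂ - fderiv ℝ f x (∑ k, ∑ l, G k l • Γ (coordVec k) (coordVec l)) := by
    rw [← sum_inv_matrix_liftMetric_smul B hsymm k₁ k₂ k₁₂]
    simp only [hsecond, smul_sub, Finset.sum_sub_distrib, map_sum, map_smul, hG, Γ]
  rw [meanCurvature, inducedMetric_eq_liftMetric hf, ← hG, htrace, smul_eq_zero_iff_right
    (one_div_ne_zero two_ne_zero), sub_eq_zero] at hmin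
  refine ⟨l, (-2⁻¹ : ℝ) • ∑ k, ∑ l, G k l • Γ (coordVec k) (coordVec l), ?_⟩
  rw [hl, covDeriv_affineLift hf, map_smul, ← hmin, smul_smul]
  norm_num

end SmoothLift

end Minimal

section Slant

variable {i : Fin 3} {f : EuclideanSpace ℝ (Fin 2) → Fin 2 → ℂ} {U : Set (EuclideanSpace ℝ (Fin 2))}
  {x : EuclideanSpace ℝ (Fin 2)} {σ : ℝ}

/-- The map `f` into the `i`-th affine chart is slant at `x`, where `σ` is the hyperbolic sine of
the slant angle. -/
def IsSlantAt (f : EuclideanSpace ℝ (Fin 2) → Fin 2 → ℂ) (i : Fin 3)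
    (x : EuclideanSpace ℝ (Fin 2)) (σ : ℝ) : Prop :=
  ∃ e₁ e₂ : EuclideanSpace ℝ (Fin 2),
    inducedMetric (chMetric i) f x e₁ e₁ = 0 ∧
    inducedMetric (chMetric i) f x e₂ e₂ = 0 ∧
    inducedMetric (chMetric i) f x e₁ e₂ = -1 ∧
    IsNormalTo f i x (Complex.I • fderiv ℝ f x e₁ - fderiv ℝ f x (σ • e₁)) ∧
    IsNormalTo f i x (Complex.I • fderiv ℝ f x e₂ - fderiv ℝ f x (-σ • e₂))

namespace IsSlantAt

variable (hf : DifferentiableAt ℝ f x)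
include hf

theorem exists_null_pair (h : IsSlantAt f i x σ) :
    ∃ e₁ e₂ : EuclideanSpace ℝ (Fin 2),
      liftMetric (affineLift i f) x e₁ e₁ = 0 ∧ liftMetric (affineLift i f) x e₂ e₂ = 0 ∧
      liftMetric (affineLift i f) x e₁ e₂ = -1 ∧
      (normForm (affineLift i f x) (covDeriv (affineLift i f) (affineLift i f) x e₁)
        (covDeriv (affineLift i f) (affineLift i f) x e₂)).im = -σ := by
  obtain ⟨e₁, e₂, h₁, h₂, h₁₂, hnormal, -⟩ := h
  have hσ : liftMetric (affineLift i f) x (σ • e₁) e₂ =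
      chMetric i (f x) (Complex.I • fderiv ℝ f x e₁) (fderiv ℝ f x e₂) := by
    have hsub := hnormal e₂
    rw [← liftMetric_affineVec, liftMetric_sub_left, liftMetric_affineVec, sub_eq_zero] at hsub
    rw [hsub, ← inducedMetric_eq_liftMetric hf, inducedMetric]
  rw [inducedMetric_eq_liftMetric hf] at h₁ h₂ h₁₂
  rw [liftMetric_smul_left, h₁₂, mul_neg_one, chMetric_I_smul hf] at hσ
  exact ⟨e₁, e₂, h₁, h₂, h₁₂, hσ.symm⟩

theorem isNormalTo (h : IsSlantAt f i x 0) (u : EuclideanSpace ℝ (Fin 2)) :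
    IsNormalTo f i x (Complex.I • fderiv ℝ f x u) := by
  obtain ⟨e₁, e₂, h₁, h₂, h₁₂, hnormal₁, hnormal₂⟩ := h
  simp only [neg_zero, zero_smul, map_zero, sub_zero] at hnormal₁ hnormal₂
  rw [inducedMetric_eq_liftMetric hf] at h₁ h₂ h₁₂
  intro v
  have him₁ := hnormal₁ v
  have him₂ := hnormal₂ v
  rw [eq_liftMetric_smul_add_of_null (by simp) h₁ h₂ h₁₂ u]
  rw [chMetric_I_smul hf] at him₁ him₂ ⊢
  simp only [map_add, map_smul, ← Complex.coe_smul, normForm_add_left, normForm_smul_left,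
    Complex.conj_ofReal, Complex.add_im, Complex.im_ofReal_mul, him₁, him₂, mul_zero, add_zero]

end IsSlantAt

namespace SmoothLift

variable (h : SmoothLift (affineLift i f) U) (hx : x ∈ U) (hslant : ∀ y ∈ U, IsSlantAt f i y σ)
include h hx hslant

/-- At each point the imaginary part is `±σ`; its sign is constant on a ball, by continuity. -/
theorem exists_slant_null_fields :
    ∃ (V : Set (EuclideanSpace ℝ (Fin 2)))
      (n₁ n₂ : EuclideanSpace ℝ (Fin 2) → EuclideanSpace ℝ (Fin 2)) (s : ℝ),
      IsOpen V ∧ V ⊆ U ∧ x ∈ V ∧ s ^ 2 = σ ^ 2 ∧ ContDiffOn ℝ ∞ n₁ V ∧ ContDiffOn ℝ ∞ n₂ V ∧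
      ∀ y ∈ V, liftMetric (affineLift i f) y (n₁ y) (n₁ y) = 0 ∧
        liftMetric (affineLift i f) y (n₂ y) (n₂ y) = 0 ∧
        liftMetric (affineLift i f) y (n₁ y) (n₂ y) = -1 ∧
        (normForm (affineLift i f y) (frameLift (affineLift i f) n₁ y)
          (frameLift (affineLift i f) n₂ y)).im = -s := by
  have hf {y} (hy : y ∈ U) := h.differentiableAt_of_affineLift hy
  obtain ⟨e₁, e₂, h₁, -, h₁₂, -⟩ := (hslant x hx).exists_null_pair (hf hx)
  obtain ⟨V, n₁, n₂, hV, hVU, hxV, hn₁, hn₂, hn⟩ := h.exists_null_fields hx h₁ h₁₂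
  obtain ⟨r, hr, hrV⟩ := Metric.isOpen_iff.1 hV x hxV
  set s := fun y => -(normForm (affineLift i f y) (frameLift (affineLift i f) n₁ y)
    (frameLift (affineLift i f) n₂ y)).im with hs
  have hsq : ∀ y ∈ V, s y ^ 2 = σ ^ 2 := fun y hy => by
    obtain ⟨e₁, e₂, h₁, h₂, h₁₂, him⟩ := (hslant y (hVU hy)).exists_null_pair (hf (hVU hy))
    have hpair := normForm_im_sq_eq_of_null (by simp) h₁ h₂ h₁₂ (hn y hy).1 (hn y hy).2.1
      (hn y hy).2.2
    rwa [him, neg_sq, ← neg_sq] at hpair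
  have hV' := h.mono hV hVU
  have hscont : ContinuousOn s (Metric.ball x r) :=
    (Complex.continuous_im.comp_continuousOn ((hV'.contDiffOn_normForm
      (hV'.contDiffOn_frameLift hn₁) (hV'.contDiffOn_frameLift hn₂)).continuousOn.mono hrV)).neg
  have hsconst : ∀ y ∈ Metric.ball x r, s y = s x := fun y hy => by
    have hsqx {z} (hz : z ∈ Metric.ball x r) : s z ^ 2 = s x ^ 2 :=
      (hsq z (hrV hz)).trans (hsq x hxV).symm
    by_cases hsx : s x = 0
    · simpa [hsx] using hsqx hy
    · exact (convex_ball x r).isPreconnected.eq_of_sq_eq hscont (continuousOn_const (c := s x))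
        (fun z => hsqx) (fun _ => hsx) (Metric.mem_ball_self hr) rfl hy
  exact ⟨Metric.ball x r, n₁, n₂, s x, Metric.isOpen_ball, hrV.trans hVU, Metric.mem_ball_self hr,
    hsq x hxV, hn₁.mono hrV, hn₂.mono hrV, fun y hy => ⟨(hn y (hrV hy)).1, (hn y (hrV hy)).2.1,
      (hn y (hrV hy)).2.2, by rw [← hsconst y hy, hs, neg_neg]⟩⟩

variable (hmin : ∀ y ∈ U, meanCurvature (chMetric i) f y = 0)
include hmin

theorem exists_minimalSlantFrame :
    ∃ (V : Set (EuclideanSpace ℝ (Fin 2)))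
      (n₁ n₂ : EuclideanSpace ℝ (Fin 2) → EuclideanSpace ℝ (Fin 2)) (s : ℝ),
      V ⊆ U ∧ x ∈ V ∧ s ^ 2 = σ ^ 2 ∧ MinimalSlantFrame (affineLift i f) V n₁ n₂ s := by
  obtain ⟨V, n₁, n₂, s, hV, hVU, hxV, hs, hn₁, hn₂, hn⟩ := h.exists_slant_null_fields hx hslant
  have hV' := h.mono hV hVU
  have hspan : ∀ y ∈ V, ∀ u, ∃ a b : ℝ, u = a • n₁ y + b • n₂ y := fun y hy u =>
    ⟨_, _, eq_liftMetric_smul_add_of_null (by simp) (hn y hy).1 (hn y hy).2.1 (hn y hy).2.2.1 u⟩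
  refine ⟨V, n₁, n₂, s, hVU, hxV, hs, hV', hn₁, hn₂,
    fun y hy => Complex.ext (hn y hy).1 (normForm_self_im _ _),
    fun y hy => Complex.ext (hn y hy).2.1 (normForm_self_im _ _),
    fun y hy => Complex.ext ((hn y hy).2.2.1.trans (by simp))
      ((hn y hy).2.2.2.trans (by simp)), hspan, fun y hy => ?_⟩
  obtain ⟨l, w, hhess⟩ := hV'.exists_covHess_eq_of_meanCurvature_eq_zero hy (hmin y (hVU hy))
    (hn y hy).1 (hn y hy).2.1 (hn y hy).2.2.1
  obtain ⟨a, b, hab⟩ := hspan y hy (w + fderiv ℝ n₂ y (n₁ y))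
  have hproduct : covDeriv (affineLift i f) (frameLift (affineLift i f) n₂) y (n₁ y) =
      covHess (affineLift i f) y (n₁ y) (n₂ y) +
        covDeriv (affineLift i f) (affineLift i f) y (fderiv ℝ n₂ y (n₁ y)) :=
    covDeriv_clm_apply (hV'.differentiableAt_of_contDiffOn
      (hV'.contDiffOn_covDeriv hV'.contDiffOn) hy) (hV'.differentiableAt_of_contDiffOn hn₂ hy) _
  refine ⟨a, b, l, ?_⟩
  rw [hproduct, hhess, add_assoc, ← map_add, hab, map_add, map_smul, map_smul, add_assoc]
  simp only [← Complex.coe_smul, frameLift]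

theorem slant_eq_zero : σ = 0 := by
  obtain ⟨V, n₁, n₂, s, -, hxV, hs, hframe⟩ := h.exists_minimalSlantFrame hx hslant hmin
  rw [hframe.slant_eq_zero hxV, zero_pow two_ne_zero] at hs
  exact pow_eq_zero_iff two_ne_zero |>.1 hs.symm

theorem exists_coordinates_unitary
    (hflat : ∀ y ∈ U, ∀ u v w, curvature (inducedMetric (chMetric i) f) y u v w = 0) :
    ∃ r > 0, Metric.ball x r ⊆ U ∧
      ∃ (X Y : EuclideanSpace ℝ (Fin 2) → ℝ) (ρ : EuclideanSpace ℝ (Fin 2) → ℂ) (A : HermUnitary),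
        ContDiffOn ℝ ∞ X (Metric.ball x r) ∧ ContDiffOn ℝ ∞ Y (Metric.ball x r) ∧
        (∀ y ∈ Metric.ball x r, ∀ u, fderiv ℝ X y u = 0 → fderiv ℝ Y y u = 0 → u = 0) ∧
        ∀ y ∈ Metric.ball x r, ρ y ≠ 0 ∧
          A.1 (ρ y • affineLift i f y) = tildeLVec 1 (X y) (Y y) := by
  obtain ⟨V, n₁, n₂, s, hVU, hxV, -, hframe⟩ := h.exists_minimalSlantFrame hx hslant hmin
  obtain rfl := hframe.slant_eq_zero hxV
  have hflat' : ∀ y ∈ V, ∀ u v w, curvature (liftMetric (affineLift i f)) y u v w = 0 :=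
    fun y hy => by
      rw [← curvature_congr (Filter.eventually_of_mem (h.isOpen.mem_nhds (hVU hy)) fun z hz =>
        inducedMetric_eq_liftMetric (h.differentiableAt_of_affineLift hz))]
      exact hflat y (hVU hy)
  obtain ⟨m₁, m₂, hFlat⟩ := hframe.exists_flatFrame hflat'
  obtain ⟨r, hr, hrV, X, Y, ρ, A, hX, hY, hXY, hA⟩ := hFlat.exists_unitary hxV
  refine ⟨r, hr, hrV.trans hVU, X, Y, ρ, A, hX, hY, fun y hy u hXu hYu => ?_, hA⟩
  rw [hXY y hy u, hXu, hYu, zero_smul, zero_smul, add_zero]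

end SmoothLift

end Slant

/-! ### Charts and congruence -/

section Charts

section Groupoid

variable {E : Type*} [NormedAddCommGroup E] [NormedSpace ℝ E]

theorem mem_contDiffGroupoid_iff {φ : OpenPartialHomeomorph E E} :
    φ ∈ contDiffGroupoid ∞ 𝓘(ℝ, E) ↔
      ContDiffOn ℝ ∞ φ φ.source ∧ ContDiffOn ℝ ∞ φ.symm φ.target := by
  rw [contDiffGroupoid, mem_groupoid_of_pregroupoid]
  simp [contDiffPregroupoid]

theorem continuousAffineEquiv_mem_contDiffGroupoid (τ : E ≃ᴬ[ℝ] E) :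
    τ.toHomeomorph.toOpenPartialHomeomorph ∈ contDiffGroupoid ∞ 𝓘(ℝ, E) :=
  mem_contDiffGroupoid_iff.2
    ⟨τ.toContinuousAffineMap.contDiff.contDiffOn, τ.symm.toContinuousAffineMap.contDiff.contDiffOn⟩

theorem trans_mem_maximalAtlas {H M : Type*} [TopologicalSpace H] [TopologicalSpace M]
    [ChartedSpace H M] {G : StructureGroupoid H} {e : OpenPartialHomeomorph M H}
    {φ : OpenPartialHomeomorph H H} (he : e ∈ G.maximalAtlas M) (hφ : φ ∈ G) :
    e ≫ₕ φ ∈ G.maximalAtlas M := by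
  rw [mem_maximalAtlas_iff] at he ⊢
  intro e' he'
  obtain ⟨hleft, hright⟩ := he e' he'
  rw [OpenPartialHomeomorph.trans_symm_eq_symm_trans_symm, OpenPartialHomeomorph.trans_assoc,
    ← OpenPartialHomeomorph.trans_assoc e'.symm]
  exact ⟨G.trans (G.symm hφ) hleft, G.trans hright hφ⟩

theorem exists_mem_contDiffGroupoid_of_injective_fderiv [FiniteDimensional ℝ E] {K : Set E}
    (hK : IsOpen K) {Φ : E → E} (hΦ : ContDiffOn ℝ ∞ Φ K)
    (hinj : ∀ y ∈ K, Function.Injective (fderiv ℝ Φ y)) {x : E} (hx : x ∈ K) :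
    ∃ φ ∈ contDiffGroupoid ∞ 𝓘(ℝ, E), x ∈ φ.source ∧ φ.source ⊆ K ∧ ∀ y, φ y = Φ y := by
  have := FiniteDimensional.complete ℝ E
  have hat (y) (hy : y ∈ K) : ContDiffAt ℝ ∞ Φ y := hΦ.contDiffAt (hK.mem_nhds hy)
  have hequiv (y) (hy : y ∈ K) : ∃ A : E ≃L[ℝ] E, HasFDerivAt Φ (A : E →L[ℝ] E) y :=
    ⟨(LinearEquiv.ofInjectiveEndo (fderiv ℝ Φ y).toLinearMap (hinj y hy)).toContinuousLinearEquiv,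
      ((hat y hy).differentiableAt (by simp)).hasFDerivAt.congr_fderiv (by ext1 u; rfl)⟩
  obtain ⟨A, hA⟩ := hequiv x hx
  set φ := ((hat x hx).toOpenPartialHomeomorph Φ hA (by simp)).restrOpen K hK
  refine ⟨φ, mem_contDiffGroupoid_iff.2 ⟨hΦ.mono fun y hy => hy.2, fun z hz => ?_⟩,
    ⟨(hat x hx).mem_toOpenPartialHomeomorph_source hA (by simp), hx⟩, fun y hy => hy.2,
    fun y => rfl⟩
  have hzK : φ.symm z ∈ K := (φ.map_target hz).2
  obtain ⟨B, hB⟩ := hequiv _ hzK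
  exact (φ.contDiffAt_symm hz hB (hat _ hzK)).contDiffWithinAt

end Groupoid

theorem exists_coordinates {K : Set (EuclideanSpace ℝ (Fin 2))} (hK : IsOpen K)
    {X Y : EuclideanSpace ℝ (Fin 2) → ℝ} (hX : ContDiffOn ℝ ∞ X K) (hY : ContDiffOn ℝ ∞ Y K)
    (hXY : ∀ y ∈ K, ∀ u, fderiv ℝ X y u = 0 → fderiv ℝ Y y u = 0 → u = 0)
    {x : EuclideanSpace ℝ (Fin 2)} (hx : x ∈ K) :
    ∃ φ ∈ contDiffGroupoid ∞ (𝓡 2), x ∈ φ.source ∧ φ.source ⊆ K ∧ ∀ y, φ y = !₂[X y, Y y] := by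
  have hΦ : ContDiffOn ℝ ∞ (fun y => !₂[X y, Y y]) K :=
    contDiffOn_euclidean.2 (Fin.forall_fin_two.2 ⟨hX, hY⟩)
  refine exists_mem_contDiffGroupoid_of_injective_fderiv hK hΦ (fun y hy => ?_) hx
  refine (injective_iff_map_eq_zero _).2 fun u hu => ?_
  have hcoord (k : Fin 2) : fderiv ℝ (fun y => (!₂[X y, Y y] : EuclideanSpace ℝ (Fin 2)) k) y u =
      0 := by
    have hd := (hΦ.contDiffAt (hK.mem_nhds hy)).differentiableAt (by simp)
    have hk : HasFDerivAt (fun y => (!₂[X y, Y y] : EuclideanSpace ℝ (Fin 2)) k) _ y :=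
      (hasFDerivAt_coord k _).comp y hd.hasFDerivAt
    rw [hk.fderiv, ContinuousLinearMap.comp_apply, hu, map_zero]
  exact hXY y hy u (hcoord 0) (hcoord 1)

section Coordinates

variable {M : Type*} [TopologicalSpace M] {L : M → CH21}
  {e : OpenPartialHomeomorph M (EuclideanSpace ℝ (Fin 2))} {i : Fin 3}

theorem isOpen_coordDomain (hL : Continuous L) : IsOpen (coordDomain L e i) :=
  e.symm.isOpen_inter_preimage ((CH21.chart i).open_source.preimage hL)

variable [ChartedSpace (EuclideanSpace ℝ (Fin 2)) M]
  (hL : ContMDiff (𝓡 2) 𝓘(ℝ, Fin 2 → ℂ) ∞ L) (he : e ∈ IsManifold.maximalAtlas (𝓡 2) ∞ M)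
include hL he

theorem contDiffOn_coordMap : ContDiffOn ℝ ∞ (coordMap L e i) (coordDomain L e i) := by
  have hchart : CH21.chart i ∈ IsManifold.maximalAtlas 𝓘(ℝ, Fin 2 → ℂ) ∞ CH21 :=
    IsManifold.subset_maximalAtlas (Set.mem_range_self i)
  exact ((contMDiffOn_of_mem_maximalAtlas hchart).comp
    (hL.comp_contMDiffOn ((contMDiffOn_symm_of_mem_maximalAtlas he).mono fun x hx => hx.1))
    fun x hx => hx.2).contDiffOn

theorem smoothLift_coordMap : SmoothLift (affineLift i (coordMap L e i)) (coordDomain L e i) :=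
  smoothLift_affineLift (isOpen_coordDomain hL.continuous) (contDiffOn_coordMap hL he)
    fun _ hx => (CH21.chart i).map_source hx.2

theorem isSlantAt_zero_of_isSlantWithAngle {α : ℝ} (hmin : IsMinimalSurface L)
    (hα : IsSlantWithAngle L α) {x : EuclideanSpace ℝ (Fin 2)} (hx : x ∈ coordDomain L e i) :
    IsSlantAt (coordMap L e i) i x 0 := by
  have hslant : ∀ y ∈ coordDomain L e i, IsSlantAt (coordMap L e i) i y (Real.sinh α) := hα e he i
  rw [← (smoothLift_coordMap hL he).slant_eq_zero hx hslant (hmin e he i)]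
  exact hslant x hx

omit he in
theorem isLagrangianSurface_of_isSlantSurface (hmin : IsMinimalSurface L)
    (hslant : IsSlantSurface L) : IsLagrangianSurface L := by
  obtain ⟨α, hα⟩ := hslant
  exact fun e he i x hx => (isSlantAt_zero_of_isSlantWithAngle hL he hmin hα hx).isNormalTo
    ((smoothLift_coordMap hL he).differentiableAt_of_affineLift hx)

end Coordinates

end Charts

section Congruence

theorem hopf_eq_hopf_iff {z w : H52} :
    hopf z = hopf w ↔ ∃ c : ℂ, c ≠ 0 ∧ (w : Fin 3 → ℂ) = c • (z : Fin 3 → ℂ) :=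
  Quotient.eq

namespace HermUnitary

theorem congruence_eq_hopf {i : Fin 3} {q : CH21} (hq : q ∈ (CH21.chart i).source)
    {A : HermUnitary} {w : H52} {ρ : ℂ} (hρ : ρ ≠ 0)
    (h : A.1 (ρ • affineVec i (CH21.chart i q)) = w) : A.congruence q = hopf w := by
  have hneg : (hermForm (affineVec i (CH21.chart i q)) (affineVec i (CH21.chart i q))).re < 0 :=
    (CH21.chart i).map_source hq
  have hne := normalizeVec_factor_ne hneg
  have hq' : q = hopf ⟨normalizeVec (affineVec i (CH21.chart i q)), normalizeVec_mem hneg⟩ := by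
    rw [← CH21.ofCoord_eq hneg]
    exact ((CH21.chart i).left_inv hq).symm
  generalize CH21.chart i q = v at *
  subst hq'
  refine hopf_eq_hopf_iff.2 ⟨ρ * _⁻¹, mul_ne_zero hρ (inv_ne_zero hne), ?_⟩
  change _ = _ • A.1 (normalizeVec (affineVec i v))
  rw [← h, normalizeVec, map_smul, map_smul, smul_smul, inv_mul_cancel_right₀ hne]

/-- The unitary map `A ∘ A'⁻¹`, which compares the congruences of `A` and `A'`. -/
def comparison (A A' : HermUnitary) : HermUnitary :=
  ⟨A'.1.symm.trans A.1, fun z w => by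
    rw [LinearEquiv.trans_apply, LinearEquiv.trans_apply, A.2, ← A'.2, A'.1.apply_symm_apply,
      A'.1.apply_symm_apply]⟩

theorem congruence_comparison_congruence (A A' : HermUnitary) (p : CH21) :
    (A.comparison A').congruence (A'.congruence p) = A.congruence p := by
  obtain ⟨z, rfl⟩ := p.exists_rep
  refine congrArg hopf (Subtype.ext ?_)
  exact congrArg A.1 (A'.1.symm_apply_apply z)

end HermUnitary

variable {M : Type*} [TopologicalSpace M] {L : M → CH21} {A A' : HermUnitary}
  {e e' : OpenPartialHomeomorph M (EuclideanSpace ℝ (Fin 2))}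

/-- In the chart `e`, the surface `L` is the explicit surface with `a = 1`, up to the congruence
`A`. -/
def IsExplicitIn (L : M → CH21) (A : HermUnitary)
    (e : OpenPartialHomeomorph M (EuclideanSpace ℝ (Fin 2))) : Prop :=
  ∀ q ∈ e.source, A.congruence (L q) = hopf (tildeL 1 (e q 0) (e q 1))

namespace IsExplicitIn

theorem exists_tildeLVec_eq_smul (h : IsExplicitIn L A e) (h' : IsExplicitIn L A' e')
    {s : EuclideanSpace ℝ (Fin 2)} (hs : s ∈ (e'.symm ≫ₕ e).source) :
    ∃ c : ℂ, tildeLVec 1 ((e'.symm ≫ₕ e) s 0) ((e'.symm ≫ₕ e) s 1) =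
      c • (A.comparison A').1 (tildeLVec 1 (s 0) (s 1)) := by
  rw [OpenPartialHomeomorph.trans_source] at hs
  have hA := h _ hs.2
  have hA' := h' _ (e'.map_target hs.1)
  rw [e'.right_inv hs.1] at hA'
  rw [← A.congruence_comparison_congruence A', hA'] at hA
  obtain ⟨c, -, hc⟩ := hopf_eq_hopf_iff.1 hA
  exact ⟨c, hc⟩

theorem trans_affineEquiv (h' : IsExplicitIn L A' e')
    {τ : EuclideanSpace ℝ (Fin 2) ≃ᴬ[ℝ] EuclideanSpace ℝ (Fin 2)} {c : ℂ}
    (hτ : ∀ s, tildeLVec 1 (τ s 0) (τ s 1) =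
      c • (A.comparison A').1 (tildeLVec 1 (s 0) (s 1))) :
    IsExplicitIn L A (e' ≫ₕ τ.toHomeomorph.toOpenPartialHomeomorph) := by
  intro q hq
  rw [OpenPartialHomeomorph.trans_source] at hq
  rw [← A.congruence_comparison_congruence A', h' q hq.1]
  exact hopf_eq_hopf_iff.2 ⟨c, ne_zero_of_tildeLVec_eq_smul (hτ (e' q)), hτ (e' q)⟩

variable [ChartedSpace (EuclideanSpace ℝ (Fin 2)) M]

theorem exists_chart (h : IsExplicitIn L A e) (h' : IsExplicitIn L A' e')
    (he : e ∈ IsManifold.maximalAtlas (𝓡 2) ∞ M) (he' : e' ∈ IsManifold.maximalAtlas (𝓡 2) ∞ M)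
    {q : M} (hq : q ∈ e.source) (hq' : q ∈ e'.source) :
    ∃ e'' ∈ IsManifold.maximalAtlas (𝓡 2) ∞ M, e''.source = e'.source ∧ IsExplicitIn L A e'' := by
  have hψ := (mem_contDiffGroupoid_iff.1 (IsManifold.compatible_of_mem_maximalAtlas he' he)).1
  have hqψ : e' q ∈ (e'.symm ≫ₕ e).source := by
    rw [OpenPartialHomeomorph.trans_source]
    exact ⟨e'.map_source hq', by rwa [Set.mem_preimage, e'.left_inv hq']⟩
  obtain ⟨r, hr, hrψ⟩ := Metric.isOpen_iff.1 (e'.symm ≫ₕ e).open_source _ hqψ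
  obtain ⟨τ, c, hτ⟩ := exists_affineEquiv_tildeLVec Metric.isOpen_ball
    (convex_ball _ _).isPreconnected (Metric.nonempty_ball.2 hr)
    ((contDiffOn_euclidean.1 hψ 0).mono hrψ) ((contDiffOn_euclidean.1 hψ 1).mono hrψ)
    fun s hs => h.exists_tildeLVec_eq_smul h' (hrψ hs)
  exact ⟨_, trans_mem_maximalAtlas he' (continuousAffineEquiv_mem_contDiffGroupoid τ),
    by simp, h'.trans_affineEquiv hτ⟩

end IsExplicitIn

variable [ChartedSpace (EuclideanSpace ℝ (Fin 2)) M]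

theorem exists_isExplicitIn [IsManifold (𝓡 2) ∞ M]
    (hL : ContMDiff (𝓡 2) 𝓘(ℝ, Fin 2 → ℂ) ∞ L) (hmin : IsMinimalSurface L)
    (hflat : IsFlatSurface L) (hslant : IsSlantSurface L) (p : M) :
    ∃ A : HermUnitary, ∃ e ∈ IsManifold.maximalAtlas (𝓡 2) ∞ M,
      p ∈ e.source ∧ IsExplicitIn L A e := by
  obtain ⟨α, hα⟩ := hslant
  set e := chartAt (EuclideanSpace ℝ (Fin 2)) p
  have he : e ∈ IsManifold.maximalAtlas (𝓡 2) ∞ M := IsManifold.chart_mem_maximalAtlas p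
  have hp : p ∈ e.source := mem_chart_source _ p
  obtain ⟨i, hi⟩ := CH21.exists_mem_source (L p)
  have hx : e p ∈ coordDomain L e i := ⟨e.map_source hp, by rwa [e.left_inv hp]⟩
  obtain ⟨r, hr, hrU, X, Y, ρ, A, hX, hY, hXY, hA⟩ :=
    (smoothLift_coordMap hL he).exists_coordinates_unitary hx (hα e he i) (hmin e he i)
      (hflat e he i)
  obtain ⟨φ, hφ, hxφ, hφK, hφXY⟩ := exists_coordinates Metric.isOpen_ball hX hY hXY
    (Metric.mem_ball_self hr)
  refine ⟨A, e ≫ₕ φ, trans_mem_maximalAtlas he hφ, ?_, fun q hq => ?_⟩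
  · rw [OpenPartialHomeomorph.trans_source]
    exact ⟨hp, hxφ⟩
  rw [OpenPartialHomeomorph.trans_source] at hq
  have hqdomain := (hrU (hφK hq.2)).2
  obtain ⟨hρ, hqA⟩ := hA _ (hφK hq.2)
  rw [affineLift, coordMap, e.left_inv hq.1] at hqA
  rw [e.left_inv hq.1] at hqdomain
  refine HermUnitary.congruence_eq_hopf hqdomain hρ ?_
  rw [hqA, OpenPartialHomeomorph.coe_trans, Function.comp_apply, hφXY]
  rfl

theorem exists_congruence_of_local [ConnectedSpace M]
    (h : ∀ p : M, ∃ A : HermUnitary, ∃ e ∈ IsManifold.maximalAtlas (𝓡 2) ∞ M,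
      p ∈ e.source ∧ IsExplicitIn L A e) :
    ∃ A : HermUnitary, ∀ p : M, ∃ e ∈ IsManifold.maximalAtlas (𝓡 2) ∞ M,
      p ∈ e.source ∧ IsExplicitIn L A e := by
  obtain ⟨p₀⟩ : Nonempty M := inferInstance
  obtain ⟨A, hA⟩ := h p₀
  set S : Set M := {p | ∃ e ∈ IsManifold.maximalAtlas (𝓡 2) ∞ M,
    p ∈ e.source ∧ IsExplicitIn L A e}
  have hopen : IsOpen S := isOpen_iff_forall_mem_open.2 fun p ⟨e, he, hp, hE⟩ =>
    ⟨e.source, fun q hq => ⟨e, he, hq, hE⟩, e.open_source, hp⟩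
  have hclosed : IsClosed S := by
    rw [← isOpen_compl_iff, isOpen_iff_forall_mem_open]
    intro p hp
    obtain ⟨A', e', he', hpe', hE'⟩ := h p
    refine ⟨e'.source, fun q hq' hq => hp ?_, e'.open_source, hpe'⟩
    obtain ⟨e, he, hqe, hE⟩ := hq
    obtain ⟨e'', he'', hsource, hE''⟩ := hE.exists_chart hE' he he' hqe hq'
    exact ⟨e'', he'', hsource ▸ hpe', hE''⟩
  have huniv : S = Set.univ := IsClopen.eq_univ ⟨hclosed, hopen⟩ ⟨p₀, hA⟩
  exact ⟨A, fun p => huniv.symm.subset (Set.mem_univ p)⟩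

end Congruence

end

theorem theorem7p1 {M : Type*} [TopologicalSpace M] [ConnectedSpace M]
    [ChartedSpace (EuclideanSpace ℝ (Fin 2)) M] [IsManifold (𝓡 2) ∞ M]
    (L : M → CH21) (hL : ContMDiff (𝓡 2) 𝓘(ℝ, Fin 2 → ℂ) ∞ L)
    (hmin : IsMinimalSurface L) (hflat : IsFlatSurface L) (hslant : IsSlantSurface L) :
    IsLagrangianSurface L ∧
    ∃ a : ℝ, a ≠ 0 ∧ ∃ A : HermUnitary,
      ∀ p : M, ∃ e ∈ IsManifold.maximalAtlas (𝓡 2) ∞ M, p ∈ e.source ∧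
        ∀ q ∈ e.source, A.congruence (L q) = hopf (tildeL a (e q 0) (e q 1)) := by
  obtain ⟨A, hA⟩ := exists_congruence_of_local (exists_isExplicitIn hL hmin hflat hslant)
  exact ⟨isLagrangianSurface_of_isSlantSurface hL hmin hslant, 1, one_ne_zero, A, hA⟩
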